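/- Let $\mathbb{C}$ denote an algebraically closed field of characteristic $0$ and let $S\cong M_{d_1}(\mathbb{C})\oplus\dots\oplus M_{d_k}(\mathbb{C})$ (all $d_i\ge 1$) be a finite dimensional semisimple algebra with matrix units $e^i_{pq}$. \textbf{The algebra side.} Let $\mathbb{D}\mathrm{er}(S)=\mathrm{Der}(S,S\otimes S)$ be the space of double derivations, i.e. of derivations for the outer bimodule structure $a\cdot(x\otimes y)\cdot b=ax\otimes yb$, made into an $S$-bimodule by the inner structure, $(s\delta t)(u)=\delta(u)'t\otimes s\,\delta(u)''$. Let $\mathbb{D}S=T_S\,\mathbb{D}\mathrm{er}(S)$, graded with $S$ in degree $0$ and $\mathbb{D}\mathrm{er}(S)$ in degree $1$. The double Schouten--Nijenhuis bracket $\{\!\{-,-\}\!\}_s:\mathbb{D}S\otimes\mathbb{D}S\to\mathbb{D}S\otimes\mathbb{D}S$ is the unique bilinear map with, for $s,t\in S$ and $\delta,\Delta\in\mathbb{D}\mathrm{er}(S)$, $$\{\!\{s,t\}\!\}_s=0,\qquad \{\!\{\delta,s\}\!\}_s=\delta(s),\qquad \{\!\{\delta,\Delta\}\!\}_s=\tau_{(23)}\big((\delta\otimes1)\Delta-(1\otimes\Delta)\delta\big)+\tau_{(12)}\big((1\otimes\delta)\Delta-(\Delta\otimes1)\delta\big)$$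 (the two terms being viewed as elements of $\mathbb{D}\mathrm{er}(S)\otimes S$ and $S\otimes\mathbb{D}\mathrm{er}(S)$), and, for homogeneous $a,b$ and all $c$, $$\{\!\{a,bc\}\!\}_s=(-1)^{(|a|-1)|b|}\,b\{\!\{a,c\}\!\}_s+\{\!\{a,b\}\!\}_s\,c,\qquad \{\!\{a,b\}\!\}_s=-(-1)^{(|a|-1)(|b|-1)}\sigma_{(12)}\{\!\{b,a\}\!\}_s,$$ where $\sigma_{(12)}(x\otimes y)=(-1)^{|x||y|}y\otimes x$; such a map exists. For a graded algebra $D$ let $[D,D]_{super}$ be the span of all $ab-(-1)^{|a||b|}ba$ with $a,b$ homogeneous; on the algebra side $[\mathbb{D}S,\mathbb{D}S]$ means $[\mathbb{D}S,\mathbb{D}S]_{super}$. \textbf{The quiver side.} The double derivation quiver $Q_S$ has vertices $1,\dots,k$. The arrows $j\to i$ are labelled by pairs (primary colour $p\in\{1,\dots,d_i\}$, secondary colour $q\in\{1,\dots,d_j\}$), except that for $i=j$ the pair $(1,1)$ does not occur. Thus the primary colour belongs to the head and the secondary colour to the tail. Paths in the path algebra $\mathbb{C}Q_S$ are written from left to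 right, and $\mathbb{C}Q_S$ is graded by path length. Whenever a loop of colour $(1,1)$ at $i$ appears below, it stands for $-\sum_{r=2}^{d_i}$ of the loops of colour $(r,r)$ at $i$. The space of necklaces is $\mathbb{C}Q_S/[\mathbb{C}Q_S,\mathbb{C}Q_S]_{super}$; it is spanned by the classes of the vertices and of the closed words in the arrows. Write $t$ and $h$ for the tail and head of an arrow. \textbf{Theorem.} (a) The bracket $\{-,-\}_s$ induced by multiplying out $\{\!\{-,-\}\!\}_s$ is well defined on $\mathbb{D}S/[\mathbb{D}S,\mathbb{D}S]$ and makes $\mathbb{D}S/[\mathbb{D}S,\mathbb{D}S][1]$ a graded Lie algebra. (b) There is exactly one bilinear bracket on $\mathbb{C}Q_S/[\mathbb{C}Q_S,\mathbb{C}Q_S]_{super}$ that is zero when one of the arguments is a vertex and that is given on closed words $\omega_1=v_1\cdots v_n$ and $\omega_2=u_1\cdots u_m$ by the following cut-and-glue rule: $\{\omega_1,\omega_2\}$ is the sum over all $0\le i<m$, $0\le j<n$ of 1. $-(-1)^{(i+j+1)(n-1)}\,u_1\cdots u_i\,v_{j+2}\cdots v_n\,v_1\cdots v_j\,z\,u_{i+2}\cdots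 u_m$, if $t(u_{i+1})=h(v_{j+1})$ and the secondary colour of $u_{i+1}$ equals the primary colour of $v_{j+1}$, where $z$ is the arrow from $t(v_{j+1})$ to $h(u_{i+1})$ with the primary colour of $u_{i+1}$ and the secondary colour of $v_{j+1}$; 2. $(-1)^{(i+j)(n-1)}\,u_1\cdots u_i\,z\,v_{j+2}\cdots v_n\,v_1\cdots v_j\,u_{i+2}\cdots u_m$, if $h(u_{i+1})=t(v_{j+1})$ and the primary colour of $u_{i+1}$ equals the secondary colour of $v_{j+1}$, where $z$ is the arrow from $t(u_{i+1})$ to $h(v_{j+1})$ with the primary colour of $v_{j+1}$ and the secondary colour of $u_{i+1}$. With this bracket, $\mathbb{C}Q_S/[\mathbb{C}Q_S,\mathbb{C}Q_S]_{super}[1]$ is a graded Lie algebra. (c) $\mathbb{D}S/[\mathbb{D}S,\mathbb{D}S][1]$ with $\{-,-\}_s$ is isomorphic, as a graded Lie algebra, to $\mathbb{C}Q_S/[\mathbb{C}Q_S,\mathbb{C}Q_S]_{super}[1]$ with this bracket. The isomorphism can be chosen so that the vertex $i$ corresponds to $e^i_{11}$, and the class of a closed word corresponds to the class of the product in $\mathbb{D}S$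 of the elements of its arrows. Here the element of the arrow $j\to i$ of colour $(p,q)$ is the double derivation $y\mapsto e^i_{p1}\otimes e^j_{1q}\,y-y\,e^i_{p1}\otimes e^j_{1q}$. -/

import Mathlib

open scoped TensorProduct DirectSum

namespace NecklaceLie

/-! ## Signs, super commutators, graded Lie brackets -/

section Graded

variable (K : Type*) [Field K]

/-- The sign `(-1)^n` in `K`, for an integer exponent `n`. -/
def sgn (n : ℤ) : K := ((n.negOnePow : ℤ) : K)

variable {K} {A : Type*} [Ring A] [Algebra K A]

/-- `[A, A]_super`: the linear span of the super commutators `a b - (-1)^{|a||b|} b a` of the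
homogeneous elements of `A`. -/
def superCommutators (𝒜 : ℕ → Submodule K A) : Submodule K A :=
  Submodule.span K {x | ∃ p q : ℕ, ∃ a ∈ 𝒜 p, ∃ b ∈ 𝒜 q,
    x = a * b - sgn K ((p : ℤ) * q) • (b * a)}

/-- The quotient space `A / [A, A]_super`. -/
abbrev SuperCyclic (𝒜 : ℕ → Submodule K A) : Type _ := A ⧸ superCommutators 𝒜

/-- The class in `A / [A, A]_super` of an element of `A`. -/
abbrev cyc (𝒜 : ℕ → Submodule K A) : A →ₗ[K] SuperCyclic 𝒜 := (superCommutators 𝒜).mkQ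

/-- The grading of the shifted space `(A / [A, A]_super)[1]`: its part of degree `p` is the image
of the part of `A` of degree `p + 1` (which is zero if `p + 1` is negative). -/
def shiftedGrading (𝒜 : ℕ → Submodule K A) (p : ℤ) : Submodule K (SuperCyclic 𝒜) :=
  if 0 ≤ p + 1 then (𝒜 (p + 1).toNat).map (cyc 𝒜) else ⊥

/-- `(V, 𝒱, L)` is a graded Lie algebra: `𝒱` is a grading of `V`, and `L` is a bracket of degree
zero that is graded antisymmetric and satisfies the graded Jacobi identity. -/
structure IsGradedLie {V : Type*} [AddCommGroup V] [Module K V] (𝒱 : ℤ → Submodule K V)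
    (L : V →ₗ[K] V →ₗ[K] V) : Prop where
  isInternal : DirectSum.IsInternal 𝒱
  bracket_mem : ∀ p q : ℤ, ∀ x ∈ 𝒱 p, ∀ y ∈ 𝒱 q, L x y ∈ 𝒱 (p + q)
  antisymm : ∀ p q : ℤ, ∀ x ∈ 𝒱 p, ∀ y ∈ 𝒱 q, L x y = -(sgn K (p * q) • L y x)
  jacobi : ∀ p q : ℤ, ∀ x ∈ 𝒱 p, ∀ y ∈ 𝒱 q, ∀ z : V,
    L x (L y z) = L (L x y) z + sgn K (p * q) • L y (L x z)

end Graded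

/-! ## Double derivations and the tensor algebra `T_A Der(A, A ⊗ A)` -/

section DoubleDerivations

variable (K A : Type*) [Field K] [Ring A] [Algebra K A]

/-- The double derivations of `A`: the derivations `A → A ⊗ A` for the outer bimodule structure
`a · (x ⊗ y) · b = (a x) ⊗ (y b)`. In terms of the algebra `A ⊗ A` the outer action is
`a · ξ · b = (a ⊗ 1) ξ (1 ⊗ b)`. -/
def DDer : Submodule K (A →ₗ[K] A ⊗[K] A) where
  carrier := {δ | ∀ a b : A, δ (a * b) = (a ⊗ₜ[K] 1) * δ b + δ a * (1 ⊗ₜ[K] b)}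
  zero_mem' := by intro a b; simp
  add_mem' := by
    intro δ ε hδ hε a b
    simp only [LinearMap.add_apply, hδ a b, hε a b, mul_add, add_mul]
    abel
  smul_mem' := by
    intro c δ hδ a b
    simp only [LinearMap.smul_apply, hδ a b, smul_add, mul_smul_comm, smul_mul_assoc]

variable {K A}

/-- The left action on double derivations that comes from the inner bimodule structure
`s ∘ (x ⊗ y) ∘ t = (x t) ⊗ (s y)`: `(s δ)(u) = δ(u)' ⊗ s δ(u)''`. -/
def DDer.lact (s : A) (δ : DDer K A) : DDer K A :=
  ⟨LinearMap.mulLeft K ((1 : A) ⊗ₜ[K] s) ∘ₗ δ.1, by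
    intro a b
    have h := δ.2 a b
    simp only [LinearMap.comp_apply, LinearMap.mulLeft_apply, h, mul_add, ← mul_assoc,
      Algebra.TensorProduct.tmul_mul_tmul, one_mul, mul_one]⟩

/-- The right action on double derivations that comes from the inner bimodule structure:
`(δ t)(u) = δ(u)' t ⊗ δ(u)''`. -/
def DDer.ract (δ : DDer K A) (t : A) : DDer K A :=
  ⟨LinearMap.mulRight K (t ⊗ₜ[K] (1 : A)) ∘ₗ δ.1, by
    intro a b
    have h := δ.2 a b
    simp only [LinearMap.comp_apply, LinearMap.mulRight_apply, h, add_mul, mul_assoc,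
      Algebra.TensorProduct.tmul_mul_tmul, one_mul, mul_one]⟩

/-- The inner double derivation of `ξ = ξ' ⊗ ξ''`: `y ↦ ξ' ⊗ ξ'' y - y ξ' ⊗ ξ''`. -/
def DDer.inner (ξ : A ⊗[K] A) : DDer K A :=
  ⟨LinearMap.mulLeft K ξ ∘ₗ TensorProduct.mk K A A 1
      - LinearMap.mulRight K ξ ∘ₗ (TensorProduct.mk K A A).flip 1, by
    intro a b
    have h1 : (1 : A) ⊗ₜ[K] (a * b) = (1 ⊗ₜ[K] a) * (1 ⊗ₜ[K] b) := by simp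
    have h2 : (a * b) ⊗ₜ[K] (1 : A) = (a ⊗ₜ[K] 1) * (b ⊗ₜ[K] 1) := by simp
    simp only [LinearMap.sub_apply, LinearMap.comp_apply, LinearMap.mulLeft_apply,
      LinearMap.mulRight_apply, TensorProduct.mk_apply, LinearMap.flip_apply, h1, h2]
    noncomm_ring⟩

variable (K A)

/-- The relations that cut the tensor algebra `T_A M`, for the bimodule `M = Der(A, A ⊗ A)` with
the inner action, out of the free tensor algebra `T_K (A × M)`. -/
inductive TensorRel : TensorAlgebra K (A × DDer K A) → TensorAlgebra K (A × DDer K A) → Prop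
  | one : TensorRel (TensorAlgebra.ι K ((1 : A), 0)) 1
  | mul (a b : A) : TensorRel (TensorAlgebra.ι K (a * b, 0))
      (TensorAlgebra.ι K (a, 0) * TensorAlgebra.ι K (b, 0))
  | left (a : A) (δ : DDer K A) : TensorRel (TensorAlgebra.ι K (0, DDer.lact a δ))
      (TensorAlgebra.ι K (a, 0) * TensorAlgebra.ι K (0, δ))
  | right (δ : DDer K A) (a : A) : TensorRel (TensorAlgebra.ι K (0, DDer.ract δ a))
      (TensorAlgebra.ι K (0, δ) * TensorAlgebra.ι K (a, 0))

/-- The tensor algebra `𝔻A = T_A Der(A, A ⊗ A)`. -/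
def DAlg : Type _ := RingQuot (TensorRel K A)

noncomputable instance : Ring (DAlg K A) := inferInstanceAs (Ring (RingQuot (TensorRel K A)))

noncomputable instance : Algebra K (DAlg K A) :=
  inferInstanceAs (Algebra K (RingQuot (TensorRel K A)))

/-- The quotient map `T_K (A × Der(A, A ⊗ A)) → 𝔻A`. -/
noncomputable def DAlg.mk : TensorAlgebra K (A × DDer K A) →ₐ[K] DAlg K A :=
  RingQuot.mkAlgHom K (TensorRel K A)

/-- The canonical map `A → 𝔻A`. -/
noncomputable def DAlg.ofA : A →ₗ[K] DAlg K A :=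
  (DAlg.mk K A).toLinearMap ∘ₗ TensorAlgebra.ι K ∘ₗ LinearMap.inl K A (DDer K A)

/-- The canonical map `Der(A, A ⊗ A) → 𝔻A`. -/
noncomputable def DAlg.ofD : DDer K A →ₗ[K] DAlg K A :=
  (DAlg.mk K A).toLinearMap ∘ₗ TensorAlgebra.ι K ∘ₗ LinearMap.inr K A (DDer K A)

/-- The part of `𝔻A` of degree `n`, where `A` has degree `0` and `Der(A, A ⊗ A)` has degree `1`:
it is spanned by the products `a δ₁ ⋯ δₙ`. -/
noncomputable def DAlg.deg (n : ℕ) : Submodule K (DAlg K A) :=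
  LinearMap.range (DAlg.ofA K A) * LinearMap.range (DAlg.ofD K A) ^ n

end DoubleDerivations

section DAlgLemmas

variable {K A : Type*} [Field K] [Ring A] [Algebra K A]

theorem DAlg.ofA_one : DAlg.ofA K A 1 = 1 := by
  have := RingQuot.mkAlgHom_rel K (TensorRel.one (K := K) (A := A))
  rw [map_one] at this
  exact this

theorem DAlg.ofA_mul (a b : A) :
    DAlg.ofA K A (a * b) = DAlg.ofA K A a * DAlg.ofA K A b := by
  have := RingQuot.mkAlgHom_rel K (TensorRel.mul (K := K) a b)
  rw [map_mul] at this
  exact this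

theorem DAlg.ofD_lact (a : A) (δ : DDer K A) :
    DAlg.ofD K A (DDer.lact a δ) = DAlg.ofA K A a * DAlg.ofD K A δ := by
  have := RingQuot.mkAlgHom_rel K (TensorRel.left (K := K) a δ)
  rw [map_mul] at this
  exact this

theorem DAlg.ofD_ract (δ : DDer K A) (a : A) :
    DAlg.ofD K A (DDer.ract δ a) = DAlg.ofD K A δ * DAlg.ofA K A a := by
  have := RingQuot.mkAlgHom_rel K (TensorRel.right (K := K) δ a)
  rw [map_mul] at this
  exact this

theorem DAlg.one_le_range_ofA : (1 : Submodule K (DAlg K A)) ≤ LinearMap.range (DAlg.ofA K A) :=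
  Submodule.one_le.2 ⟨1, DAlg.ofA_one⟩

theorem DAlg.ofA_mem (a : A) : DAlg.ofA K A a ∈ DAlg.deg K A 0 := by
  rw [DAlg.deg, pow_zero, mul_one]
  exact LinearMap.mem_range_self _ a

theorem DAlg.ofD_mem (δ : DDer K A) : DAlg.ofD K A δ ∈ DAlg.deg K A 1 := by
  rw [DAlg.deg, pow_one, ← one_mul (DAlg.ofD K A δ), ← DAlg.ofA_one]
  exact Submodule.mul_mem_mul (LinearMap.mem_range_self _ _) (LinearMap.mem_range_self _ _)

theorem DAlg.range_ofA_mul_self :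
    LinearMap.range (DAlg.ofA K A) * LinearMap.range (DAlg.ofA K A)
      ≤ LinearMap.range (DAlg.ofA K A) := by
  rw [Submodule.mul_le]
  rintro _ ⟨a, rfl⟩ _ ⟨b, rfl⟩
  exact ⟨a * b, DAlg.ofA_mul a b⟩

theorem DAlg.range_pow_mul (n : ℕ) :
    LinearMap.range (DAlg.ofD K A) ^ n * LinearMap.range (DAlg.ofA K A)
      ≤ LinearMap.range (DAlg.ofA K A) * LinearMap.range (DAlg.ofD K A) ^ n := by
  cases n with
  | zero => simp
  | succ n =>
    have h : LinearMap.range (DAlg.ofD K A) * LinearMap.range (DAlg.ofA K A)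
        ≤ LinearMap.range (DAlg.ofD K A) := by
      rw [Submodule.mul_le]
      rintro _ ⟨δ, rfl⟩ _ ⟨a, rfl⟩
      exact ⟨DDer.ract δ a, DAlg.ofD_ract δ a⟩
    calc LinearMap.range (DAlg.ofD K A) ^ (n + 1) * LinearMap.range (DAlg.ofA K A)
        = LinearMap.range (DAlg.ofD K A) ^ n *
            (LinearMap.range (DAlg.ofD K A) * LinearMap.range (DAlg.ofA K A)) := by
          rw [pow_succ, mul_assoc]
      _ ≤ LinearMap.range (DAlg.ofD K A) ^ (n + 1) := by
          rw [pow_succ]; exact mul_le_mul' le_rfl h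
      _ = 1 * LinearMap.range (DAlg.ofD K A) ^ (n + 1) := (one_mul _).symm
      _ ≤ _ := mul_le_mul' DAlg.one_le_range_ofA le_rfl

instance DAlg.gradedMonoid : SetLike.GradedMonoid (DAlg.deg K A) where
  one_mem := by rw [← DAlg.ofA_one]; exact DAlg.ofA_mem 1
  mul_mem := by
    intro i j x y hx hy
    have h : DAlg.deg K A i * DAlg.deg K A j ≤ DAlg.deg K A (i + j) := by
      simp only [DAlg.deg]
      calc LinearMap.range (DAlg.ofA K A) * LinearMap.range (DAlg.ofD K A) ^ i *
            (LinearMap.range (DAlg.ofA K A) * LinearMap.range (DAlg.ofD K A) ^ j)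
          = LinearMap.range (DAlg.ofA K A) * (LinearMap.range (DAlg.ofD K A) ^ i *
            LinearMap.range (DAlg.ofA K A)) * LinearMap.range (DAlg.ofD K A) ^ j := by
            simp only [mul_assoc]
        _ ≤ LinearMap.range (DAlg.ofA K A) * (LinearMap.range (DAlg.ofA K A) *
            LinearMap.range (DAlg.ofD K A) ^ i) * LinearMap.range (DAlg.ofD K A) ^ j :=
            mul_le_mul' (mul_le_mul' le_rfl (DAlg.range_pow_mul i)) le_rfl
        _ = LinearMap.range (DAlg.ofA K A) * LinearMap.range (DAlg.ofA K A) *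
            LinearMap.range (DAlg.ofD K A) ^ (i + j) := by
            simp only [mul_assoc, pow_add]
        _ ≤ _ := mul_le_mul' DAlg.range_ofA_mul_self le_rfl
    exact h (Submodule.mul_mem_mul hx hy)

/-- The generators of `𝔻A`, placed in their degrees. -/
noncomputable def DAlg.decompGen : A × DDer K A →ₗ[K] ⨁ n, DAlg.deg K A n :=
  (DirectSum.lof K ℕ (fun n => DAlg.deg K A n) 0 ∘ₗ
      (DAlg.ofA K A).codRestrict _ DAlg.ofA_mem).coprod
    (DirectSum.lof K ℕ (fun n => DAlg.deg K A n) 1 ∘ₗ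
      (DAlg.ofD K A).codRestrict _ DAlg.ofD_mem)

theorem DAlg.decompGen_ofA (a : A) : DAlg.decompGen (K := K) (a, 0) =
    DirectSum.of (fun n => DAlg.deg K A n) 0 ⟨DAlg.ofA K A a, DAlg.ofA_mem a⟩ := by
  simp only [DAlg.decompGen, LinearMap.coprod_apply, map_zero, add_zero, LinearMap.comp_apply,
    DirectSum.lof_eq_of]
  rfl

theorem DAlg.decompGen_ofD (δ : DDer K A) : DAlg.decompGen (K := K) (0, δ) =
    DirectSum.of (fun n => DAlg.deg K A n) 1 ⟨DAlg.ofD K A δ, DAlg.ofD_mem δ⟩ := by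
  simp only [DAlg.decompGen, LinearMap.coprod_apply, map_zero, zero_add, LinearMap.comp_apply,
    DirectSum.lof_eq_of]
  rfl

/-- The map that decomposes `𝔻A` into its homogeneous parts. -/
noncomputable def DAlg.decompAux : DAlg K A →ₐ[K] ⨁ n, DAlg.deg K A n :=
  RingQuot.liftAlgHom K ⟨TensorAlgebra.lift K DAlg.decompGen, by
    intro x y h
    cases h with
    | one =>
      rw [TensorAlgebra.lift_ι_apply, map_one, DAlg.decompGen_ofA]
      exact DirectSum.of_eq_of_gradedMonoid_eq (Sigma.subtype_ext rfl DAlg.ofA_one)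
    | mul a b =>
      simp only [map_mul, TensorAlgebra.lift_ι_apply, DAlg.decompGen_ofA, DirectSum.of_mul_of]
      exact DirectSum.of_eq_of_gradedMonoid_eq (Sigma.subtype_ext rfl (DAlg.ofA_mul a b))
    | left a δ =>
      simp only [map_mul, TensorAlgebra.lift_ι_apply, DAlg.decompGen_ofA, DAlg.decompGen_ofD,
        DirectSum.of_mul_of]
      exact DirectSum.of_eq_of_gradedMonoid_eq (Sigma.subtype_ext rfl (DAlg.ofD_lact a δ))
    | right δ a =>
      simp only [map_mul, TensorAlgebra.lift_ι_apply, DAlg.decompGen_ofA, DAlg.decompGen_ofD,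
        DirectSum.of_mul_of]
      exact DirectSum.of_eq_of_gradedMonoid_eq (Sigma.subtype_ext rfl (DAlg.ofD_ract δ a))⟩

theorem DAlg.decompAux_mk (x : TensorAlgebra K (A × DDer K A)) :
    DAlg.decompAux (DAlg.mk K A x) = TensorAlgebra.lift K DAlg.decompGen x :=
  RingQuot.liftAlgHom_mkAlgHom_apply _ _ _ _

theorem DAlg.decompAux_ofA (a : A) : DAlg.decompAux (DAlg.ofA K A a) =
    DirectSum.of (fun n => DAlg.deg K A n) 0 ⟨DAlg.ofA K A a, DAlg.ofA_mem a⟩ := by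
  rw [← DAlg.decompGen_ofA, ← TensorAlgebra.lift_ι_apply (R := K) DAlg.decompGen,
    ← DAlg.decompAux_mk]
  rfl

theorem DAlg.decompAux_ofD (δ : DDer K A) : DAlg.decompAux (DAlg.ofD K A δ) =
    DirectSum.of (fun n => DAlg.deg K A n) 1 ⟨DAlg.ofD K A δ, DAlg.ofD_mem δ⟩ := by
  rw [← DAlg.decompGen_ofD, ← TensorAlgebra.lift_ι_apply (R := K) DAlg.decompGen,
    ← DAlg.decompAux_mk]
  rfl

theorem DAlg.decompAux_of_mem (n : ℕ) : ∀ x, ∀ hx : x ∈ DAlg.deg K A n,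
    DAlg.decompAux x = DirectSum.of (fun n => DAlg.deg K A n) n ⟨x, hx⟩ := by
  have hadd : ∀ (m : ℕ) (x y : DAlg K A) (hx : x ∈ DAlg.deg K A m) (hy : y ∈ DAlg.deg K A m),
      DAlg.decompAux x = DirectSum.of (fun n => DAlg.deg K A n) m ⟨x, hx⟩ →
      DAlg.decompAux y = DirectSum.of (fun n => DAlg.deg K A n) m ⟨y, hy⟩ →
      ∀ h : x + y ∈ DAlg.deg K A m,
      DAlg.decompAux (x + y) = DirectSum.of (fun n => DAlg.deg K A n) m ⟨x + y, h⟩ := by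
    intro m x y hx hy h1 h2 h
    rw [map_add, h1, h2, ← map_add]
    rfl
  have hmul : ∀ (m k : ℕ) (x y : DAlg K A) (hx : x ∈ DAlg.deg K A m) (hy : y ∈ DAlg.deg K A k),
      DAlg.decompAux x = DirectSum.of (fun n => DAlg.deg K A n) m ⟨x, hx⟩ →
      DAlg.decompAux y = DirectSum.of (fun n => DAlg.deg K A n) k ⟨y, hy⟩ →
      ∀ h : x * y ∈ DAlg.deg K A (m + k),
      DAlg.decompAux (x * y) = DirectSum.of (fun n => DAlg.deg K A n) (m + k) ⟨x * y, h⟩ := by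
    intro m k x y hx hy h1 h2 h
    rw [map_mul, h1, h2, DirectSum.of_mul_of]
    rfl
  induction n with
  | zero =>
    intro x hx
    have hx' := hx
    rw [DAlg.deg, pow_zero, mul_one] at hx'
    obtain ⟨a, rfl⟩ := hx'
    exact DAlg.decompAux_ofA a
  | succ n ih =>
    intro x hx
    have hx' := hx
    rw [DAlg.deg, pow_succ, ← mul_assoc] at hx'
    have key : ∀ h : x ∈ DAlg.deg K A (n + 1),
        DAlg.decompAux x = DirectSum.of (fun n => DAlg.deg K A n) (n + 1) ⟨x, h⟩ := by
      induction hx' using Submodule.mul_induction_on' with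
      | mem_mul_mem y hy z hz =>
        obtain ⟨δ, rfl⟩ := hz
        exact hmul n 1 y _ hy (DAlg.ofD_mem δ) (ih y hy) (DAlg.decompAux_ofD δ)
      | add y hy z hz ihy ihz =>
        have hy' : y ∈ DAlg.deg K A (n + 1) := by
          rw [DAlg.deg, pow_succ, ← mul_assoc]; exact hy
        have hz' : z ∈ DAlg.deg K A (n + 1) := by
          rw [DAlg.deg, pow_succ, ← mul_assoc]; exact hz
        exact hadd (n + 1) y z hy' hz' (ihy hy' hy') (ihz hz' hz')
    exact key hx

/-- `𝔻A` is a graded algebra. -/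
noncomputable instance DAlg.gradedAlgebra : GradedAlgebra (DAlg.deg K A) :=
  GradedAlgebra.ofAlgHom _ DAlg.decompAux
    (by
      apply RingQuot.ringQuot_ext'
      apply TensorAlgebra.hom_ext
      apply LinearMap.prod_ext
      · ext a
        change DirectSum.coeAlgHom (DAlg.deg K A) (DAlg.decompAux (DAlg.ofA K A a)) = _
        rw [DAlg.decompAux_ofA, DirectSum.coeAlgHom_of]
        rfl
      · ext δ
        change DirectSum.coeAlgHom (DAlg.deg K A) (DAlg.decompAux (DAlg.ofD K A δ)) = _
        rw [DAlg.decompAux_ofD, DirectSum.coeAlgHom_of]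
        rfl)
    (fun n x => DAlg.decompAux_of_mem n x.1 x.2)

end DAlgLemmas

/-! ## The double Schouten-Nijenhuis bracket -/

section Schouten

variable {K A : Type*} [Field K] [Ring A] [Algebra K A]

/-- The graded flip `σ₍₁₂₎` of `𝔻A ⊗ 𝔻A`: `a ⊗ b ↦ (-1)^{|a||b|} b ⊗ a`. -/
noncomputable def gradedFlip : DAlg K A ⊗[K] DAlg K A ≃ₗ[K] DAlg K A ⊗[K] DAlg K A :=
  TensorProduct.congr (DirectSum.decomposeLinearEquiv (DAlg.deg K A))
      (DirectSum.decomposeLinearEquiv (DAlg.deg K A)) ≪≫ₗ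
    TensorProduct.gradedComm K (fun n => DAlg.deg K A n) (fun n => DAlg.deg K A n) ≪≫ₗ
    (TensorProduct.congr (DirectSum.decomposeLinearEquiv (DAlg.deg K A))
      (DirectSum.decomposeLinearEquiv (DAlg.deg K A))).symm

/-- Evaluation of double derivations at `z`. -/
def DDer.evalAt (z : A) : DDer K A →ₗ[K] A ⊗[K] A := LinearMap.applyₗ z ∘ₗ (DDer K A).subtype

/-- `{{δ, Δ}}_l~ = (δ ⊗ 1) Δ - (1 ⊗ Δ) δ : A → A ⊗ A ⊗ A`. -/
noncomputable def DDer.tildeL (δ Δ : DDer K A) : A →ₗ[K] (A ⊗[K] A) ⊗[K] A :=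
  δ.1.rTensor A ∘ₗ Δ.1 - (TensorProduct.assoc K A A A).symm.toLinearMap ∘ₗ Δ.1.lTensor A ∘ₗ δ.1

/-- `{{δ, Δ}}_r~ = (1 ⊗ δ) Δ - (Δ ⊗ 1) δ : A → A ⊗ A ⊗ A`. -/
noncomputable def DDer.tildeR (δ Δ : DDer K A) : A →ₗ[K] A ⊗[K] (A ⊗[K] A) :=
  δ.1.lTensor A ∘ₗ Δ.1 - (TensorProduct.assoc K A A A).toLinearMap ∘ₗ Δ.1.rTensor A ∘ₗ δ.1

/-- `B = {{-,-}}` is the double Schouten-Nijenhuis bracket of `𝔻A`: it has the prescribed values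
on the generators and obeys the graded derivation rule (for the outer bimodule structure of
`𝔻A ⊗ 𝔻A`) and graded antisymmetry. The two components of `{{δ, Δ}}` are the elements `l` of
`Der(A, A ⊗ A) ⊗ A` and `r` of `A ⊗ Der(A, A ⊗ A)` that, as maps `A → A ⊗ A ⊗ A`, equal
`τ₍₂₃₎ {{δ, Δ}}_l~` and `τ₍₁₂₎ {{δ, Δ}}_r~`. -/
structure IsDoubleSchouten
    (B : DAlg K A →ₗ[K] DAlg K A →ₗ[K] DAlg K A ⊗[K] DAlg K A) : Prop where
  ofA_ofA : ∀ s t : A, B (DAlg.ofA K A s) (DAlg.ofA K A t) = 0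
  ofD_ofA : ∀ (δ : DDer K A) (s : A), B (DAlg.ofD K A δ) (DAlg.ofA K A s) =
    TensorProduct.map (DAlg.ofA K A) (DAlg.ofA K A) (δ.1 s)
  ofD_ofD : ∀ δ Δ : DDer K A, ∃ (l : DDer K A ⊗[K] A) (r : A ⊗[K] DDer K A),
    (∀ z : A, (DDer.evalAt z).rTensor A l =
      TensorProduct.rightComm K A A A (DDer.tildeL δ Δ z)) ∧
    (∀ z : A, (DDer.evalAt z).lTensor A r =
      TensorProduct.leftComm K A A A (DDer.tildeR δ Δ z)) ∧
    B (DAlg.ofD K A δ) (DAlg.ofD K A Δ) =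
      TensorProduct.map (DAlg.ofD K A) (DAlg.ofA K A) l +
      TensorProduct.map (DAlg.ofA K A) (DAlg.ofD K A) r
  leibniz : ∀ p q : ℕ, ∀ a ∈ DAlg.deg K A p, ∀ b ∈ DAlg.deg K A q, ∀ c : DAlg K A,
    B a (b * c) = sgn K (((p : ℤ) - 1) * q) • ((b ⊗ₜ[K] 1) * B a c) + B a b * (1 ⊗ₜ[K] c)
  antisymm : ∀ p q : ℕ, ∀ a ∈ DAlg.deg K A p, ∀ b ∈ DAlg.deg K A q,
    B a b = -(sgn K (((p : ℤ) - 1) * ((q : ℤ) - 1)) • gradedFlip (B b a))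

end Schouten

/-! ## Path algebras -/

section PathAlgebra

/-- The path algebra of a quiver: the vector space on the set of all paths. -/
def PathAlgebra (K V : Type*) [Field K] [Quiver V] : Type _ :=
  (Σ a b : V, Quiver.Path a b) →₀ K

variable {K V : Type*} [Field K] [Quiver V]

noncomputable instance : AddCommGroup (PathAlgebra K V) :=
  inferInstanceAs (AddCommGroup ((Σ a b : V, Quiver.Path a b) →₀ K))

noncomputable instance : Module K (PathAlgebra K V) :=
  inferInstanceAs (Module K ((Σ a b : V, Quiver.Path a b) →₀ K))

variable (K) in
/-- A path, as a basis element of the path algebra. -/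
noncomputable def PathAlgebra.path {a b : V} (p : Quiver.Path a b) : PathAlgebra K V :=
  Finsupp.single ⟨a, b, p⟩ 1

theorem PathAlgebra.hom_ext {M : Type*} [AddCommGroup M] [Module K M]
    {f g : PathAlgebra K V →ₗ[K] M}
    (h : ∀ (a b : V) (p : Quiver.Path a b), f (path K p) = g (path K p)) : f = g :=
  Finsupp.lhom_ext' fun ⟨a, b, p⟩ => LinearMap.ext_ring (h a b p)

/-- The linear map with given values on the paths. -/
noncomputable def PathAlgebra.lift {M : Type*} [AddCommGroup M] [Module K M]
    (f : (Σ a b : V, Quiver.Path a b) → M) : PathAlgebra K V →ₗ[K] M :=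
  Finsupp.lift M K _ f

theorem PathAlgebra.lift_path {M : Type*} [AddCommGroup M] [Module K M]
    (f : (Σ a b : V, Quiver.Path a b) → M) {a b : V} (p : Quiver.Path a b) :
    lift f (path K p) = f ⟨a, b, p⟩ := by
  have h := Finsupp.sum_single_index (a := (⟨a, b, p⟩ : Σ a b : V, Quiver.Path a b)) (b := (1 : K))
    (h := fun x r => r • f x) (zero_smul K _)
  exact h.trans (one_smul K _)

section

variable [Fintype V]

noncomputable instance : One (PathAlgebra K V) :=
  ⟨∑ a : V, PathAlgebra.path K (Quiver.Path.nil : Quiver.Path a a)⟩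

theorem PathAlgebra.one_def :
    (1 : PathAlgebra K V) = ∑ a : V, path K (Quiver.Path.nil : Quiver.Path a a) := rfl

end

variable [DecidableEq V]

/-- The product of two paths: the first followed by the second if the first ends where the second
begins, and zero otherwise. -/
noncomputable def PathAlgebra.mulPath (p q : Σ a b : V, Quiver.Path a b) : PathAlgebra K V :=
  if h : p.2.1 = q.1 then path K (p.2.2.comp (q.2.2.cast h.symm rfl)) else 0

/-- The multiplication of the path algebra, as a bilinear map. -/
noncomputable def PathAlgebra.mulLin :
    PathAlgebra K V →ₗ[K] PathAlgebra K V →ₗ[K] PathAlgebra K V :=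
  lift fun p => lift fun q => mulPath p q

noncomputable instance : Mul (PathAlgebra K V) := ⟨fun x y => PathAlgebra.mulLin x y⟩

theorem PathAlgebra.mul_def (x y : PathAlgebra K V) : x * y = mulLin x y := rfl

theorem PathAlgebra.mulLin_path_path {a b c e : V} (p : Quiver.Path a b) (q : Quiver.Path c e) :
    mulLin (path K p) (path K q) = mulPath ⟨a, b, p⟩ ⟨c, e, q⟩ := by
  rw [mulLin, lift_path, lift_path]

theorem PathAlgebra.path_mul_path {a b c e : V} (p : Quiver.Path a b) (q : Quiver.Path c e) :
    path K p * path K q = mulPath ⟨a, b, p⟩ ⟨c, e, q⟩ := by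
  rw [mul_def, mulLin_path_path]

theorem PathAlgebra.path_mul_comp {a b c : V} (p : Quiver.Path a b) (q : Quiver.Path b c) :
    path K p * path K q = path K (p.comp q) := by
  simp [path_mul_path, mulPath]

theorem PathAlgebra.path_mul_ne {a b c e : V} (p : Quiver.Path a b) (q : Quiver.Path c e)
    (h : b ≠ c) : path K p * path K q = 0 := by
  simp [path_mul_path, mulPath, h]

theorem PathAlgebra.mul_assoc' (x y z : PathAlgebra K V) : x * y * z = x * (y * z) := by
  have h : (LinearMap.llcomp K _ _ _ (mulLin (K := K) (V := V))) ∘ₗ mulLin =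
      (LinearMap.llcomp K _ _ _).flip mulLin ∘ₗ
        (LinearMap.llcomp K (PathAlgebra K V) _ (PathAlgebra K V)) ∘ₗ
          mulLin (K := K) (V := V) := by
    apply hom_ext; intro a b p
    apply hom_ext; intro c e q
    apply hom_ext; intro f g r
    change path K p * path K q * path K r = path K p * (path K q * path K r)
    by_cases h1 : b = c
    · subst h1
      by_cases h2 : e = f
      · subst h2
        simp only [path_mul_comp, Quiver.Path.comp_assoc]
      · rw [path_mul_comp, path_mul_ne _ _ h2, path_mul_ne _ _ h2]
        exact (map_zero (mulLin (path K p))).symm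
    · rw [path_mul_ne _ _ h1]
      have h0 : (0 : PathAlgebra K V) * path K r = 0 := by
        rw [mul_def, map_zero, LinearMap.zero_apply]
      rw [h0]
      by_cases h2 : e = f
      · subst h2
        rw [path_mul_comp, path_mul_ne _ _ h1]
      · rw [path_mul_ne _ _ h2]
        exact (map_zero (mulLin (path K p))).symm
  exact LinearMap.congr_fun (LinearMap.congr_fun (LinearMap.congr_fun h x) y) z

variable [Fintype V]

theorem PathAlgebra.one_mul' (x : PathAlgebra K V) : 1 * x = x := by
  have h : mulLin (1 : PathAlgebra K V) = LinearMap.id := by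
    apply hom_ext
    intro a b p
    rw [one_def, map_sum, LinearMap.sum_apply, Finset.sum_eq_single a]
    · rw [← mul_def, path_mul_comp]; simp
    · intro c _ hc
      rw [← mul_def, path_mul_ne _ _ hc]
    · simp
  rw [mul_def, h]; rfl

theorem PathAlgebra.mul_one' (x : PathAlgebra K V) : x * 1 = x := by
  have h : (mulLin (K := K) (V := V)).flip 1 = LinearMap.id := by
    apply hom_ext
    intro a b p
    rw [LinearMap.flip_apply, one_def, map_sum, Finset.sum_eq_single b]
    · rw [← mul_def, path_mul_comp]; simp
    · intro c _ hc
      rw [← mul_def, path_mul_ne _ _ hc.symm]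
    · simp
  rw [mul_def, ← LinearMap.flip_apply, h]; rfl

noncomputable instance : Ring (PathAlgebra K V) :=
  { (inferInstance : AddCommGroup (PathAlgebra K V)) with
    mul := (· * ·)
    one := 1
    left_distrib := fun x y z => map_add (PathAlgebra.mulLin x) y z
    right_distrib := fun x y z => by
      change PathAlgebra.mulLin (x + y) z = _
      rw [map_add]; rfl
    zero_mul := fun x => by
      change PathAlgebra.mulLin 0 x = 0
      rw [map_zero]; rfl
    mul_zero := fun x => map_zero (PathAlgebra.mulLin x)
    mul_assoc := PathAlgebra.mul_assoc'
    one_mul := PathAlgebra.one_mul'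
    mul_one := PathAlgebra.mul_one' }

noncomputable instance : Algebra K (PathAlgebra K V) :=
  Algebra.ofModule
    (fun r x y => by
      change PathAlgebra.mulLin (r • x) y = r • PathAlgebra.mulLin x y
      rw [map_smul]; rfl)
    (fun r x y => map_smul (PathAlgebra.mulLin x) r y)

variable (K V)

/-- The part of the path algebra that is spanned by the paths of length `n`. -/
noncomputable def PathAlgebra.deg (n : ℕ) : Submodule K (PathAlgebra K V) :=
  Submodule.span K {x | ∃ (a b : V) (p : Quiver.Path a b), p.length = n ∧ x = path K p}

variable {V}

/-- The idempotent of a vertex (the trivial path). -/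
noncomputable def PathAlgebra.vertex (a : V) : PathAlgebra K V :=
  path K (Quiver.Path.nil : Quiver.Path a a)

/-- An arrow, as an element of the path algebra. -/
noncomputable def PathAlgebra.arrow (a : Quiver.Total V) : PathAlgebra K V := path K a.hom.toPath

/-- The product `u₁ ⋯ uₘ` in the path algebra of a word in the arrows. -/
noncomputable def PathAlgebra.word (u : List (Quiver.Total V)) : PathAlgebra K V :=
  (u.map (PathAlgebra.arrow K)).prod

end PathAlgebra

/-- A closed word `u₁ ⋯ uₘ`, `m ≥ 1`, in the arrows of a quiver (a representative of a necklace):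
each arrow ends where the cyclically next one begins. -/
def IsClosedWord {V : Type*} [Quiver V] (u : List (Quiver.Total V)) : Prop :=
  u.IsChain (fun a b => a.right = b.left) ∧ ∃ h : u ≠ [], (u.getLast h).right = (u.head h).left

/-! ## The double derivation quiver and its necklace bracket -/

/-- The vertices of the double derivation quiver of `⨁ᵢ M_{dᵢ}`: one for each index `i`. -/
@[ext] structure DDQuiver {ι : Type*} (d : ι → ℕ) where
  /-- The index of a vertex. -/
  idx : ι

section Necklace

variable {ι : Type*} {d : ι → ℕ}

instance [Fintype ι] : Fintype (DDQuiver d) :=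
  Fintype.ofEquiv ι ⟨DDQuiver.mk, DDQuiver.idx, fun _ => rfl, fun _ => rfl⟩

instance [DecidableEq ι] : DecidableEq (DDQuiver d) := fun a b =>
  decidable_of_iff (a.idx = b.idx) ⟨DDQuiver.ext, congrArg DDQuiver.idx⟩

/-- The arrows `j ⟶ i` are indexed by their primary colour in `{1, …, dᵢ}` (the one that belongs
to the head `i`) and their secondary colour in `{1, …, dⱼ}` (the one that belongs to the tail `j`);
the pair `(1, 1)` does not occur if `i = j`. The colour `c` is represented by `c - 1` in `Fin`. -/
instance : Quiver (DDQuiver d) where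
  Hom j i := {c : Fin (d i.idx) × Fin (d j.idx) // ¬ (j = i ∧ c.1.val = 0 ∧ c.2.val = 0)}

/-- The primary colour of an arrow. -/
def prim (a : Quiver.Total (DDQuiver d)) : Fin (d a.right.idx) := a.hom.1.1

/-- The secondary colour of an arrow. -/
def sec (a : Quiver.Total (DDQuiver d)) : Fin (d a.left.idx) := a.hom.1.2

variable [Fintype ι] [DecidableEq ι]

variable (K : Type*) [Field K]

/-- The arrow `j ⟶ i` of primary colour `p` and secondary colour `q` in the path algebra, where
the missing loop of colour `(1, 1)` in a vertex `i` is read as minus the sum of the loops of colour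
`(r, r)` in `i` with `2 ≤ r ≤ dᵢ`. -/
noncomputable def colouredArrow (j i : DDQuiver d) (p : Fin (d i.idx)) (q : Fin (d j.idx)) :
    PathAlgebra K (DDQuiver d) :=
  if h : j = i ∧ p.val = 0 ∧ q.val = 0 then
    -∑ r : {r : Fin (d i.idx) // r.val ≠ 0},
      PathAlgebra.arrow K (⟨i, i, ⟨(r.1, r.1), fun h => r.2 h.2.1⟩⟩ : Quiver.Total (DDQuiver d))
  else PathAlgebra.arrow K ⟨j, i, ⟨(p, q), h⟩⟩

/-- Cut and glue, with `x = uᵢ₊₁` and `y = vⱼ₊₁`, at the vertex that is the tail of `x` and the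
head of `y`: if the secondary colour of `x` equals the primary colour of `y`, both arrows are
removed and `u₁ ⋯ uᵢ vⱼ₊₂ ⋯ vₙ v₁ ⋯ vⱼ z uᵢ₊₂ ⋯ uₘ` is formed, where `z` goes from the tail of `y`
to the head of `x` and has the primary colour of `x` and the secondary colour of `y`. -/
noncomputable def glueTailHead (v u : List (Quiver.Total (DDQuiver d))) (i : Fin u.length)
    (j : Fin v.length) : PathAlgebra K (DDQuiver d) :=
  if u[i].left = v[j].right ∧ (sec u[i]).val = (prim v[j]).val then
    PathAlgebra.word K (u.take i) *
      (PathAlgebra.word K (v.drop (j + 1)) * PathAlgebra.word K (v.take j)) *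
      colouredArrow K v[j].left u[i].right (prim u[i]) (sec v[j]) *
      PathAlgebra.word K (u.drop (i + 1))
  else 0

/-- Cut and glue, with `x = uᵢ₊₁` and `y = vⱼ₊₁`, at the vertex that is the head of `x` and the
tail of `y`: if the primary colour of `x` equals the secondary colour of `y`, both arrows are
removed and `u₁ ⋯ uᵢ z vⱼ₊₂ ⋯ vₙ v₁ ⋯ vⱼ uᵢ₊₂ ⋯ uₘ` is formed, where `z` goes from the tail of `x`
to the head of `y` and has the primary colour of `y` and the secondary colour of `x`. -/
noncomputable def glueHeadTail (v u : List (Quiver.Total (DDQuiver d))) (i : Fin u.length)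
    (j : Fin v.length) : PathAlgebra K (DDQuiver d) :=
  if u[i].right = v[j].left ∧ (prim u[i]).val = (sec v[j]).val then
    PathAlgebra.word K (u.take i) *
      colouredArrow K u[i].left v[j].right (prim v[j]) (sec u[i]) *
      (PathAlgebra.word K (v.drop (j + 1)) * PathAlgebra.word K (v.take j)) *
      PathAlgebra.word K (u.drop (i + 1))
  else 0

/-- The bracket of the closed words `v = v₁ ⋯ vₙ` and `u = u₁ ⋯ uₘ` (in this order), as an element
of the path algebra. -/
noncomputable def necklaceSum (v u : List (Quiver.Total (DDQuiver d))) :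
    PathAlgebra K (DDQuiver d) :=
  ∑ i : Fin u.length, ∑ j : Fin v.length,
    (sgn K (((i : ℤ) + j) * ((v.length : ℤ) - 1)) • glueHeadTail K v u i j
      - sgn K (((i : ℤ) + j + 1) * ((v.length : ℤ) - 1)) • glueTailHead K v u i j)

/-- The space of necklaces `K Q / [K Q, K Q]_super` of the double derivation quiver. -/
abbrev Necklaces (d : ι → ℕ) : Type _ :=
  SuperCyclic (PathAlgebra.deg K (DDQuiver d))

/-- `N` is the necklace bracket: it is given by cut and glue on the classes of closed words, and
it vanishes if one of its arguments is (the class of) a vertex, which has no arrow to cut. The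
classes of the vertices and of the closed words span the space of necklaces. -/
structure IsNecklaceBracket
    (N : Necklaces K d →ₗ[K] Necklaces K d →ₗ[K] Necklaces K d) : Prop where
  closed : ∀ v u : List (Quiver.Total (DDQuiver d)), IsClosedWord v → IsClosedWord u →
    N (cyc _ (PathAlgebra.word K v)) (cyc _ (PathAlgebra.word K u)) = cyc _ (necklaceSum K v u)
  vertex_left : ∀ (a : DDQuiver d) (x : Necklaces K d), N (cyc _ (PathAlgebra.vertex K a)) x = 0
  vertex_right : ∀ (a : DDQuiver d) (x : Necklaces K d), N x (cyc _ (PathAlgebra.vertex K a)) = 0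

end Necklace

/-! ## The generators of `𝔻S` for a semisimple algebra `S` -/

section Generators

variable {K : Type*} [Field K] {ι : Type*} [DecidableEq ι] {d : ι → ℕ} {S : Type*} [Ring S]
  [Algebra K S]

/-- The matrix unit `e^i_{pq}` of `S ≅ ⨁ᵢ M_{dᵢ}(K)`. -/
def matUnit (e : S ≃ₐ[K] ((i : ι) → Matrix (Fin (d i)) (Fin (d i)) K)) (i : ι)
    (p q : Fin (d i)) : S :=
  e.symm (Pi.single i (Matrix.single p q 1))

variable [∀ i, NeZero (d i)]

/-- The element of `𝔻S` of an arrow `j ⟶ i` of colour `(p, q)`: the inner double derivation of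
`e^i_{p1} ⊗ e^j_{1q}`. -/
noncomputable def gen (e : S ≃ₐ[K] ((i : ι) → Matrix (Fin (d i)) (Fin (d i)) K))
    (a : Quiver.Total (DDQuiver d)) : DAlg K S :=
  DAlg.ofD K S (DDer.inner (matUnit e a.right.idx (prim a) 0 ⊗ₜ[K] matUnit e a.left.idx 0 (sec a)))

/-- The element of `𝔻S` of a vertex `i`: the idempotent `e^i_{11}`. -/
noncomputable def genVertex (e : S ≃ₐ[K] ((i : ι) → Matrix (Fin (d i)) (Fin (d i)) K))
    (i : DDQuiver d) : DAlg K S :=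
  DAlg.ofA K S (matUnit e i.idx 0 0)

end Generators

end NecklaceLie

open NecklaceLie

/-!
Let `E` be the gauge element of `𝔻S`, the double derivation `y ↦ 1 ⊗ y - y ⊗ 1`. The algebra `S` is
separable, so every double derivation is inner (`DDer.exists_inner`), and `𝔻S` is generated by `S`
and `E` subject to the single family of relations `∑ e^i_{1p} E e^i_{p1} = 0`, summed over all
`(i, p)` (`DAlg.lift`). Consequently twisted derivations of `𝔻S` are determined by their values on
`S` and `E` (`IsTwDer.ext`), and exist for all values that respect the relation (`exists_twDer`).

For `s ∈ S` let `∂_s` be the outer derivation of `𝔻S` with values in `𝔻S ⊗ 𝔻S` that vanishes on `S`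
and maps `E` to `1 ⊗ s - s ⊗ 1` (`partialDer`). If `E` is regarded as even, the double bracket is
given by `{{a, s}} = -(∂_s a)°`, where `°` is the flip, and `{{a, E}} = 1 ⊗ a - a ⊗ 1`
(`unsignedBracket`). The double Schouten-Nijenhuis bracket arises from it when the parity
automorphism is applied to the left tensor factor if `a` has even degree (`superBracket`).

Multiplying out gives for each homogeneous `a` a derivation `{a, -}` of `𝔻S` that kills `E`. The
Jacobi identity already holds on `𝔻S` (`bracket_jacobi`): both sides are derivations in the last
argument, so it need only be checked on `S`. There `{a, s}` is, up to sign, the cyclic derivative of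
`a` that belongs to `s`, and the identity becomes a formula for the cyclic derivative of a bracket
(`cyclicDer_bracket`). It rests on the symmetry of second cyclic derivatives
(`partialDer_cyclicDer`), which follows from `(∂_s ⊗ 1) ∂_t = (1 ⊗ ∂_t) ∂_s`
(`partialLeft_partialDer`). Antisymmetry holds modulo super commutators, so the bracket descends to a
graded Lie bracket on the quotient (`isGradedLie_cyclicBracket`).

The comparison with the quiver is a form of Morita equivalence. On the one hand, the matrix of all
coloured arrows satisfies the relation of `E`, because of the convention on loops of colour `(1, 1)`;
this gives a representation of `𝔻S` by matrices over the path algebra (`rep`), whose trace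
(`repTrace`) respects super commutators. On the other hand, a path is sent to the product in `𝔻S` of
the elements of its arrows (`realize`). The two maps are inverse to each other modulo super
commutators (`necklaceEquiv`).

Finally, the element of an arrow of colour `(p, q)` from `j` to `i` is `e^j_{1q} E e^i_{p1}`. The
double bracket of two such elements has six terms (`unsignedBracket_generators`). In the bracket of
two closed words two of them are the two kinds of cutting and gluing; the other four vanish modulo
super commutators, because no arrow is a loop of colour `(1, 1)` (`cyc_bracket_term`). So the bracket
transported to the necklaces satisfies the cut-and-glue rule (`cyc_bracket_wordElem`). It vanishes on
vertices, since these correspond to idempotents of `S`, and it is the only such bracket since the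
vertices and the closed words span the space of necklaces (`necklaces_hom_ext`).
-/

namespace NecklaceLie

/-! ### Matrix units and the Casimir element -/

section Semisimple

variable {K : Type*} [Field K] {ι : Type*} [DecidableEq ι] {d : ι → ℕ} {S : Type*} [Ring S]
  [Algebra K S] (e : S ≃ₐ[K] ((i : ι) → Matrix (Fin (d i)) (Fin (d i)) K))

theorem matUnit_mul_same (i : ι) (p q r s : Fin (d i)) :
    matUnit e i p q * matUnit e i r s = if q = r then matUnit e i p s else 0 := by
  unfold matUnit
  rw [← map_mul, ← Pi.single_mul]
  split_ifs with h
  · subst h; simp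
  · simp [Matrix.single_mul_single_of_ne _ _ _ _ h]

theorem matUnit_mul_ne {i j : ι} (h : i ≠ j) (p q : Fin (d i)) (r s : Fin (d j)) :
    matUnit e i p q * matUnit e j r s = 0 := by
  unfold matUnit
  have : Pi.single i (Matrix.single p q 1) * Pi.single j (Matrix.single r s 1)
      = (0 : (i : ι) → Matrix (Fin (d i)) (Fin (d i)) K) := by
    funext k
    by_cases hk : k = i
    · subst hk; simp [Pi.single_eq_of_ne h]
    · simp [Pi.single_eq_of_ne hk]
  rw [← map_mul, this, map_zero]

/-- The expansion of an element of `S` in matrix units. -/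
theorem sum_matUnit [Fintype ι] (s : S) :
    s = ∑ i, ∑ p, ∑ q, (e s i p q) • matUnit e i p q := by
  apply e.injective
  rw [map_sum]
  funext i
  rw [Finset.sum_apply, Finset.sum_eq_single i]
  · simp only [map_sum, map_smul, matUnit, AlgEquiv.apply_symm_apply, Finset.sum_apply,
      Pi.smul_apply, Pi.single_eq_same]
    conv_lhs => rw [Matrix.matrix_eq_sum_single (e s i)]
    simp [Matrix.smul_single]
  · intro j _ hj
    simp [map_sum, matUnit, Finset.sum_apply, Pi.single_eq_of_ne (Ne.symm hj)]
  · simp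

variable [∀ i, NeZero (d i)]

/-- The matrix unit `e^i_{p1}` of an index `I = (i, p)`. -/
def col (I : Σ i, Fin (d i)) : S := matUnit e I.1 I.2 0

/-- The matrix unit `e^i_{1p}` of an index `I = (i, p)`. -/
def row (I : Σ i, Fin (d i)) : S := matUnit e I.1 0 I.2

/-- The idempotent `e^i_{11}`. -/
def idem (i : ι) : S := matUnit e i 0 0

theorem row_mul_col (I J : Σ i, Fin (d i)) :
    row e I * col e J = if I = J then idem e I.1 else 0 := by
  obtain ⟨i, p⟩ := I
  obtain ⟨j, q⟩ := J
  by_cases h : i = j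
  · subst h
    simp [row, col, matUnit_mul_same, idem]
  · have h' : (⟨i, p⟩ : Σ i, Fin (d i)) ≠ ⟨j, q⟩ := fun H => h (congrArg Sigma.fst H)
    rw [if_neg h', row, col, matUnit_mul_ne e h]

theorem idem_mul_idem (i j : ι) : idem e i * idem e j = if i = j then idem e i else 0 := by
  by_cases h : i = j
  · subst h
    simp [idem, matUnit_mul_same]
  · rw [if_neg h, idem, idem, matUnit_mul_ne e h]

theorem idem_mul_row (I : Σ i, Fin (d i)) : idem e I.1 * row e I = row e I := by
  simp [idem, row, matUnit_mul_same]

theorem col_mul_idem (I : Σ i, Fin (d i)) : col e I * idem e I.1 = col e I := by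
  simp [idem, col, matUnit_mul_same]

theorem col_mul_row_same (i : ι) (p q : Fin (d i)) :
    col e ⟨i, p⟩ * row e ⟨i, q⟩ = matUnit e i p q := by
  simp [row, col, matUnit_mul_same]

theorem idem_mul_col (j : ι) (I : Σ i, Fin (d i)) :
    idem e j * col e I = if j = I.1 ∧ I.2 = 0 then idem e I.1 else 0 := by
  obtain ⟨i, p⟩ := I
  by_cases h : j = i
  · subst h
    simp only [idem, col, matUnit_mul_same, true_and, eq_comm (a := (0 : Fin (d j)))]
  · simp [idem, col, matUnit_mul_ne e h, h]

theorem row_mul_idem (j : ι) (I : Σ i, Fin (d i)) :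
    row e I * idem e j = if j = I.1 ∧ I.2 = 0 then idem e I.1 else 0 := by
  obtain ⟨i, p⟩ := I
  by_cases h : i = j
  · subst h
    simp [idem, row, matUnit_mul_same]
  · simp [idem, row, matUnit_mul_ne e h, Ne.symm h]

variable [Fintype ι]

theorem sum_col_mul_row : ∑ I, col e I * row e I = 1 := by
  rw [Fintype.sum_sigma]
  simp only [col_mul_row_same]
  conv_rhs => rw [sum_matUnit e 1]
  refine Finset.sum_congr rfl fun i _ => Finset.sum_congr rfl fun p _ => ?_
  rw [Finset.sum_eq_single p]
  · simp
  · intro q _ hq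
    simp [Matrix.one_apply_ne hq.symm]
  · simp

/-- The two sides of the Casimir identity, written for an arbitrary bilinear expression. -/
theorem sum_casimir {M : Type*} [AddCommGroup M] [Module K M] (f : S →ₗ[K] S →ₗ[K] M) (s : S) :
    ∑ I, f (s * col e I) (row e I) = ∑ I, f (col e I) (row e I * s) := by
  have key : ∀ (i : ι) (a b : Fin (d i)),
      ∑ I, f (matUnit e i a b * col e I) (row e I)
        = ∑ I, f (col e I) (row e I * matUnit e i a b) := by
    intro i a b
    rw [Finset.sum_eq_single ⟨i, b⟩, Finset.sum_eq_single ⟨i, a⟩]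
    · simp [col, row, matUnit_mul_same]
    · rintro ⟨j, q⟩ - h
      by_cases hj : j = i
      · subst hj
        have : q ≠ a := fun H => h (by rw [H])
        simp [row, matUnit_mul_same, this]
      · simp [row, matUnit_mul_ne e hj]
    · simp
    · rintro ⟨j, q⟩ - h
      by_cases hj : i = j
      · subst hj
        have : b ≠ q := fun H => h (by rw [H])
        simp [col, matUnit_mul_same, this]
      · simp [col, matUnit_mul_ne e hj]
    · simp
  rw [sum_matUnit e s]
  simp only [Finset.sum_mul, Finset.mul_sum, map_sum, LinearMap.sum_apply, smul_mul_assoc,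
    mul_smul_comm, map_smul, LinearMap.smul_apply]
  rw [Finset.sum_comm]
  conv_rhs => rw [Finset.sum_comm]
  refine Finset.sum_congr rfl fun i _ => ?_
  rw [Finset.sum_comm]
  conv_rhs => rw [Finset.sum_comm]
  refine Finset.sum_congr rfl fun a _ => ?_
  rw [Finset.sum_comm]
  conv_rhs => rw [Finset.sum_comm]
  refine Finset.sum_congr rfl fun b _ => ?_
  rw [← Finset.smul_sum, ← Finset.smul_sum, key]

theorem sum_casimir_tmul (s : S) :
    ∑ I, (s * col e I) ⊗ₜ[K] row e I = ∑ I, col e I ⊗ₜ[K] (row e I * s) :=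
  sum_casimir e (TensorProduct.mk K S S) s

end Semisimple

/-! ### Inner double derivations -/

section Inner

variable {K A : Type*} [Field K] [Ring A] [Algebra K A]

theorem inner_apply_tmul (x y z : A) :
    (DDer.inner (K := K) (x ⊗ₜ[K] y)).1 z = x ⊗ₜ (y * z) - (z * x) ⊗ₜ y := by
  simp [DDer.inner]

theorem inner_apply (ξ : A ⊗[K] A) (z : A) :
    (DDer.inner ξ).1 z = ξ * (1 ⊗ₜ z) - (z ⊗ₜ 1) * ξ := by
  simp [DDer.inner]

variable (K A) in
/-- `DDer.inner` as a linear map. -/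
def DDer.innerLin : A ⊗[K] A →ₗ[K] DDer K A where
  toFun := DDer.inner
  map_add' ξ η := by
    ext z
    simp only [inner_apply, Submodule.coe_add, LinearMap.add_apply, add_mul, mul_add]
    abel
  map_smul' c ξ := by
    ext z
    simp [inner_apply, smul_sub]

theorem DDer.innerLin_apply (ξ : A ⊗[K] A) : DDer.innerLin K A ξ = DDer.inner ξ := rfl

theorem inner_lact (a : A) (ξ : A ⊗[K] A) :
    DDer.inner ((1 ⊗ₜ a) * ξ) = DDer.lact a (DDer.inner ξ) := by
  apply Subtype.ext
  ext z
  change _ = (1 ⊗ₜ a) * ((DDer.inner ξ).1 z)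
  rw [inner_apply, inner_apply, mul_sub, ← mul_assoc, ← mul_assoc, ← mul_assoc]
  simp [Algebra.TensorProduct.tmul_mul_tmul]

theorem inner_ract (a : A) (ξ : A ⊗[K] A) :
    DDer.inner (ξ * (a ⊗ₜ 1)) = DDer.ract (DDer.inner ξ) a := by
  apply Subtype.ext
  ext z
  change _ = ((DDer.inner ξ).1 z) * (a ⊗ₜ 1)
  rw [inner_apply, inner_apply, sub_mul, mul_assoc, mul_assoc, mul_assoc]
  simp [Algebra.TensorProduct.tmul_mul_tmul]

variable (K A) in
/-- The gauge element of `𝔻A`: the double derivation `y ↦ 1 ⊗ y - y ⊗ 1`. -/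
noncomputable def gauge : DAlg K A := DAlg.ofD K A (DDer.inner (1 ⊗ₜ 1))

theorem ofD_inner_tmul (t s : A) :
    DAlg.ofD K A (DDer.inner (t ⊗ₜ s)) = DAlg.ofA K A s * gauge K A * DAlg.ofA K A t := by
  have : t ⊗ₜ[K] s = (1 ⊗ₜ s) * (1 ⊗ₜ 1) * (t ⊗ₜ 1) := by simp
  rw [this, inner_ract, inner_lact, DAlg.ofD_ract, DAlg.ofD_lact, gauge]

end Inner

/-! ### The presentation of `𝔻S` by `S` and the gauge element -/

section Generation

variable {K : Type*} [Field K] {ι : Type*} [DecidableEq ι] [Fintype ι] {d : ι → ℕ}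
  [∀ i, NeZero (d i)] {S : Type*} [Ring S]
  [Algebra K S] (e : S ≃ₐ[K] ((i : ι) → Matrix (Fin (d i)) (Fin (d i)) K))

/-- A linear section of `DDer.inner`: a double derivation `δ` of the separable algebra `S` is the
inner one of `-∑ e^i_{p1} δ(e^i_{1p})`. -/
noncomputable def DDer.toTensor : DDer K S →ₗ[K] S ⊗[K] S :=
  -∑ I, LinearMap.mulLeft K (col e I ⊗ₜ[K] (1 : S)) ∘ₗ DDer.evalAt (row e I)

theorem DDer.toTensor_apply (δ : DDer K S) :
    DDer.toTensor e δ = -∑ I, (col e I ⊗ₜ[K] (1 : S)) * δ.1 (row e I) := by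
  simp [DDer.toTensor, DDer.evalAt, LinearMap.sum_apply]

theorem DDer.inner_toTensor (δ : DDer K S) : DDer.inner (DDer.toTensor e δ) = δ := by
  apply Subtype.ext
  ext z
  rw [inner_apply, DDer.toTensor_apply]
  have h1 := sum_casimir e ((LinearMap.mul K (S ⊗[K] S)).compl₁₂
    ((TensorProduct.mk K S S).flip 1) δ.1) z
  simp only [LinearMap.compl₁₂_apply, LinearMap.mul_apply', LinearMap.flip_apply,
    TensorProduct.mk_apply] at h1
  have h2 : ∀ I, (col e I ⊗ₜ[K] (1 : S)) * δ.1 (row e I * z) =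
      ((col e I * row e I) ⊗ₜ[K] (1 : S)) * δ.1 z +
        (col e I ⊗ₜ[K] (1 : S)) * δ.1 (row e I) * (1 ⊗ₜ z) := by
    intro I
    rw [δ.2, mul_add, ← mul_assoc, ← mul_assoc, Algebra.TensorProduct.tmul_mul_tmul, one_mul]
  have h3 : ∑ I, ((col e I * row e I) ⊗ₜ[K] (1 : S)) * δ.1 z = δ.1 z := by
    rw [← Finset.sum_mul, ← TensorProduct.sum_tmul, sum_col_mul_row,
      ← Algebra.TensorProduct.one_def, one_mul]
  have h4 : ∀ I, (z ⊗ₜ[K] (1 : S)) * ((col e I ⊗ₜ[K] (1 : S)) * δ.1 (row e I)) =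
      ((z * col e I) ⊗ₜ[K] (1 : S)) * δ.1 (row e I) := by
    intro I
    rw [← mul_assoc, Algebra.TensorProduct.tmul_mul_tmul, one_mul]
  simp only [h2, Finset.sum_add_distrib, h3] at h1
  rw [neg_mul, mul_neg, Finset.sum_mul, Finset.mul_sum]
  simp only [h4, h1]
  abel

include e in
/-- Every double derivation of `S` is inner, because `S` is separable. -/
theorem DDer.exists_inner (δ : DDer K S) : ∃ ξ, DDer.inner ξ = δ :=
  ⟨_, DDer.inner_toTensor e δ⟩

theorem inner_casimir : DDer.inner (∑ I, col e I ⊗ₜ[K] row e I) = 0 := by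
  apply Subtype.ext
  ext z
  rw [inner_apply, Finset.mul_sum, Finset.sum_mul]
  simp [Algebra.TensorProduct.tmul_mul_tmul, sum_casimir_tmul]

/-- The defining relation of `𝔻S`: the Casimir element commutes with `S`, so its inner double
derivation is zero. -/
theorem sum_row_gauge_col :
    ∑ I, DAlg.ofA K S (row e I) * gauge K S * DAlg.ofA K S (col e I) = 0 := by
  simp only [← ofD_inner_tmul, ← DDer.innerLin_apply, ← map_sum]
  rw [DDer.innerLin_apply, inner_casimir, map_zero]

include e in
/-- `𝔻S` is generated by `S` and the gauge element. -/
theorem DAlg.induction {P : DAlg K S → Prop} (hA : ∀ s, P (DAlg.ofA K S s)) (hE : P (gauge K S))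
    (hadd : ∀ x y, P x → P y → P (x + y)) (hmul : ∀ x y, P x → P y → P (x * y)) (x : DAlg K S) :
    P x := by
  have hsmul : ∀ (c : K) x, P x → P (c • x) := by
    intro c x hx
    have : c • x = DAlg.ofA K S (c • 1) * x := by rw [map_smul, DAlg.ofA_one, smul_one_mul]
    rw [this]
    exact hmul _ _ (hA _) hx
  have hD : ∀ δ, P (DAlg.ofD K S δ) := by
    intro δ
    obtain ⟨ξ, rfl⟩ := DDer.exists_inner e δ
    rw [← DDer.innerLin_apply]
    induction ξ with
    | zero => simpa using hA 0
    | tmul t s =>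
      rw [DDer.innerLin_apply, ofD_inner_tmul]
      exact hmul _ _ (hmul _ _ (hA _) hE) (hA _)
    | add ξ η h1 h2 => rw [map_add, map_add]; exact hadd _ _ h1 h2
  obtain ⟨y, rfl⟩ : ∃ y, DAlg.mk K S y = x := RingQuot.mkAlgHom_surjective K _ x
  induction y using TensorAlgebra.induction with
  | algebraMap r =>
    rw [AlgHom.commutes, Algebra.algebraMap_eq_smul_one, ← DAlg.ofA_one]
    exact hsmul _ _ (hA _)
  | ι v =>
    have : DAlg.mk K S (TensorAlgebra.ι K v) = DAlg.ofA K S v.1 + DAlg.ofD K S v.2 := by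
      obtain ⟨s, δ⟩ := v
      change _ = DAlg.mk K S (TensorAlgebra.ι K (s, 0)) + DAlg.mk K S (TensorAlgebra.ι K (0, δ))
      rw [← map_add, ← map_add]
      simp
    rw [this]
    exact hadd _ _ (hA _) (hD _)
  | mul a b ha hb => rw [map_mul]; exact hmul _ _ ha hb
  | add a b ha hb => rw [map_add]; exact hadd _ _ ha hb

variable {R : Type*} [Ring R] [Algebra K R]

/-- The linear map `t ⊗ s ↦ h(s) Y h(t)`. -/
noncomputable def sandwich (h : S →ₐ[K] R) (Y : R) : S ⊗[K] S →ₗ[K] R :=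
  TensorProduct.lift ((LinearMap.mul K R).compl₁₂ (LinearMap.mulRight K Y ∘ₗ h.toLinearMap)
    h.toLinearMap).flip

theorem sandwich_tmul (h : S →ₐ[K] R) (Y : R) (t s : S) :
    sandwich h Y (t ⊗ₜ s) = h s * Y * h t := by
  simp [sandwich]

theorem sandwich_left (h : S →ₐ[K] R) (Y : R) (a : S) (ξ : S ⊗[K] S) :
    sandwich h Y ((1 ⊗ₜ a) * ξ) = h a * sandwich h Y ξ := by
  induction ξ with
  | zero => simp
  | tmul t s => simp [sandwich_tmul, mul_assoc]
  | add x y hx hy => rw [mul_add, map_add, map_add, mul_add, hx, hy]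

theorem sandwich_right (h : S →ₐ[K] R) (Y : R) (a : S) (ξ : S ⊗[K] S) :
    sandwich h Y (ξ * (a ⊗ₜ 1)) = sandwich h Y ξ * h a := by
  induction ξ with
  | zero => simp
  | tmul t s => simp [sandwich_tmul, mul_assoc]
  | add x y hx hy => rw [add_mul, map_add, map_add, add_mul, hx, hy]

variable (h : S →ₐ[K] R) (Y : R) (hY : ∑ I, h (row e I) * Y * h (col e I) = 0)

include hY in
/-- If `ξ` defines the zero derivation, then `z ξ = ξ z` in the outer structure, so that `ξ = ∑
(e_{p1} ⊗ 1) ξ (1 ⊗ e_{1p})`; such sums are sent to multiples of `∑ h(e_{1p}) Y h(e_{p1}) = 0`. -/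
theorem sandwich_eq_zero (ξ : S ⊗[K] S) (hξ : DDer.inner ξ = 0) : sandwich h Y ξ = 0 := by
  have h0 : ∀ z : S, ξ * (1 ⊗ₜ z) = (z ⊗ₜ 1) * ξ := by
    intro z
    rw [← sub_eq_zero, ← inner_apply, hξ]
    rfl
  have h1 : ξ = ∑ I, (col e I ⊗ₜ[K] (1 : S)) * ξ * (1 ⊗ₜ row e I) := by
    simp only [mul_assoc, h0]
    simp only [← mul_assoc, Algebra.TensorProduct.tmul_mul_tmul, one_mul]
    rw [← Finset.sum_mul, ← TensorProduct.sum_tmul, sum_col_mul_row,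
      ← Algebra.TensorProduct.one_def, one_mul]
  have h2 : ∀ η : S ⊗[K] S,
      sandwich h Y (∑ I, (col e I ⊗ₜ[K] (1 : S)) * η * (1 ⊗ₜ row e I)) = 0 := by
    intro η
    induction η with
    | zero => simp
    | tmul t s =>
      simp only [Algebra.TensorProduct.tmul_mul_tmul, map_sum, sandwich_tmul, one_mul, mul_one,
        map_mul]
      have : ∀ I, h s * h (row e I) * Y * (h (col e I) * h t) =
          h s * (h (row e I) * Y * h (col e I)) * h t := by
        intro I; simp only [mul_assoc]
      simp only [this]
      rw [← Finset.sum_mul, ← Finset.mul_sum, hY, mul_zero, zero_mul]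
    | add x y hx hy =>
      simp only [mul_add, add_mul, Finset.sum_add_distrib, map_add, hx, hy, add_zero]
  rw [h1]
  exact h2 ξ

include hY in
theorem sandwich_congr (ξ η : S ⊗[K] S) (hξ : DDer.inner ξ = DDer.inner η) :
    sandwich h Y ξ = sandwich h Y η := by
  rw [← sub_eq_zero, ← map_sub]
  apply sandwich_eq_zero e h Y hY
  rw [← DDer.innerLin_apply, map_sub, DDer.innerLin_apply, DDer.innerLin_apply, hξ, sub_self]

/-- The universal property of `𝔻S`: an algebra homomorphism from `𝔻S` is given by its restriction
to `S` and by the image `Y` of the gauge element, subject to one linear relation. -/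
noncomputable def DAlg.lift : DAlg K S →ₐ[K] R :=
  RingQuot.liftAlgHom K ⟨TensorAlgebra.lift K
    (h.toLinearMap.coprod (sandwich h Y ∘ₗ DDer.toTensor e)), by
    intro x y hxy
    cases hxy with
    | one => simp
    | mul a b => simp
    | left a δ =>
      simp only [map_mul, TensorAlgebra.lift_ι_apply, LinearMap.coprod_apply, map_zero, zero_add,
        add_zero, LinearMap.comp_apply, AlgHom.toLinearMap_apply]
      rw [← sandwich_left]
      apply sandwich_congr e h Y hY
      rw [DDer.inner_toTensor, inner_lact, DDer.inner_toTensor]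
    | right δ a =>
      simp only [map_mul, TensorAlgebra.lift_ι_apply, LinearMap.coprod_apply, map_zero, zero_add,
        add_zero, LinearMap.comp_apply, AlgHom.toLinearMap_apply]
      rw [← sandwich_right]
      apply sandwich_congr e h Y hY
      rw [DDer.inner_toTensor, inner_ract, DDer.inner_toTensor]⟩

theorem DAlg.lift_mk (x : TensorAlgebra K (S × DDer K S)) :
    DAlg.lift e h Y hY (DAlg.mk K S x) = TensorAlgebra.lift K
      (h.toLinearMap.coprod (sandwich h Y ∘ₗ DDer.toTensor e)) x :=
  RingQuot.liftAlgHom_mkAlgHom_apply _ _ _ _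

theorem DAlg.lift_ofA (s : S) : DAlg.lift e h Y hY (DAlg.ofA K S s) = h s := by
  change DAlg.lift e h Y hY (DAlg.mk K S (TensorAlgebra.ι K (s, 0))) = _
  rw [DAlg.lift_mk]
  simp

theorem DAlg.lift_gauge : DAlg.lift e h Y hY (gauge K S) = Y := by
  change DAlg.lift e h Y hY (DAlg.mk K S (TensorAlgebra.ι K (0, _))) = _
  rw [DAlg.lift_mk, TensorAlgebra.lift_ι_apply, LinearMap.coprod_apply, map_zero, zero_add,
    LinearMap.comp_apply]
  change sandwich h Y (DDer.toTensor e (DDer.inner (1 ⊗ₜ 1))) = _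
  rw [sandwich_congr e h Y hY _ (1 ⊗ₜ 1) (DDer.inner_toTensor e _),
    sandwich_tmul, map_one, one_mul, mul_one]

include e in
theorem DAlg.algHom_ext {f g : DAlg K S →ₐ[K] R}
    (hA : ∀ s, f (DAlg.ofA K S s) = g (DAlg.ofA K S s)) (hE : f (gauge K S) = g (gauge K S)) :
    f = g := by
  ext x
  induction x using DAlg.induction e with
  | hA s => exact hA s
  | hE => exact hE
  | hadd x y hx hy => rw [map_add, map_add, hx, hy]
  | hmul x y hx hy => rw [map_mul, map_mul, hx, hy]

/-- `δ` is an `(f, g)`-derivation: `δ(bc) = f(b) δ(c) + δ(b) g(c)`. -/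
def IsTwDer (f g : DAlg K S → R) (δ : DAlg K S →ₗ[K] R) : Prop :=
  ∀ b c, δ (b * c) = f b * δ c + δ b * g c

include e in
/-- A twisted derivation of `𝔻S` is determined by its values on `S` and on the gauge element. -/
theorem IsTwDer.ext {f g : DAlg K S → R} {δ δ' : DAlg K S →ₗ[K] R} (h1 : IsTwDer f g δ)
    (h2 : IsTwDer f g δ') (hA : ∀ s, δ (DAlg.ofA K S s) = δ' (DAlg.ofA K S s))
    (hE : δ (gauge K S) = δ' (gauge K S)) : δ = δ' := by
  ext x
  induction x using DAlg.induction e with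
  | hA s => exact hA s
  | hE => exact hE
  | hadd x y hx hy => rw [map_add, map_add, hx, hy]
  | hmul x y hx hy => rw [h1, h2, hx, hy]

theorem matrix_two_ext {R : Type*} {A B : Matrix (Fin 2) (Fin 2) R} (h00 : A 0 0 = B 0 0)
    (h01 : A 0 1 = B 0 1) (h10 : A 1 0 = B 1 0) (h11 : A 1 1 = B 1 1) : A = B :=
  Matrix.ext (Fin.forall_fin_two.2 ⟨Fin.forall_fin_two.2 ⟨h00, h01⟩,
    Fin.forall_fin_two.2 ⟨h10, h11⟩⟩)

/-- Derivations of `𝔻S` with prescribed values on the generators exist if the values on `S` form a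
derivation and the relation is respected. This is the universal property of `𝔻S`, applied to upper
triangular `2 × 2` matrices. -/
theorem exists_twDer (f g : DAlg K S →ₐ[K] R) (δ : S →ₗ[K] R) (Y : R)
    (hδ : ∀ s t, δ (s * t) = f (DAlg.ofA K S s) * δ t + δ s * g (DAlg.ofA K S t))
    (hY : ∑ I, (f (DAlg.ofA K S (row e I)) * f (gauge K S) * δ (col e I)
      + f (DAlg.ofA K S (row e I)) * Y * g (DAlg.ofA K S (col e I))
      + δ (row e I) * g (gauge K S) * g (DAlg.ofA K S (col e I))) = 0) :
    ∃ D : DAlg K S →ₗ[K] R, IsTwDer f g D ∧ (∀ s, D (DAlg.ofA K S s) = δ s) ∧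
      D (gauge K S) = Y := by
  have hδ1 : δ 1 = 0 := by
    have := hδ 1 1
    simpa [DAlg.ofA_one] using this
  let h : S →ₐ[K] Matrix (Fin 2) (Fin 2) R := AlgHom.ofLinearMap
    { toFun := fun s => !![f (DAlg.ofA K S s), δ s; 0, g (DAlg.ofA K S s)]
      map_add' := fun s t => by apply matrix_two_ext <;> simp
      map_smul' := fun s t => by apply matrix_two_ext <;> simp }
    (by apply matrix_two_ext <;> simp [DAlg.ofA_one, hδ1])
    (by
      intro s t
      apply matrix_two_ext <;> simp [Matrix.mul_apply, DAlg.ofA_mul, hδ])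
  have hh : ∀ s, h s = !![f (DAlg.ofA K S s), δ s; 0, g (DAlg.ofA K S s)] := fun s => rfl
  let Z : Matrix (Fin 2) (Fin 2) R := !![f (gauge K S), Y; 0, g (gauge K S)]
  -- the relation holds on the diagonal because `f` and `g` are homomorphisms, and off it by `hY`
  have hrel : ∀ k : DAlg K S →ₐ[K] R, ∑ I, k (DAlg.ofA K S (row e I)) * k (gauge K S) *
      k (DAlg.ofA K S (col e I)) = 0 := by
    intro k
    simp only [← map_mul, ← map_sum, sum_row_gauge_col, map_zero]
  have hZ : ∑ I, h (row e I) * Z * h (col e I) = 0 := by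
    apply matrix_two_ext <;> rw [Matrix.sum_apply]
    · simpa [hh, Z, Matrix.mul_apply] using hrel f
    · refine Eq.trans ?_ hY
      refine Finset.sum_congr rfl fun I _ => ?_
      simp [hh, Z, Matrix.mul_apply, add_mul, add_assoc]
    · simp [hh, Z, Matrix.mul_apply]
    · simpa [hh, Z, Matrix.mul_apply] using hrel g
  let F := DAlg.lift e h Z hZ
  have hF : ∀ x, F x 0 0 = f x ∧ F x 1 0 = 0 ∧ F x 1 1 = g x := by
    intro x
    induction x using DAlg.induction e with
    | hA s => simp [F, DAlg.lift_ofA, hh]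
    | hE => simp [F, DAlg.lift_gauge, Z]
    | hadd x y hx hy => simp [map_add, hx, hy]
    | hmul x y hx hy => simp [map_mul, Matrix.mul_apply, hx, hy]
  let D : DAlg K S →ₗ[K] R :=
    { toFun := fun x => F x 0 1
      map_add' := fun x y => by simp
      map_smul' := fun c x => by simp }
  have hD : ∀ x, D x = F x 0 1 := fun x => rfl
  refine ⟨D, ?_, ?_, ?_⟩
  · intro b c
    simp [hD, Matrix.mul_apply, hF]
  · intro s
    simp [hD, F, DAlg.lift_ofA, hh]
  · simp [hD, F, DAlg.lift_gauge, Z]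

end Generation

/-! ### The double bracket without signs -/

section UnsignedBracket

variable {K : Type*} [Field K] {ι : Type*} [DecidableEq ι] [Fintype ι] {d : ι → ℕ}
  [∀ i, NeZero (d i)] {S : Type*} [Ring S]
  [Algebra K S] (e : S ≃ₐ[K] ((i : ι) → Matrix (Fin (d i)) (Fin (d i)) K))

/-- `δ : 𝔻S → 𝔻S ⊗ 𝔻S` is a derivation for the outer bimodule structure. -/
abbrev IsOuter (δ : DAlg K S →ₗ[K] DAlg K S ⊗[K] DAlg K S) : Prop :=
  IsTwDer (fun b => b ⊗ₜ[K] (1 : DAlg K S)) (fun c => (1 : DAlg K S) ⊗ₜ[K] c) δ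

theorem IsOuter.add {δ δ' : DAlg K S →ₗ[K] DAlg K S ⊗[K] DAlg K S} (h : IsOuter δ)
    (h' : IsOuter δ') : IsOuter (δ + δ') := by
  intro b c
  simp only [LinearMap.add_apply, h b c, h' b c, mul_add, add_mul]
  abel

theorem IsOuter.smul {δ : DAlg K S →ₗ[K] DAlg K S ⊗[K] DAlg K S} (h : IsOuter δ) (r : K) :
    IsOuter (r • δ) := by
  intro b c
  simp only [LinearMap.smul_apply, h b c, smul_add, mul_smul_comm, smul_mul_assoc]

theorem IsOuter.sum {J : Type*} [Fintype J] {δ : J → DAlg K S →ₗ[K] DAlg K S ⊗[K] DAlg K S}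
    (h : ∀ j, IsOuter (δ j)) : IsOuter (∑ j, δ j) := by
  intro b c
  simp only [LinearMap.sum_apply, h _ b c, Finset.mul_sum, Finset.sum_mul,
    Finset.sum_add_distrib]

theorem IsOuter.mulLeft {δ : DAlg K S →ₗ[K] DAlg K S ⊗[K] DAlg K S} (h : IsOuter δ)
    (x : DAlg K S) : IsOuter (LinearMap.mulLeft K ((1 : DAlg K S) ⊗ₜ[K] x) ∘ₗ δ) := by
  intro b c
  simp only [LinearMap.comp_apply, LinearMap.mulLeft_apply, h b c, mul_add, ← mul_assoc,
    Algebra.TensorProduct.tmul_mul_tmul, one_mul, mul_one]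

theorem IsOuter.mulRight {δ : DAlg K S →ₗ[K] DAlg K S ⊗[K] DAlg K S} (h : IsOuter δ)
    (x : DAlg K S) : IsOuter (LinearMap.mulRight K (x ⊗ₜ[K] (1 : DAlg K S)) ∘ₗ δ) := by
  intro b c
  simp only [LinearMap.comp_apply, LinearMap.mulRight_apply, h b c, add_mul, mul_assoc,
    Algebra.TensorProduct.tmul_mul_tmul, one_mul, mul_one]

/-- The inner derivation `a ↦ (a ⊗ 1) ξ - ξ (1 ⊗ a)`. -/
noncomputable def outerAd (ξ : DAlg K S ⊗[K] DAlg K S) :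
    DAlg K S →ₗ[K] DAlg K S ⊗[K] DAlg K S :=
  LinearMap.mulRight K ξ ∘ₗ (TensorProduct.mk K _ _).flip 1
    - LinearMap.mulLeft K ξ ∘ₗ TensorProduct.mk K _ _ 1

theorem outerAd_apply (ξ : DAlg K S ⊗[K] DAlg K S) (a : DAlg K S) :
    outerAd ξ a = (a ⊗ₜ 1) * ξ - ξ * (1 ⊗ₜ a) := by
  simp [outerAd]

theorem isOuter_outerAd (ξ : DAlg K S ⊗[K] DAlg K S) : IsOuter (outerAd ξ) := by
  intro b c
  have h1 : (b * c) ⊗ₜ[K] (1 : DAlg K S) = (b ⊗ₜ 1) * (c ⊗ₜ 1) := by simp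
  have h2 : (1 : DAlg K S) ⊗ₜ[K] (b * c) = (1 ⊗ₜ b) * (1 ⊗ₜ c) := by simp
  simp only [outerAd_apply, h1, h2]
  noncomm_ring

include e in
/-- The relation is respected because the Casimir element, after a flip, commutes with `s`. -/
theorem exists_partialDer (s : S) : ∃ D : DAlg K S →ₗ[K] DAlg K S ⊗[K] DAlg K S,
    IsOuter D ∧ (∀ t, D (DAlg.ofA K S t) = 0) ∧
      D (gauge K S) = 1 ⊗ₜ DAlg.ofA K S s - DAlg.ofA K S s ⊗ₜ 1 := by
  refine exists_twDer e (Algebra.TensorProduct.includeLeft)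
    (Algebra.TensorProduct.includeRight) 0 _ (by simp) ?_
  have h := congrArg (TensorProduct.map (DAlg.ofA K S) (DAlg.ofA K S)) (sum_casimir_tmul e s)
  have h' := congrArg (TensorProduct.comm K _ _) h
  simp only [map_sum, TensorProduct.map_tmul, TensorProduct.comm_tmul] at h'
  have : ∀ I, Algebra.TensorProduct.includeLeft (S := K) (DAlg.ofA K S (row e I)) *
      ((1 : DAlg K S) ⊗ₜ[K] DAlg.ofA K S s - DAlg.ofA K S s ⊗ₜ[K] (1 : DAlg K S)) *
      Algebra.TensorProduct.includeRight (DAlg.ofA K S (col e I)) =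
      DAlg.ofA K S (row e I) ⊗ₜ[K] DAlg.ofA K S (s * col e I) -
      DAlg.ofA K S (row e I * s) ⊗ₜ[K] DAlg.ofA K S (col e I) := by
    intro I
    simp only [Algebra.TensorProduct.includeLeft_apply, Algebra.TensorProduct.includeRight_apply,
      mul_sub, sub_mul, Algebra.TensorProduct.tmul_mul_tmul, one_mul, mul_one, DAlg.ofA_mul]
  simp only [LinearMap.zero_apply, mul_zero, zero_mul, zero_add, add_zero, this,
    Finset.sum_sub_distrib]
  rw [h', sub_self]

/-- For `s ∈ S`, the double derivation of `𝔻S` that vanishes on `S` and maps the gauge element to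
`1 ⊗ s - s ⊗ 1`. It depends linearly on `s`. -/
noncomputable def partialDer : S →ₗ[K] DAlg K S →ₗ[K] DAlg K S ⊗[K] DAlg K S where
  toFun s := (exists_partialDer e s).choose
  map_add' s t := by
    refine IsTwDer.ext e (exists_partialDer e (s + t)).choose_spec.1
      ((exists_partialDer e s).choose_spec.1.add (exists_partialDer e t).choose_spec.1) ?_ ?_
    · intro u
      simp only [LinearMap.add_apply, (exists_partialDer e _).choose_spec.2.1, add_zero]
    · refine (exists_partialDer e (s + t)).choose_spec.2.2.trans ?_
      simp only [LinearMap.add_apply, (exists_partialDer e _).choose_spec.2.2, map_add,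
        TensorProduct.tmul_add, TensorProduct.add_tmul]
      abel
  map_smul' r s := by
    refine IsTwDer.ext e (exists_partialDer e (r • s)).choose_spec.1
      ((exists_partialDer e s).choose_spec.1.smul r) ?_ ?_
    · intro u
      simp only [LinearMap.smul_apply, (exists_partialDer e _).choose_spec.2.1, smul_zero]
    · refine (exists_partialDer e (r • s)).choose_spec.2.2.trans ?_
      simp only [LinearMap.smul_apply, (exists_partialDer e _).choose_spec.2.2, map_smul,
        TensorProduct.tmul_smul, TensorProduct.smul_tmul', smul_sub, RingHom.id_apply]

theorem isOuter_partialDer (s : S) : IsOuter (partialDer e s) :=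
  (exists_partialDer e s).choose_spec.1

theorem partialDer_mul_right (s : S) (a b : DAlg K S) : partialDer e s (a * b) =
    (a ⊗ₜ 1) * partialDer e s b + partialDer e s a * (1 ⊗ₜ b) :=
  isOuter_partialDer e s a b

theorem partialDer_ofA (s t : S) : partialDer e s (DAlg.ofA K S t) = 0 :=
  (exists_partialDer e s).choose_spec.2.1 t

theorem partialDer_gauge (s : S) :
    partialDer e s (gauge K S) = 1 ⊗ₜ DAlg.ofA K S s - DAlg.ofA K S s ⊗ₜ 1 :=
  (exists_partialDer e s).choose_spec.2.2

theorem partialDer_mul (s t : S) (a : DAlg K S) : partialDer e (s * t) a =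
    (1 ⊗ₜ DAlg.ofA K S s) * partialDer e t a + partialDer e s a * (DAlg.ofA K S t ⊗ₜ 1) := by
  have : partialDer e (s * t) =
      LinearMap.mulLeft K (1 ⊗ₜ DAlg.ofA K S s) ∘ₗ partialDer e t +
      LinearMap.mulRight K (DAlg.ofA K S t ⊗ₜ 1) ∘ₗ partialDer e s := by
    refine IsTwDer.ext e (isOuter_partialDer e _) (((isOuter_partialDer e t).mulLeft _).add
      ((isOuter_partialDer e s).mulRight _)) ?_ ?_
    · intro u
      simp [partialDer_ofA]
    · simp only [LinearMap.add_apply, LinearMap.comp_apply, LinearMap.mulLeft_apply,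
        LinearMap.mulRight_apply, partialDer_gauge, DAlg.ofA_mul, mul_sub, sub_mul,
        Algebra.TensorProduct.tmul_mul_tmul, one_mul, mul_one]
      abel
  exact LinearMap.congr_fun this a

/-- The derivations `partialDer` respect the defining relation of `𝔻S`. -/
theorem sum_partialDer (a : DAlg K S) :
    ∑ I, (partialDer e (row e I) a * ((gauge K S * DAlg.ofA K S (col e I)) ⊗ₜ 1) +
      (1 ⊗ₜ (DAlg.ofA K S (row e I) * gauge K S)) * partialDer e (col e I) a) =
    ∑ I, ((a * DAlg.ofA K S (col e I)) ⊗ₜ DAlg.ofA K S (row e I) -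
      DAlg.ofA K S (col e I) ⊗ₜ (DAlg.ofA K S (row e I) * a)) := by
  have h : ∑ I, (LinearMap.mulRight K ((gauge K S * DAlg.ofA K S (col e I)) ⊗ₜ 1) ∘ₗ
        partialDer e (row e I) +
      LinearMap.mulLeft K (1 ⊗ₜ (DAlg.ofA K S (row e I) * gauge K S)) ∘ₗ
        partialDer e (col e I)) =
      outerAd (∑ I, DAlg.ofA K S (col e I) ⊗ₜ DAlg.ofA K S (row e I)) := by
    refine IsTwDer.ext e (IsOuter.sum fun I => ((isOuter_partialDer e _).mulRight _).add
      ((isOuter_partialDer e _).mulLeft _)) (isOuter_outerAd _) ?_ ?_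
    · intro s
      have h := congrArg (TensorProduct.map (DAlg.ofA K S) (DAlg.ofA K S)) (sum_casimir_tmul e s)
      simp only [map_sum, TensorProduct.map_tmul] at h
      simp only [LinearMap.sum_apply, LinearMap.add_apply, LinearMap.comp_apply, partialDer_ofA,
        map_zero, add_zero, Finset.sum_const_zero, outerAd_apply, Finset.mul_sum, Finset.sum_mul,
        Algebra.TensorProduct.tmul_mul_tmul, one_mul, mul_one, ← DAlg.ofA_mul, h, sub_self]
    · have h1 : ∑ I, ((DAlg.ofA K S (row e I) * (gauge K S * DAlg.ofA K S (col e I))) ⊗ₜ[K]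
          (1 : DAlg K S)) = 0 := by
        simp only [← mul_assoc]
        rw [← TensorProduct.sum_tmul, sum_row_gauge_col, TensorProduct.zero_tmul]
      have h2 : ∑ I, ((1 : DAlg K S) ⊗ₜ[K] (DAlg.ofA K S (row e I) * gauge K S *
          DAlg.ofA K S (col e I))) = 0 := by
        rw [← TensorProduct.tmul_sum, sum_row_gauge_col, TensorProduct.tmul_zero]
      simp only [LinearMap.sum_apply, LinearMap.add_apply, LinearMap.comp_apply,
        LinearMap.mulRight_apply, LinearMap.mulLeft_apply, partialDer_gauge, outerAd_apply,
        Finset.mul_sum, Finset.sum_mul, mul_sub, sub_mul, Algebra.TensorProduct.tmul_mul_tmul,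
        one_mul, mul_one, Finset.sum_add_distrib, Finset.sum_sub_distrib, h1, h2]
      abel
  have := LinearMap.congr_fun h a
  simpa only [LinearMap.sum_apply, LinearMap.add_apply, LinearMap.comp_apply,
    LinearMap.mulRight_apply, LinearMap.mulLeft_apply, outerAd_apply, Finset.mul_sum,
    Finset.sum_mul, Algebra.TensorProduct.tmul_mul_tmul, one_mul, mul_one,
    Finset.sum_sub_distrib] using this

/-- The flip of `𝔻S ⊗ 𝔻S` without signs, an algebra automorphism. -/
noncomputable abbrev flip' : DAlg K S ⊗[K] DAlg K S ≃ₐ[K] DAlg K S ⊗[K] DAlg K S :=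
  Algebra.TensorProduct.comm K (DAlg K S) (DAlg K S)

include e in
/-- The values of `{{a, -}}` on the generators extend to `𝔻S`. On `S` they are forced by
antisymmetry, and the flip of the defining relation is the identity `sum_partialDer` for `a`. -/
theorem exists_unsignedBracket (a : DAlg K S) :
    ∃ D : DAlg K S →ₗ[K] DAlg K S ⊗[K] DAlg K S,
    IsOuter D ∧ (∀ s, D (DAlg.ofA K S s) = -flip' (partialDer e s a)) ∧
      D (gauge K S) = 1 ⊗ₜ a - a ⊗ₜ 1 := by
  have := exists_twDer e (R := DAlg K S ⊗[K] DAlg K S) (Algebra.TensorProduct.includeLeft)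
    (Algebra.TensorProduct.includeRight)
    (-(flip'.toLinearMap ∘ₗ (partialDer e).flip a)) (1 ⊗ₜ a - a ⊗ₜ 1) ?_ ?_
  · obtain ⟨D, h1, h2, h3⟩ := this
    exact ⟨D, h1, h2, h3⟩
  · intro s t
    simp only [LinearMap.neg_apply, LinearMap.comp_apply, LinearMap.flip_apply,
      AlgEquiv.toLinearMap_apply, partialDer_mul, map_add, map_mul,
      Algebra.TensorProduct.comm_tmul, Algebra.TensorProduct.includeLeft_apply,
      Algebra.TensorProduct.includeRight_apply, mul_neg, neg_mul, neg_add]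
  · apply (flip' (K := K) (S := S)).injective
    have hc : ∀ ξ : DAlg K S ⊗[K] DAlg K S, flip' (flip' ξ) = ξ := fun ξ =>
      (flip' (K := K) (S := S)).symm_apply_apply ξ
    rw [map_zero, map_sum, ← sub_self (∑ I, ((a * DAlg.ofA K S (col e I)) ⊗ₜ[K]
      DAlg.ofA K S (row e I) - DAlg.ofA K S (col e I) ⊗ₜ[K] (DAlg.ofA K S (row e I) * a)))]
    conv_rhs => enter [2]; rw [← sum_partialDer e a]
    rw [← Finset.sum_sub_distrib]
    refine Finset.sum_congr rfl fun I _ => ?_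
    simp only [LinearMap.neg_apply, LinearMap.comp_apply, LinearMap.flip_apply,
      AlgEquiv.toLinearMap_apply, map_add, map_mul, map_neg, map_sub,
      Algebra.TensorProduct.comm_tmul, Algebra.TensorProduct.includeLeft_apply,
      Algebra.TensorProduct.includeRight_apply, hc, mul_neg, neg_mul, mul_assoc, mul_sub, sub_mul,
      Algebra.TensorProduct.tmul_mul_tmul, one_mul, mul_one]
    abel

/-- The double bracket of `𝔻S` without signs, that is, with the gauge element regarded as an even
element. -/
noncomputable def unsignedBracket : DAlg K S →ₗ[K] DAlg K S →ₗ[K] DAlg K S ⊗[K] DAlg K S where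
  toFun a := (exists_unsignedBracket e a).choose
  map_add' a b := by
    refine IsTwDer.ext e (exists_unsignedBracket e (a + b)).choose_spec.1
      ((exists_unsignedBracket e a).choose_spec.1.add
        (exists_unsignedBracket e b).choose_spec.1) ?_ ?_
    · intro u
      refine ((exists_unsignedBracket e (a + b)).choose_spec.2.1 u).trans ?_
      simp only [LinearMap.add_apply, (exists_unsignedBracket e _).choose_spec.2.1, map_add,
        neg_add]
    · refine (exists_unsignedBracket e (a + b)).choose_spec.2.2.trans ?_
      simp only [LinearMap.add_apply, (exists_unsignedBracket e _).choose_spec.2.2,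
        TensorProduct.tmul_add, TensorProduct.add_tmul]
      abel
  map_smul' r a := by
    refine IsTwDer.ext e (exists_unsignedBracket e (r • a)).choose_spec.1
      ((exists_unsignedBracket e a).choose_spec.1.smul r) ?_ ?_
    · intro u
      refine ((exists_unsignedBracket e (r • a)).choose_spec.2.1 u).trans ?_
      simp only [LinearMap.smul_apply, (exists_unsignedBracket e _).choose_spec.2.1, map_smul,
        RingHom.id_apply, smul_neg]
    · refine (exists_unsignedBracket e (r • a)).choose_spec.2.2.trans ?_
      simp only [LinearMap.smul_apply, (exists_unsignedBracket e _).choose_spec.2.2,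
        TensorProduct.tmul_smul, TensorProduct.smul_tmul', smul_sub, RingHom.id_apply]

theorem isOuter_unsignedBracket (a : DAlg K S) : IsOuter (unsignedBracket e a) :=
  (exists_unsignedBracket e a).choose_spec.1

theorem unsignedBracket_ofA (a : DAlg K S) (s : S) :
    unsignedBracket e a (DAlg.ofA K S s) = -flip' (partialDer e s a) :=
  (exists_unsignedBracket e a).choose_spec.2.1 s

theorem unsignedBracket_gauge (a : DAlg K S) :
    unsignedBracket e a (gauge K S) = 1 ⊗ₜ a - a ⊗ₜ 1 :=
  (exists_unsignedBracket e a).choose_spec.2.2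

theorem unsignedBracket_mul_right (a b c : DAlg K S) : unsignedBracket e a (b * c) =
    (b ⊗ₜ 1) * unsignedBracket e a c + unsignedBracket e a b * (1 ⊗ₜ c) :=
  isOuter_unsignedBracket e a b c

/-- In its first argument, the bracket is a derivation for the inner bimodule structure. -/
theorem unsignedBracket_mul_left (a a' b : DAlg K S) : unsignedBracket e (a * a') b =
    (1 ⊗ₜ a) * unsignedBracket e a' b + unsignedBracket e a b * (a' ⊗ₜ 1) := by
  have : unsignedBracket e (a * a') =
      LinearMap.mulLeft K (1 ⊗ₜ a) ∘ₗ unsignedBracket e a' +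
      LinearMap.mulRight K (a' ⊗ₜ 1) ∘ₗ unsignedBracket e a := by
    refine IsTwDer.ext e (isOuter_unsignedBracket e _)
      (((isOuter_unsignedBracket e a').mulLeft _).add
        ((isOuter_unsignedBracket e a).mulRight _)) ?_ ?_
    · intro s
      simp only [LinearMap.add_apply, LinearMap.comp_apply, LinearMap.mulLeft_apply,
        LinearMap.mulRight_apply, unsignedBracket_ofA, isOuter_partialDer e s a a', map_add,
        map_mul, Algebra.TensorProduct.comm_tmul, mul_neg, neg_mul, neg_add]
    · simp only [LinearMap.add_apply, LinearMap.comp_apply, LinearMap.mulLeft_apply,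
        LinearMap.mulRight_apply, unsignedBracket_gauge, mul_sub, sub_mul,
        Algebra.TensorProduct.tmul_mul_tmul, one_mul, mul_one]
      abel
  exact LinearMap.congr_fun this b

theorem unsignedBracket_ofA_left (s : S) : unsignedBracket e (DAlg.ofA K S s) = partialDer e s := by
  refine IsTwDer.ext e (isOuter_unsignedBracket e _) (isOuter_partialDer e s) ?_ ?_
  · intro t
    rw [unsignedBracket_ofA, partialDer_ofA, partialDer_ofA, map_zero, neg_zero]
  · rw [unsignedBracket_gauge, partialDer_gauge]

theorem unsignedBracket_gauge_left (a : DAlg K S) :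
    unsignedBracket e (gauge K S) a = 1 ⊗ₜ a - a ⊗ₜ 1 := by
  have : unsignedBracket e (gauge K S) = -outerAd (1 ⊗ₜ 1) := by
    refine IsTwDer.ext e (isOuter_unsignedBracket e _)
      (by rw [← neg_one_smul K]; exact (isOuter_outerAd _).smul _) ?_ ?_
    · intro t
      rw [unsignedBracket_ofA, partialDer_gauge]
      simp [outerAd_apply]
    · rw [unsignedBracket_gauge]
      simp [outerAd_apply]
  rw [this]
  simp [outerAd_apply]

/-- The unsigned bracket is antisymmetric. -/
theorem unsignedBracket_swap (a b : DAlg K S) :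
    unsignedBracket e a b = -flip' (unsignedBracket e b a) := by
  have hout : IsOuter (-(flip'.toLinearMap ∘ₗ (unsignedBracket e).flip a)) := by
    intro b c
    simp only [LinearMap.neg_apply, LinearMap.comp_apply, LinearMap.flip_apply,
      AlgEquiv.toLinearMap_apply, unsignedBracket_mul_left, map_add, map_mul,
      Algebra.TensorProduct.comm_tmul, mul_neg, neg_mul, neg_add]
  have := IsTwDer.ext e (isOuter_unsignedBracket e a) hout ?_ ?_
  · exact LinearMap.congr_fun this b
  · intro s
    simp only [LinearMap.neg_apply, LinearMap.comp_apply, LinearMap.flip_apply,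
      AlgEquiv.toLinearMap_apply, unsignedBracket_ofA, unsignedBracket_ofA_left]
  · simp only [LinearMap.neg_apply, LinearMap.comp_apply, LinearMap.flip_apply,
      AlgEquiv.toLinearMap_apply, unsignedBracket_gauge, unsignedBracket_gauge_left, map_sub,
      Algebra.TensorProduct.comm_tmul, neg_sub]

/-- The double bracket of two elements of degree one, `a E b` and `c E c'`, where `E` is the gauge
element: six terms, each linear in `E`. -/
theorem unsignedBracket_generators (a b c c' : S) :
    unsignedBracket e (DAlg.ofA K S a * gauge K S * DAlg.ofA K S b)
      (DAlg.ofA K S c * gauge K S * DAlg.ofA K S c') =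
    (DAlg.ofA K S c * gauge K S * DAlg.ofA K S b) ⊗ₜ DAlg.ofA K S (a * c')
    - (DAlg.ofA K S c * gauge K S * DAlg.ofA K S (c' * b)) ⊗ₜ DAlg.ofA K S a
    + DAlg.ofA K S c ⊗ₜ (DAlg.ofA K S a * gauge K S * DAlg.ofA K S (b * c'))
    - (DAlg.ofA K S (c * a) * gauge K S * DAlg.ofA K S b) ⊗ₜ DAlg.ofA K S c'
    + DAlg.ofA K S b ⊗ₜ (DAlg.ofA K S (a * c) * gauge K S * DAlg.ofA K S c')
    - DAlg.ofA K S (c * b) ⊗ₜ (DAlg.ofA K S a * gauge K S * DAlg.ofA K S c') := by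
  simp only [unsignedBracket_mul_right, unsignedBracket_ofA, unsignedBracket_gauge,
    partialDer_mul_right, partialDer_ofA, partialDer_gauge]
  simp only [map_sub, Algebra.TensorProduct.comm_tmul,
    add_mul, mul_sub, sub_mul, mul_zero, zero_mul, add_zero, zero_add,
    Algebra.TensorProduct.tmul_mul_tmul, one_mul, mul_one, DAlg.ofA_mul, neg_sub, mul_assoc]
  abel

end UnsignedBracket

/-! ### Signs -/

section Signs

variable (K : Type*) [Field K]

theorem sgn_add (m n : ℤ) : sgn K (m + n) = sgn K m * sgn K n := by
  simp [sgn, Int.negOnePow_add]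

theorem sgn_of_even {n : ℤ} (h : Even n) : sgn K n = 1 := by
  simp [sgn, Int.negOnePow_even n h]

theorem sgn_of_odd {n : ℤ} (h : Odd n) : sgn K n = -1 := by
  simp [sgn, Int.negOnePow_odd n h]

theorem sgn_zero : sgn K 0 = 1 := sgn_of_even K Even.zero

theorem sgn_congr {m n : ℤ} (h : Even (m - n)) : sgn K m = sgn K n := by
  rw [← sub_add_cancel m n, sgn_add, sgn_of_even K h, one_mul]

theorem sgn_congr_neg {m n : ℤ} (h : Odd (m - n)) : sgn K m = -sgn K n := by
  rw [← sub_add_cancel m n, sgn_add, sgn_of_odd K h, neg_one_mul]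

theorem sgn_mul_self (n : ℤ) : sgn K n * sgn K n = 1 := by
  rw [← sgn_add, sgn_of_even K (Even.add_self n)]

end Signs

/-! ### Parity and the graded flip -/

section Parity

variable {K : Type*} [Field K] {ι : Type*} [DecidableEq ι] [Fintype ι] {d : ι → ℕ}
  [∀ i, NeZero (d i)] {S : Type*} [Ring S]
  [Algebra K S] (e : S ≃ₐ[K] ((i : ι) → Matrix (Fin (d i)) (Fin (d i)) K))

theorem gauge_mem : gauge K S ∈ DAlg.deg K S 1 := DAlg.ofD_mem _

include e in
/-- A multiplicative family of subspaces that contains the generators contains the homogeneous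
parts of `𝔻S`. -/
theorem DAlg.deg_le {F : ℕ → Submodule K (DAlg K S)} (hA : ∀ s, DAlg.ofA K S s ∈ F 0)
    (hE : gauge K S ∈ F 1) (hmul : ∀ m n x y, x ∈ F m → y ∈ F n → x * y ∈ F (m + n)) (n : ℕ) :
    DAlg.deg K S n ≤ F n := by
  have hD : LinearMap.range (DAlg.ofD K S) ≤ F 1 := by
    rintro _ ⟨δ, rfl⟩
    obtain ⟨ξ, rfl⟩ := DDer.exists_inner e δ
    rw [← DDer.innerLin_apply]
    induction ξ with
    | zero => simp
    | tmul t s =>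
      rw [DDer.innerLin_apply, ofD_inner_tmul]
      exact hmul 1 0 _ _ (hmul 0 1 _ _ (hA _) hE) (hA _)
    | add ξ η h1 h2 => rw [map_add, map_add]; exact add_mem h1 h2
  rw [DAlg.deg]
  induction n with
  | zero =>
    rw [pow_zero, mul_one]
    rintro _ ⟨s, rfl⟩
    exact hA s
  | succ n ih =>
    rw [pow_succ, ← mul_assoc, Submodule.mul_le]
    exact fun x hx y hy => hmul n 1 x y (ih hx) (hD hy)

variable (K S) in
/-- The canonical map `S → 𝔻S` as a homomorphism of algebras. -/
noncomputable def DAlg.ofAHom : S →ₐ[K] DAlg K S :=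
  AlgHom.ofLinearMap (DAlg.ofA K S) DAlg.ofA_one DAlg.ofA_mul

/-- The automorphism of `𝔻S` that multiplies the part of degree `n` by `(-1)^{kn}`. -/
noncomputable def par (k : ℤ) : DAlg K S →ₐ[K] DAlg K S :=
  DAlg.lift e (DAlg.ofAHom K S) (sgn K k • gauge K S) (by
    simp only [mul_smul_comm, smul_mul_assoc, ← Finset.smul_sum]
    exact smul_eq_zero_of_right _ (sum_row_gauge_col e))

theorem par_ofA (k : ℤ) (s : S) : par e k (DAlg.ofA K S s) = DAlg.ofA K S s :=
  DAlg.lift_ofA _ _ _ _ _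

theorem par_gauge (k : ℤ) : par e k (gauge K S) = sgn K k • gauge K S :=
  DAlg.lift_gauge _ _ _ _

theorem par_par (k l : ℤ) (x : DAlg K S) : par e k (par e l x) = par e (k + l) x := by
  have : (par e k).comp (par e l) = par e (k + l) := by
    refine DAlg.algHom_ext e (fun s => ?_) ?_
    · simp [par_ofA]
    · simp [par_gauge, sgn_add, smul_smul, mul_comm]
  exact DFunLike.congr_fun this x

theorem par_of_even {k : ℤ} (hk : Even k) (x : DAlg K S) : par e k x = x := by
  have : par e k = AlgHom.id K _ := by
    refine DAlg.algHom_ext e (fun s => ?_) ?_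
    · simp [par_ofA]
    · simp [par_gauge, sgn_of_even K hk]
  exact DFunLike.congr_fun this x

theorem par_mem_deg (k : ℤ) (n : ℕ) (x : DAlg K S) (hx : x ∈ DAlg.deg K S n) :
    par e k x = sgn K (k * n) • x := by
  have := DAlg.deg_le e (F := fun n => LinearMap.ker
    ((par e k).toLinearMap - sgn K (k * n) • LinearMap.id)) ?_ ?_ ?_ n hx
  · simpa [sub_eq_zero] using this
  · intro s
    simp [par_ofA, sgn_zero]
  · simp [par_gauge]
  · intro m n x y hx hy
    simp only [LinearMap.mem_ker, LinearMap.sub_apply, AlgHom.toLinearMap_apply,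
      LinearMap.smul_apply, LinearMap.id_apply, sub_eq_zero] at hx hy ⊢
    rw [map_mul, hx, hy, smul_mul_smul_comm, ← sgn_add]
    push_cast
    rw [mul_add]

/-- `x` is a sum of homogeneous elements whose degrees have the parity of `i`. -/
def HasParity (i : ℤ) (x : DAlg K S) : Prop := ∀ k, par e k x = sgn K (k * i) • x

theorem HasParity.of_mem_deg {n : ℕ} {x : DAlg K S} (hx : x ∈ DAlg.deg K S n) :
    HasParity e n x := fun k => par_mem_deg e k n x hx

theorem HasParity.ofA (s : S) : HasParity e 0 (DAlg.ofA K S s) := fun k => by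
  rw [par_ofA, mul_zero, sgn_zero, one_smul]

theorem HasParity.one : HasParity e 0 (1 : DAlg K S) := fun k => by
  rw [map_one, mul_zero, sgn_zero, one_smul]

theorem HasParity.gauge : HasParity e 1 (gauge K S) := fun k => by
  rw [par_gauge, mul_one]

variable {e}

theorem HasParity.mul {i j : ℤ} {x y : DAlg K S} (hx : HasParity e i x) (hy : HasParity e j y) :
    HasParity e (i + j) (x * y) := fun k => by
  rw [map_mul, hx, hy, smul_mul_smul_comm, ← sgn_add, mul_add]

theorem HasParity.add {i : ℤ} {x y : DAlg K S} (hx : HasParity e i x) (hy : HasParity e i y) :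
    HasParity e i (x + y) := fun k => by
  rw [map_add, hx, hy, smul_add]

theorem HasParity.smul {i : ℤ} {x : DAlg K S} (hx : HasParity e i x) (r : K) :
    HasParity e i (r • x) := fun k => by
  rw [map_smul, hx, smul_comm]

theorem HasParity.neg {i : ℤ} {x : DAlg K S} (hx : HasParity e i x) :
    HasParity e i (-x) := fun k => by
  rw [map_neg, hx, smul_neg]

theorem HasParity.congr {i j : ℤ} {x : DAlg K S} (hx : HasParity e i x) (h : Even (i - j)) :
    HasParity e j x := fun k => by
  rw [hx, sgn_congr K (by rw [← mul_sub]; exact h.mul_left k)]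

variable (e)

include e in
/-- A linear statement about `𝔻S` need only be proved for elements that have a parity. -/
theorem parity_induction {P : DAlg K S → Prop} (h0 : P 0) (hadd : ∀ x y, P x → P y → P (x + y))
    (h : ∀ i x, HasParity e i x → P x) (x : DAlg K S) : P x := by
  induction x using DirectSum.Decomposition.inductionOn (DAlg.deg K S) with
  | zero => exact h0
  | homogeneous x => exact h _ _ (HasParity.of_mem_deg e x.2)
  | add x y hx hy => exact hadd _ _ hx hy

theorem gradedFlip_homogeneous (m n : ℕ) (x y : DAlg K S) (hx : x ∈ DAlg.deg K S m)
    (hy : y ∈ DAlg.deg K S n) :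
    gradedFlip (x ⊗ₜ[K] y) = sgn K ((m : ℤ) * n) • (y ⊗ₜ x) := by
  have h := TensorProduct.gradedComm_of_tmul_of K (fun n => DAlg.deg K S n)
    (fun n => DAlg.deg K S n) m n ⟨x, hx⟩ ⟨y, hy⟩
  have h1 : DirectSum.decomposeLinearEquiv (DAlg.deg K S) x =
      DirectSum.lof K ℕ (fun n => DAlg.deg K S n) m ⟨x, hx⟩ :=
    DirectSum.decompose_of_mem _ hx
  have h2 : DirectSum.decomposeLinearEquiv (DAlg.deg K S) y =
      DirectSum.lof K ℕ (fun n => DAlg.deg K S n) n ⟨y, hy⟩ :=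
    DirectSum.decompose_of_mem _ hy
  simp only [gradedFlip, LinearEquiv.trans_apply, TensorProduct.congr_tmul]
  rw [h1, h2, h, ← h1, ← h2, LinearEquiv.symm_apply_eq]
  rw [map_smul, TensorProduct.congr_tmul]
  have hs : sgn K ((m : ℤ) * n) = (((-1 : ℤˣ) ^ (n * m) : ℤˣ) : ℤ) := by
    rw [sgn, mul_comm, ← Nat.cast_mul, Int.negOnePow_def, zpow_natCast]
  rw [hs, Units.smul_def]
  exact (Int.cast_smul_eq_zsmul K _ _).symm

/-- The graded flip in terms of the plain flip and the parity automorphism: on homogeneous elements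
`(1 + (-1)^n + (-1)^m - (-1)^{m + n}) / 2 = (-1)^{mn}`. -/
theorem gradedFlip_two_smul (x y : DAlg K S) :
    (2 : K) • gradedFlip (x ⊗ₜ[K] y) =
      y ⊗ₜ x + y ⊗ₜ par e 1 x + par e 1 y ⊗ₜ x - par e 1 y ⊗ₜ par e 1 x := by
  induction x using DirectSum.Decomposition.inductionOn (DAlg.deg K S) with
  | zero => simp
  | add x x' hx hx' =>
    simp only [TensorProduct.add_tmul, TensorProduct.tmul_add, map_add, smul_add, hx, hx']
    abel
  | @homogeneous m x =>
    induction y using DirectSum.Decomposition.inductionOn (DAlg.deg K S) with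
    | zero => simp
    | add y y' hy hy' =>
      simp only [TensorProduct.add_tmul, TensorProduct.tmul_add, map_add, smul_add, hy, hy']
      abel
    | @homogeneous n y =>
      rw [gradedFlip_homogeneous m n _ _ x.2 y.2, par_mem_deg e _ _ _ x.2,
        par_mem_deg e _ _ _ y.2]
      simp only [one_mul, TensorProduct.tmul_smul, ← TensorProduct.smul_tmul', smul_smul]
      nth_rewrite 2 [← one_smul K ((y : DAlg K S) ⊗ₜ[K] (x : DAlg K S))]
      simp only [← add_smul, ← sub_smul]
      congr 1
      rcases Int.even_or_odd (m : ℤ) with hm | hm <;> rcases Int.even_or_odd (n : ℤ) with hn | hn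
      · rw [sgn_of_even K hm, sgn_of_even K hn, sgn_of_even K (hm.mul_right _)]; ring
      · rw [sgn_of_even K hm, sgn_of_odd K hn, sgn_of_even K (hm.mul_right _)]; ring
      · rw [sgn_of_odd K hm, sgn_of_even K hn, sgn_of_even K (hn.mul_left _)]; ring
      · rw [sgn_of_odd K hm, sgn_of_odd K hn, sgn_of_odd K (hm.mul hn)]; ring

variable [CharZero K]

theorem gradedFlip_tmul {i j : ℤ} {x y : DAlg K S} (hx : HasParity e i x)
    (hy : HasParity e j y) : gradedFlip (x ⊗ₜ[K] y) = sgn K (i * j) • (y ⊗ₜ x) := by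
  have h2 : (2 : K) ≠ 0 := two_ne_zero
  apply smul_right_injective _ h2
  simp only
  rw [gradedFlip_two_smul e, hx, hy]
  simp only [one_mul, TensorProduct.tmul_smul, ← TensorProduct.smul_tmul', smul_smul]
  nth_rewrite 1 [← one_smul K (y ⊗ₜ[K] x)]
  simp only [← add_smul, ← sub_smul]
  congr 1
  rcases Int.even_or_odd i with hm | hm <;> rcases Int.even_or_odd j with hn | hn
  · rw [sgn_of_even K hm, sgn_of_even K hn, sgn_of_even K (hm.mul_right _)]; ring
  · rw [sgn_of_even K hm, sgn_of_odd K hn, sgn_of_even K (hm.mul_right _)]; ring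
  · rw [sgn_of_odd K hm, sgn_of_even K hn, sgn_of_even K (hn.mul_left _)]; ring
  · rw [sgn_of_odd K hm, sgn_of_odd K hn, sgn_of_odd K (hm.mul hn)]; ring

/-- `par k` on both tensor factors. -/
noncomputable abbrev parBoth (k : ℤ) : DAlg K S ⊗[K] DAlg K S →ₐ[K] DAlg K S ⊗[K] DAlg K S :=
  Algebra.TensorProduct.map (par e k) (par e k)

/-- `par k` on the left tensor factor. -/
noncomputable abbrev parLeft (k : ℤ) : DAlg K S ⊗[K] DAlg K S →ₐ[K] DAlg K S ⊗[K] DAlg K S :=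
  Algebra.TensorProduct.map (par e k) (AlgHom.id K _)

/-- Linear maps agree on a tensor of total parity `n` if they agree on the pure tensors
of total parity `n`. -/
theorem tensor_parity_ext {M : Type*} [AddCommGroup M] [Module K M]
    {F G : DAlg K S ⊗[K] DAlg K S →ₗ[K] M} (n : ℤ)
    (h : ∀ i j x y, HasParity e i x → HasParity e j y → Even (i + j - n) →
      F (x ⊗ₜ y) = G (x ⊗ₜ y)) (ξ : DAlg K S ⊗[K] DAlg K S)
    (hξ : parBoth e 1 ξ = sgn K n • ξ) : F ξ = G ξ := by
  have key : ∀ η : DAlg K S ⊗[K] DAlg K S,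
      F (η + sgn K n • parBoth e 1 η) = G (η + sgn K n • parBoth e 1 η) := by
    intro η
    induction η with
    | zero => simp
    | add η η' h1 h2 =>
      have : η + η' + sgn K n • parBoth e 1 (η + η') =
          (η + sgn K n • parBoth e 1 η) + (η' + sgn K n • parBoth e 1 η') := by
        rw [map_add, smul_add]; abel
      rw [this, map_add F (_ + _) (_ + _), map_add G (_ + _) (_ + _), h1, h2]
    | tmul x y =>
      revert y
      induction x using parity_induction e with
      | h0 => simp
      | hadd x x' h1 h2 =>
        intro y
        have : (x + x') ⊗ₜ[K] y + sgn K n • parBoth e 1 ((x + x') ⊗ₜ y) =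
            (x ⊗ₜ[K] y + sgn K n • parBoth e 1 (x ⊗ₜ y)) +
            (x' ⊗ₜ[K] y + sgn K n • parBoth e 1 (x' ⊗ₜ y)) := by
          rw [TensorProduct.add_tmul, map_add, smul_add]; abel
        rw [this, map_add F (_ + _) (_ + _), map_add G (_ + _) (_ + _), h1, h2]
      | h i x hx =>
        intro y
        induction y using parity_induction e with
        | h0 => simp
        | hadd y y' h1 h2 =>
          have : x ⊗ₜ[K] (y + y') + sgn K n • parBoth e 1 (x ⊗ₜ (y + y')) =
              (x ⊗ₜ[K] y + sgn K n • parBoth e 1 (x ⊗ₜ y)) +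
              (x ⊗ₜ[K] y' + sgn K n • parBoth e 1 (x ⊗ₜ y')) := by
            rw [TensorProduct.tmul_add, map_add, smul_add]; abel
          rw [this, map_add F (_ + _) (_ + _), map_add G (_ + _) (_ + _), h1, h2]
        | h j y hy =>
          rw [Algebra.TensorProduct.map_tmul, hx, hy, TensorProduct.tmul_smul,
            ← TensorProduct.smul_tmul', smul_smul, smul_smul]
          rcases Int.even_or_odd (i + j - n) with hn | hn
          · rw [map_add, map_add, map_smul, map_smul, h i j x y hx hy hn]
          · have : sgn K n * sgn K (1 * j) * sgn K (1 * i) = -1 := by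
              rw [one_mul, one_mul, ← sgn_add, ← sgn_add, sgn_of_odd]
              have : n + j + i = (i + j - n) + 2 * n := by ring
              rw [this]
              exact hn.add_even (even_two_mul n)
            rw [this, neg_one_smul, add_neg_cancel, map_zero, map_zero]
  have h2 : (2 : K) ≠ 0 := two_ne_zero
  have h3 := key ξ
  rw [hξ, smul_smul, sgn_mul_self, one_smul, ← two_smul K, map_smul, map_smul] at h3
  exact smul_right_injective _ h2 h3

omit [CharZero K]

theorem parBoth_partialDer (k : ℤ) (s : S) (a : DAlg K S) :
    parBoth e k (partialDer e s a) = sgn K k • partialDer e s (par e k a) := by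
  have h1 : IsTwDer (fun b => par e k b ⊗ₜ[K] (1 : DAlg K S))
      (fun c => (1 : DAlg K S) ⊗ₜ[K] par e k c)
      ((parBoth e k).toLinearMap ∘ₗ partialDer e s) := by
    intro b c
    simp only [LinearMap.comp_apply, partialDer_mul_right, AlgHom.toLinearMap_apply, map_add,
      map_mul, Algebra.TensorProduct.map_tmul, map_one]
  have h2 : IsTwDer (fun b => par e k b ⊗ₜ[K] (1 : DAlg K S))
      (fun c => (1 : DAlg K S) ⊗ₜ[K] par e k c)
      (sgn K k • (partialDer e s ∘ₗ (par e k).toLinearMap)) := by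
    intro b c
    simp only [LinearMap.comp_apply, LinearMap.smul_apply, partialDer_mul_right,
      AlgHom.toLinearMap_apply, map_mul, smul_add, mul_smul_comm, smul_mul_assoc]
  refine LinearMap.congr_fun (IsTwDer.ext e h1 h2 ?_ ?_) a
  · intro t
    simp [partialDer_ofA, par_ofA]
  · simp [partialDer_gauge, par_gauge, smul_smul, sgn_mul_self, par_ofA]

/-- The unsigned bracket lowers the total degree by one, so its parity is odd. -/
theorem parBoth_unsignedBracket (k : ℤ) (a b : DAlg K S) :
    parBoth e k (unsignedBracket e a b) =
      sgn K k • unsignedBracket e (par e k a) (par e k b) := by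
  have h1 : IsTwDer (fun b => par e k b ⊗ₜ[K] (1 : DAlg K S))
      (fun c => (1 : DAlg K S) ⊗ₜ[K] par e k c)
      ((parBoth e k).toLinearMap ∘ₗ unsignedBracket e a) := by
    intro b c
    simp only [LinearMap.comp_apply, unsignedBracket_mul_right, AlgHom.toLinearMap_apply, map_add,
      map_mul, Algebra.TensorProduct.map_tmul, map_one]
  have h2 : IsTwDer (fun b => par e k b ⊗ₜ[K] (1 : DAlg K S))
      (fun c => (1 : DAlg K S) ⊗ₜ[K] par e k c)
      (sgn K k • (unsignedBracket e (par e k a) ∘ₗ (par e k).toLinearMap)) := by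
    intro b c
    simp only [LinearMap.comp_apply, LinearMap.smul_apply, unsignedBracket_mul_right,
      AlgHom.toLinearMap_apply, map_mul, smul_add, mul_smul_comm, smul_mul_assoc]
  refine LinearMap.congr_fun (IsTwDer.ext e h1 h2 ?_ ?_) b
  · intro t
    have hc : ∀ ξ : DAlg K S ⊗[K] DAlg K S, parBoth e k (flip' ξ) = flip' (parBoth e k ξ) := by
      intro ξ
      induction ξ with
      | zero => simp
      | tmul x y => simp
      | add x y hx hy => rw [map_add, map_add, hx, hy, map_add, map_add]
    simp only [LinearMap.comp_apply, LinearMap.smul_apply, AlgHom.toLinearMap_apply, par_ofA,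
      unsignedBracket_ofA, map_neg, hc, parBoth_partialDer, map_smul, smul_neg]
  · simp only [LinearMap.comp_apply, LinearMap.smul_apply, AlgHom.toLinearMap_apply, par_gauge,
      unsignedBracket_gauge, map_sub, map_smul, smul_smul, sgn_mul_self, one_smul,
      Algebra.TensorProduct.map_tmul, map_one]

theorem parBoth_unsignedBracket_of_parity {i j : ℤ} {a b : DAlg K S} (ha : HasParity e i a)
    (hb : HasParity e j b) : parBoth e 1 (unsignedBracket e a b) =
      sgn K (i + j - 1) • unsignedBracket e a b := by
  rw [parBoth_unsignedBracket, ha, hb, map_smul, map_smul, LinearMap.smul_apply, smul_smul,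
    smul_smul]
  congr 1
  rw [one_mul, one_mul, ← sgn_add, ← sgn_add]
  exact sgn_congr K ⟨1, by ring⟩

end Parity

/-! ### Existence and uniqueness of the double Schouten-Nijenhuis bracket -/

section SuperBracket

variable {K : Type*} [Field K] {ι : Type*} [DecidableEq ι] [Fintype ι] {d : ι → ℕ}
  [∀ i, NeZero (d i)] {S : Type*} [Ring S]
  [Algebra K S] (e : S ≃ₐ[K] ((i : ι) → Matrix (Fin (d i)) (Fin (d i)) K))

theorem par_congr {k l : ℤ} (h : Even (k - l)) (x : DAlg K S) : par e k x = par e l x := by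
  rw [← sub_add_cancel k l, ← par_par, par_of_even e h]

theorem parLeft_congr {k l : ℤ} (h : Even (k - l)) (ξ : DAlg K S ⊗[K] DAlg K S) :
    parLeft e k ξ = parLeft e l ξ := by
  have : par e k = par e l := AlgHom.ext (par_congr e h)
  rw [parLeft, this]

theorem parLeft_of_even {k : ℤ} (h : Even k) (ξ : DAlg K S ⊗[K] DAlg K S) :
    parLeft e k ξ = ξ := by
  have : par e k = AlgHom.id K _ := AlgHom.ext (par_of_even e h)
  rw [parLeft, this, Algebra.TensorProduct.map_id]
  rfl

theorem parLeft_tmul (k : ℤ) {i : ℤ} {x : DAlg K S} (hx : HasParity e i x) (y : DAlg K S) :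
    parLeft e k (x ⊗ₜ y) = sgn K (k * i) • (x ⊗ₜ y) := by
  rw [Algebra.TensorProduct.map_tmul, hx, AlgHom.id_apply, TensorProduct.smul_tmul']

/-- The projection of `𝔻S` onto its part of even degree. -/
noncomputable def evenPart : DAlg K S →ₗ[K] DAlg K S :=
  (2⁻¹ : K) • (LinearMap.id + (par e 1).toLinearMap)

/-- The projection of `𝔻S` onto its part of odd degree. -/
noncomputable def oddPart : DAlg K S →ₗ[K] DAlg K S :=
  (2⁻¹ : K) • (LinearMap.id - (par e 1).toLinearMap)

/-- The double Schouten-Nijenhuis bracket: `{{a, b}}` is the unsigned bracket, with the sign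
`(-1)^{(|a| - 1) i}` on the terms whose left tensor factor has degree `i`. -/
noncomputable def superBracket : DAlg K S →ₗ[K] DAlg K S →ₗ[K] DAlg K S ⊗[K] DAlg K S :=
  unsignedBracket e ∘ₗ oddPart e +
    (unsignedBracket e).compr₂ (parLeft e 1).toLinearMap ∘ₗ evenPart e

variable [CharZero K]

theorem superBracket_apply {i : ℤ} {a : DAlg K S} (ha : HasParity e i a) (b : DAlg K S) :
    superBracket e a b = parLeft e (i - 1) (unsignedBracket e a b) := by
  have h2 : (2⁻¹ : K) • (a + a) = a := by
    rw [← two_smul K, smul_smul, inv_mul_cancel₀ two_ne_zero, one_smul]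
  simp only [superBracket, LinearMap.add_apply, LinearMap.comp_apply, LinearMap.compr₂_apply,
    oddPart, evenPart, LinearMap.smul_apply, LinearMap.sub_apply, LinearMap.id_apply,
    AlgHom.toLinearMap_apply]
  rcases Int.even_or_odd i with hi | hi
  · rw [ha, one_mul, sgn_of_even K hi, one_smul, sub_self, smul_zero, map_zero,
      LinearMap.zero_apply, zero_add, h2]
    exact parLeft_congr e (by rw [sub_sub_eq_add_sub]; exact (by decide : Even (2 : ℤ)).sub hi) _
  · rw [ha, one_mul, sgn_of_odd K hi, neg_one_smul, sub_neg_eq_add, add_neg_cancel, smul_zero,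
      map_zero, LinearMap.zero_apply, map_zero, add_zero, h2]
    exact (parLeft_of_even e (hi.sub_odd odd_one) _).symm

omit [CharZero K] in
include e in
/-- An element of `𝔻er(S) ⊗ S` is determined by its evaluations, since a double derivation of `S`
is recovered linearly from its values on the matrix units. -/
theorem rTensor_evalAt_injective (l l' : DDer K S ⊗[K] S)
    (h : ∀ z : S, (DDer.evalAt z).rTensor S l = (DDer.evalAt z).rTensor S l') : l = l' := by
  have h1 : DDer.innerLin K S ∘ₗ DDer.toTensor e = LinearMap.id :=
    LinearMap.ext (DDer.inner_toTensor e)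
  have h2 : LinearMap.rTensor S (DDer.toTensor e) l = LinearMap.rTensor S (DDer.toTensor e) l' := by
    rw [DDer.toTensor, LinearMap.rTensor_neg, LinearMap.neg_apply, LinearMap.neg_apply,
      ← LinearMap.coe_rTensorHom, map_sum, LinearMap.sum_apply, LinearMap.sum_apply]
    simp only [LinearMap.coe_rTensorHom, LinearMap.rTensor_comp_apply, h]
  rw [← LinearMap.rTensor_id_apply S _ l, ← LinearMap.rTensor_id_apply S _ l', ← h1,
    LinearMap.rTensor_comp_apply, h2, LinearMap.rTensor_comp_apply]

omit [CharZero K] in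
include e in
/-- The analogue of `rTensor_evalAt_injective` for `S ⊗ 𝔻er(S)`. -/
theorem lTensor_evalAt_injective (r r' : S ⊗[K] DDer K S)
    (h : ∀ z : S, (DDer.evalAt z).lTensor S r = (DDer.evalAt z).lTensor S r') : r = r' := by
  have h1 : DDer.innerLin K S ∘ₗ DDer.toTensor e = LinearMap.id :=
    LinearMap.ext (DDer.inner_toTensor e)
  have h2 : LinearMap.lTensor S (DDer.toTensor e) r = LinearMap.lTensor S (DDer.toTensor e) r' := by
    rw [DDer.toTensor, LinearMap.lTensor_neg, LinearMap.neg_apply, LinearMap.neg_apply,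
      ← LinearMap.coe_lTensorHom, map_sum, LinearMap.sum_apply, LinearMap.sum_apply]
    simp only [LinearMap.coe_lTensorHom, LinearMap.lTensor_comp_apply, h]
  rw [← LinearMap.lTensor_id_apply S _ r, ← LinearMap.lTensor_id_apply S _ r', ← h1,
    LinearMap.lTensor_comp_apply, h2, LinearMap.lTensor_comp_apply]

/-- `ω` is the value at `(δ, Δ)` that `IsDoubleSchouten.ofD_ofD` prescribes. -/
def IsDerivationBracket {A : Type*} [Ring A] [Algebra K A] (δ Δ : DDer K A)
    (ω : DAlg K A ⊗[K] DAlg K A) : Prop :=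
  ∃ (l : DDer K A ⊗[K] A) (r : A ⊗[K] DDer K A),
    (∀ z : A, (DDer.evalAt z).rTensor A l =
      TensorProduct.rightComm K A A A (DDer.tildeL δ Δ z)) ∧
    (∀ z : A, (DDer.evalAt z).lTensor A r =
      TensorProduct.leftComm K A A A (DDer.tildeR δ Δ z)) ∧
    ω = TensorProduct.map (DAlg.ofD K A) (DAlg.ofA K A) l +
      TensorProduct.map (DAlg.ofA K A) (DAlg.ofD K A) r

omit [CharZero K] in
theorem IsDerivationBracket.add {A : Type*} [Ring A] [Algebra K A] {δ δ' Δ Δ' η : DDer K A}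
    {ω ω' : DAlg K A ⊗[K] DAlg K A} {η' : DDer K A}
    (h : IsDerivationBracket δ Δ ω) (h' : IsDerivationBracket δ' Δ' ω')
    (hL : DDer.tildeL η η' = DDer.tildeL δ Δ + DDer.tildeL δ' Δ')
    (hR : DDer.tildeR η η' = DDer.tildeR δ Δ + DDer.tildeR δ' Δ') :
    IsDerivationBracket η η' (ω + ω') := by
  obtain ⟨l, r, h1, h2, rfl⟩ := h
  obtain ⟨l', r', h1', h2', rfl⟩ := h'
  refine ⟨l + l', r + r', fun z => ?_, fun z => ?_, ?_⟩
  · rw [map_add, h1, h1', hL, LinearMap.add_apply, map_add]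
  · rw [map_add, h2, h2', hR, LinearMap.add_apply, map_add]
  · rw [map_add, map_add]; abel

omit [CharZero K] in
theorem tildeL_inner {A : Type*} [Ring A] [Algebra K A] (a b c c' z : A) :
    DDer.tildeL (K := K) (DDer.inner (b ⊗ₜ a)) (DDer.inner (c' ⊗ₜ c)) z =
    (b ⊗ₜ (a * c')) ⊗ₜ (c * z) - ((c' * b) ⊗ₜ a) ⊗ₜ (c * z)
    - ((b ⊗ₜ (a * (z * c'))) ⊗ₜ c - ((z * c' * b) ⊗ₜ a) ⊗ₜ c)
    - ((b ⊗ₜ c') ⊗ₜ (c * (a * z)) - (b ⊗ₜ (a * z * c')) ⊗ₜ c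
      - (((z * b) ⊗ₜ c') ⊗ₜ (c * a) - ((z * b) ⊗ₜ (a * c')) ⊗ₜ c)) := by
  simp only [DDer.tildeL, LinearMap.sub_apply, LinearMap.comp_apply, inner_apply_tmul, map_sub,
    LinearMap.rTensor_tmul, LinearMap.lTensor_tmul, TensorProduct.sub_tmul,
    TensorProduct.tmul_sub, LinearEquiv.coe_coe, TensorProduct.assoc_symm_tmul]

omit [CharZero K] in
theorem tildeR_inner {A : Type*} [Ring A] [Algebra K A] (a b c c' z : A) :
    DDer.tildeR (K := K) (DDer.inner (b ⊗ₜ a)) (DDer.inner (c' ⊗ₜ c)) z =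
    c' ⊗ₜ (b ⊗ₜ (a * (c * z))) - c' ⊗ₜ ((c * z * b) ⊗ₜ a)
    - ((z * c') ⊗ₜ (b ⊗ₜ (a * c)) - (z * c') ⊗ₜ ((c * b) ⊗ₜ a))
    - (c' ⊗ₜ ((c * b) ⊗ₜ (a * z)) - (b * c') ⊗ₜ (c ⊗ₜ (a * z))
      - (c' ⊗ₜ ((c * (z * b)) ⊗ₜ a) - (z * b * c') ⊗ₜ (c ⊗ₜ a))) := by
  simp only [DDer.tildeR, LinearMap.sub_apply, LinearMap.comp_apply, inner_apply_tmul, map_sub,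
    LinearMap.rTensor_tmul, LinearMap.lTensor_tmul, TensorProduct.sub_tmul,
    TensorProduct.tmul_sub, LinearEquiv.coe_coe, TensorProduct.assoc_tmul]

omit [CharZero K] in
/-- For the inner double derivations `a E b` and `c E c'`, three of the six terms of the bracket
lie in `𝔻er(S) ⊗ S` and three in `S ⊗ 𝔻er(S)`; each group is the corresponding double commutator.
-/
theorem isDerivationBracket_tmul (a b c c' : S) :
    IsDerivationBracket (DDer.inner (b ⊗ₜ a)) (DDer.inner (c' ⊗ₜ c))
      (unsignedBracket e (DAlg.ofD K S (DDer.inner (b ⊗ₜ a)))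
        (DAlg.ofD K S (DDer.inner (c' ⊗ₜ c)))) := by
  refine ⟨DDer.inner (b ⊗ₜ[K] c) ⊗ₜ[K] (a * c') + DDer.inner ((-(c' * b)) ⊗ₜ[K] c) ⊗ₜ[K] a
      + DDer.inner ((-b) ⊗ₜ[K] (c * a)) ⊗ₜ[K] c',
    c ⊗ₜ[K] DDer.inner ((b * c') ⊗ₜ[K] a) + b ⊗ₜ[K] DDer.inner (c' ⊗ₜ[K] (a * c))
      + (c * b) ⊗ₜ[K] DDer.inner ((-c') ⊗ₜ[K] a), fun z => ?_, fun z => ?_, ?_⟩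
  · have h : ∀ x y : S, DDer.evalAt z (DDer.inner (x ⊗ₜ[K] y)) =
      x ⊗ₜ (y * z) - (z * x) ⊗ₜ y := fun x y => inner_apply_tmul x y z
    rw [tildeL_inner]
    simp only [map_add, LinearMap.rTensor_tmul, h]
    simp only [map_sub, TensorProduct.neg_tmul, mul_neg, TensorProduct.rightComm_tmul,
      TensorProduct.sub_tmul, mul_assoc]
    abel
  · have h : ∀ x y : S, DDer.evalAt z (DDer.inner (x ⊗ₜ[K] y)) =
      x ⊗ₜ (y * z) - (z * x) ⊗ₜ y := fun x y => inner_apply_tmul x y z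
    rw [tildeR_inner]
    simp only [map_add, LinearMap.lTensor_tmul, h]
    simp only [map_sub, TensorProduct.leftComm_tmul,
      TensorProduct.neg_tmul, TensorProduct.tmul_neg, mul_neg,
      TensorProduct.tmul_sub, mul_assoc]
    abel
  · rw [ofD_inner_tmul, ofD_inner_tmul, unsignedBracket_generators]
    simp only [map_add, TensorProduct.map_tmul, ofD_inner_tmul]
    simp only [map_neg,
      TensorProduct.neg_tmul, TensorProduct.tmul_neg, mul_neg]
    abel

omit [CharZero K] in
theorem tildeL_add_left {A : Type*} [Ring A] [Algebra K A] (δ δ' Δ : DDer K A) :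
    DDer.tildeL (δ + δ') Δ = DDer.tildeL δ Δ + DDer.tildeL δ' Δ := by
  simp only [DDer.tildeL, Submodule.coe_add, LinearMap.rTensor_add, LinearMap.add_comp,
    LinearMap.comp_add]
  abel

omit [CharZero K] in
theorem tildeL_add_right {A : Type*} [Ring A] [Algebra K A] (δ Δ Δ' : DDer K A) :
    DDer.tildeL δ (Δ + Δ') = DDer.tildeL δ Δ + DDer.tildeL δ Δ' := by
  simp only [DDer.tildeL, Submodule.coe_add, LinearMap.lTensor_add, LinearMap.add_comp,
    LinearMap.comp_add]
  abel

omit [CharZero K] in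
theorem tildeR_add_left {A : Type*} [Ring A] [Algebra K A] (δ δ' Δ : DDer K A) :
    DDer.tildeR (δ + δ') Δ = DDer.tildeR δ Δ + DDer.tildeR δ' Δ := by
  simp only [DDer.tildeR, Submodule.coe_add, LinearMap.lTensor_add, LinearMap.add_comp,
    LinearMap.comp_add]
  abel

omit [CharZero K] in
theorem tildeR_add_right {A : Type*} [Ring A] [Algebra K A] (δ Δ Δ' : DDer K A) :
    DDer.tildeR δ (Δ + Δ') = DDer.tildeR δ Δ + DDer.tildeR δ Δ' := by
  simp only [DDer.tildeR, Submodule.coe_add, LinearMap.rTensor_add, LinearMap.add_comp,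
    LinearMap.comp_add]
  abel

omit [CharZero K] in
/-- The prescribed value is additive in both arguments, so it suffices to treat inner double
derivations that come from pure tensors. -/
theorem isDerivationBracket (δ Δ : DDer K S) :
    IsDerivationBracket δ Δ (unsignedBracket e (DAlg.ofD K S δ) (DAlg.ofD K S Δ)) := by
  obtain ⟨ξ, rfl⟩ := DDer.exists_inner e δ
  obtain ⟨η, rfl⟩ := DDer.exists_inner e Δ
  rw [← DDer.innerLin_apply, ← DDer.innerLin_apply]
  have h0 : ∀ δ Δ : DDer K S, δ = 0 ∨ Δ = 0 →
      IsDerivationBracket δ Δ (unsignedBracket e (DAlg.ofD K S δ) (DAlg.ofD K S Δ)) := by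
    rintro δ Δ (rfl | rfl) <;>
    exact ⟨0, 0, fun z => by simp [DDer.tildeL], fun z => by simp [DDer.tildeR], by simp⟩
  induction ξ with
  | zero => exact h0 _ _ (Or.inl (map_zero _))
  | add ξ ξ' h1 h2 =>
    rw [map_add, map_add, map_add, LinearMap.add_apply]
    exact h1.add h2 (tildeL_add_left _ _ _) (tildeR_add_left _ _ _)
  | tmul b a =>
    induction η with
    | zero => exact h0 _ _ (Or.inr (map_zero _))
    | add η η' h1 h2 =>
      rw [map_add, map_add, map_add]
      exact h1.add h2 (tildeL_add_right _ _ _) (tildeR_add_right _ _ _)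
    | tmul c' c => exact isDerivationBracket_tmul e a b c c'

omit [CharZero K] in
theorem partialDer_ofD (s : S) (δ : DDer K S) : partialDer e s (DAlg.ofD K S δ) =
    -flip' (TensorProduct.map (DAlg.ofA K S) (DAlg.ofA K S) (δ.1 s)) := by
  obtain ⟨ξ, rfl⟩ := DDer.exists_inner e δ
  rw [← DDer.innerLin_apply]
  induction ξ with
  | zero => simp
  | add ξ ξ' h1 h2 =>
    simp only [map_add, h1, h2, Submodule.coe_add, LinearMap.add_apply, neg_add]
  | tmul t u =>
    rw [DDer.innerLin_apply, ofD_inner_tmul, inner_apply_tmul]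
    simp only [partialDer_mul_right, partialDer_ofA, partialDer_gauge, map_sub,
      TensorProduct.map_tmul, Algebra.TensorProduct.comm_tmul, mul_zero, zero_mul, add_zero,
      zero_add, mul_sub, sub_mul, Algebra.TensorProduct.tmul_mul_tmul, one_mul, mul_one,
      DAlg.ofA_mul, neg_sub]

omit [CharZero K] in
theorem HasParity.ofD (δ : DDer K S) : HasParity e 1 (DAlg.ofD K S δ) := by
  have := HasParity.of_mem_deg e (DAlg.ofD_mem δ)
  simpa using this

/-- The signs that turn the antisymmetry of the unsigned bracket into graded antisymmetry. -/
theorem parLeft_unsignedBracket_swap {p q : ℤ} {a b : DAlg K S} (ha : HasParity e p a)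
    (hb : HasParity e q b) : parLeft e (p - 1) (unsignedBracket e a b) =
      -(sgn K ((p - 1) * (q - 1)) • gradedFlip (parLeft e (q - 1) (unsignedBracket e b a))) := by
  rw [unsignedBracket_swap, map_neg, neg_inj]
  have := tensor_parity_ext e (F := (parLeft e (p - 1)).toLinearMap ∘ₗ flip'.toLinearMap)
    (G := sgn K ((p - 1) * (q - 1)) • (gradedFlip.toLinearMap ∘ₗ
      (parLeft e (q - 1)).toLinearMap)) (q + p - 1) ?_ (unsignedBracket e b a)
      (parBoth_unsignedBracket_of_parity e hb ha)
  · exact this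
  · intro i j x y hx hy hij
    simp only [LinearMap.comp_apply, AlgHom.toLinearMap_apply, LinearMap.smul_apply,
      LinearEquiv.coe_coe, AlgEquiv.toLinearMap_apply, Algebra.TensorProduct.comm_tmul]
    rw [parLeft_tmul e _ hx, parLeft_tmul e _ hy, map_smul, gradedFlip_tmul e hx hy, smul_smul,
      smul_smul, ← sgn_add, ← sgn_add]
    congr 1
    apply sgn_congr
    simp only [Int.even_sub, Int.even_add, Int.even_mul, Int.not_even_one] at hij ⊢
    tauto

theorem isDoubleSchouten_superBracket : IsDoubleSchouten (superBracket e) where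
  ofA_ofA s t := by
    rw [superBracket_apply e (HasParity.ofA e s), unsignedBracket_ofA_left, partialDer_ofA,
      map_zero]
  ofD_ofA δ s := by
    rw [superBracket_apply e (HasParity.ofD e δ), parLeft_of_even e (by simp),
      unsignedBracket_ofA, partialDer_ofD, map_neg, neg_neg]
    exact (flip' (K := K) (S := S)).symm_apply_apply _
  ofD_ofD δ Δ := by
    rw [superBracket_apply e (HasParity.ofD e δ), parLeft_of_even e (by simp)]
    exact isDerivationBracket e δ Δ
  leibniz p q a ha b hb c := by
    have ha' := HasParity.of_mem_deg e ha
    have hb' := HasParity.of_mem_deg e hb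
    rw [superBracket_apply e ha', superBracket_apply e ha', superBracket_apply e ha',
      unsignedBracket_mul_right, map_add, map_mul, map_mul, parLeft_tmul e _ hb',
      smul_mul_assoc]
    simp
  antisymm p q a ha b hb := by
    have ha' := HasParity.of_mem_deg e ha
    have hb' := HasParity.of_mem_deg e hb
    rw [superBracket_apply e ha', superBracket_apply e hb']
    exact parLeft_unsignedBracket_swap e ha' hb'

omit [CharZero K] in
include e in
/-- `𝔻S` is spanned by the words in the generators, built by multiplication from the left. -/
theorem DAlg.induction_left {P : DAlg K S → Prop} (h1 : P 1)
    (hadd : ∀ x y, P x → P y → P (x + y)) (hA : ∀ s x, P x → P (DAlg.ofA K S s * x))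
    (hE : ∀ x, P x → P (gauge K S * x)) (x : DAlg K S) : P x := by
  have : ∀ y, P y → P (x * y) := by
    induction x using DAlg.induction e with
    | hA s => exact hA s
    | hE => exact hE
    | hadd x x' hx hx' => intro y hy; rw [add_mul]; exact hadd _ _ (hx y hy) (hx' y hy)
    | hmul x x' hx hx' => intro y hy; rw [mul_assoc]; exact hx _ (hx' y hy)
  simpa using this 1 h1

omit [CharZero K] in
include e in
/-- The double Schouten-Nijenhuis bracket is determined by its values on generators. -/
theorem IsDoubleSchouten.unique
    {B B' : DAlg K S →ₗ[K] DAlg K S →ₗ[K] DAlg K S ⊗[K] DAlg K S}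
    (hB : IsDoubleSchouten B) (hB' : IsDoubleSchouten B') : B = B' := by
  have hone : ∀ {B : DAlg K S →ₗ[K] DAlg K S →ₗ[K] DAlg K S ⊗[K] DAlg K S},
      IsDoubleSchouten B → ∀ (p : ℕ) (a) (_ : a ∈ DAlg.deg K S p), B a 1 = 0 := by
    intro B hB p a ha
    have h := hB.leibniz p 0 a ha 1 (by rw [← DAlg.ofA_one]; exact DAlg.ofA_mem 1) 1
    have h1 : (1 : DAlg K S) ⊗ₜ[K] (1 : DAlg K S) = 1 := rfl
    simpa [sgn_zero, h1] using h
  -- by the Leibniz rule it suffices to compare second arguments among the generators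
  have hgen : ∀ (p : ℕ) (a) (_ : a ∈ DAlg.deg K S p),
      (∀ s, B a (DAlg.ofA K S s) = B' a (DAlg.ofA K S s)) →
      B a (gauge K S) = B' a (gauge K S) → B a = B' a := by
    intro p a ha hs hE
    ext x
    induction x using DAlg.induction_left e with
    | h1 => rw [hone hB p a ha, hone hB' p a ha]
    | hadd x y hx hy => rw [map_add, map_add, hx, hy]
    | hA s x hx =>
      rw [hB.leibniz p 0 a ha _ (DAlg.ofA_mem s), hB'.leibniz p 0 a ha _ (DAlg.ofA_mem s), hx, hs]
    | hE x hx =>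
      rw [hB.leibniz p 1 a ha _ gauge_mem, hB'.leibniz p 1 a ha _ gauge_mem, hx, hE]
  have hEs : ∀ s, B (gauge K S) (DAlg.ofA K S s) = B' (gauge K S) (DAlg.ofA K S s) := by
    intro s
    rw [gauge, hB.ofD_ofA, hB'.ofD_ofA]
  have hEE : B (gauge K S) (gauge K S) = B' (gauge K S) (gauge K S) := by
    rw [gauge]
    obtain ⟨l, r, h1, h2, h⟩ := hB.ofD_ofD (DDer.inner (1 ⊗ₜ 1)) (DDer.inner (1 ⊗ₜ 1))
    obtain ⟨l', r', h1', h2', h'⟩ := hB'.ofD_ofD (DDer.inner (1 ⊗ₜ 1)) (DDer.inner (1 ⊗ₜ 1))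
    have hl : l = l' := by
      refine rTensor_evalAt_injective e _ _ fun z => ?_
      rw [h1, h1']
    have hr : r = r' := by
      refine lTensor_evalAt_injective e _ _ fun z => ?_
      rw [h2, h2']
    rw [h, h', hl, hr]
  have hE := hgen 1 _ gauge_mem hEs hEE
  have hA : ∀ s, B (DAlg.ofA K S s) = B' (DAlg.ofA K S s) := by
    intro s
    refine hgen 0 _ (DAlg.ofA_mem s) (fun t => ?_) ?_
    · rw [hB.ofA_ofA, hB'.ofA_ofA]
    · rw [hB.antisymm 0 1 _ (DAlg.ofA_mem s) _ gauge_mem,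
        hB'.antisymm 0 1 _ (DAlg.ofA_mem s) _ gauge_mem, hE]
  ext1 a
  induction a using DirectSum.Decomposition.inductionOn (DAlg.deg K S) with
  | zero => rw [map_zero, map_zero]
  | add x y hx hy => rw [map_add, map_add, hx, hy]
  | @homogeneous n a =>
    refine hgen n _ a.2 (fun t => ?_) ?_
    · rw [hB.antisymm n 0 _ a.2 _ (DAlg.ofA_mem t), hB'.antisymm n 0 _ a.2 _ (DAlg.ofA_mem t), hA]
    · rw [hB.antisymm n 1 _ a.2 _ gauge_mem, hB'.antisymm n 1 _ a.2 _ gauge_mem, hE]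

end SuperBracket

/-! ### The bracket on `𝔻S` and its Jacobi identity -/

section Bracket

variable {K : Type*} [Field K] {ι : Type*} [DecidableEq ι] [Fintype ι] {d : ι → ℕ}
  [∀ i, NeZero (d i)] {S : Type*} [Ring S]
  [Algebra K S] (e : S ≃ₐ[K] ((i : ι) → Matrix (Fin (d i)) (Fin (d i)) K))

theorem mul'_left_mul (b : DAlg K S) (ξ : DAlg K S ⊗[K] DAlg K S) :
    LinearMap.mul' K (DAlg K S) ((b ⊗ₜ 1) * ξ) = b * LinearMap.mul' K (DAlg K S) ξ := by
  induction ξ with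
  | zero => simp
  | tmul x y => simp [mul_assoc]
  | add x y hx hy => rw [mul_add, map_add, map_add, mul_add, hx, hy]

theorem mul'_mul_right (c : DAlg K S) (ξ : DAlg K S ⊗[K] DAlg K S) :
    LinearMap.mul' K (DAlg K S) (ξ * (1 ⊗ₜ c)) = LinearMap.mul' K (DAlg K S) ξ * c := by
  induction ξ with
  | zero => simp
  | tmul x y => simp [mul_assoc]
  | add x y hx hy => rw [add_mul, map_add, map_add, add_mul, hx, hy]

theorem par_mul' (k : ℤ) (ξ : DAlg K S ⊗[K] DAlg K S) :
    par e k (LinearMap.mul' K (DAlg K S) ξ) = LinearMap.mul' K (DAlg K S) (parBoth e k ξ) := by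
  induction ξ with
  | zero => simp
  | tmul x y => simp
  | add x y hx hy => rw [map_add, map_add, map_add, map_add, hx, hy]

theorem parBoth_parLeft (k l : ℤ) (ξ : DAlg K S ⊗[K] DAlg K S) :
    parBoth e k (parLeft e l ξ) = parLeft e l (parBoth e k ξ) := by
  induction ξ with
  | zero => simp
  | tmul x y => simp [par_par, add_comm]
  | add x y hx hy => simp only [map_add, hx, hy]

/-- The bracket `{a, b}` on `𝔻S`, obtained by multiplying out the double bracket. -/
noncomputable def bracket : DAlg K S →ₗ[K] DAlg K S →ₗ[K] DAlg K S :=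
  (superBracket e).compr₂ (LinearMap.mul' K (DAlg K S))

theorem bracket_def (a b : DAlg K S) :
    bracket e a b = LinearMap.mul' K (DAlg K S) (superBracket e a b) := rfl

variable [CharZero K]

section

variable {e}
variable {p q : ℤ} {a b : DAlg K S} (ha : HasParity e p a) (hb : HasParity e q b)
include ha

theorem bracket_apply (b : DAlg K S) : bracket e a b =
    LinearMap.mul' K (DAlg K S) (parLeft e (p - 1) (unsignedBracket e a b)) := by
  rw [bracket_def, superBracket_apply e ha]

/-- The bracket `{a, -}` is a derivation of `𝔻S` of degree `|a| - 1`. -/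
theorem isTwDer_bracket : IsTwDer (par e (p - 1)) id (bracket e a) := by
  intro b c
  rw [bracket_apply ha, bracket_apply ha, bracket_apply ha, unsignedBracket_mul_right, map_add,
    map_mul, map_mul, map_add, Algebra.TensorProduct.map_tmul, Algebra.TensorProduct.map_tmul,
    map_one, map_one, AlgHom.id_apply, mul'_left_mul, mul'_mul_right]
  rfl

theorem par_bracket (k : ℤ) (b : DAlg K S) :
    par e k (bracket e a b) = sgn K (k * (p - 1)) • bracket e a (par e k b) := by
  rw [bracket_apply ha, bracket_apply ha, par_mul', parBoth_parLeft, parBoth_unsignedBracket, ha]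
  simp only [map_smul, LinearMap.smul_apply, smul_smul, ← sgn_add]
  congr 1
  exact sgn_congr K ⟨k, by ring⟩

include hb in
theorem HasParity.bracket : HasParity e (p + q - 1) (bracket e a b) := by
  intro k
  rw [par_bracket ha, hb, map_smul, smul_smul, ← sgn_add]
  congr 2
  ring

/-- The gauge element is central for the bracket, because the double bracket `{{a, E}}` is `1 ⊗ a -
a ⊗ 1` and multiplies out to `a - a`. -/
theorem bracket_gauge : bracket e a (gauge K S) = 0 := by
  rw [bracket_apply ha, unsignedBracket_gauge, map_sub, parLeft_tmul e _ ha,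
    parLeft_tmul e _ (HasParity.one e), map_sub, map_smul, map_smul, LinearMap.mul'_apply,
    LinearMap.mul'_apply, one_mul, mul_one, mul_zero, sgn_zero, sgn_of_even, one_smul, sub_self]
  rw [mul_comm]
  exact Int.even_mul_pred_self p

end

/-- The map `x ⊗ y ↦ (-1)^{(|x| + 1) |y|} y x`. -/
noncomputable def signedMul : DAlg K S ⊗[K] DAlg K S →ₗ[K] DAlg K S :=
  LinearMap.mul' K (DAlg K S) ∘ₗ gradedFlip.toLinearMap ∘ₗ (par e 1).toLinearMap.lTensor _

theorem signedMul_tmul {i j : ℤ} {x y : DAlg K S} (hx : HasParity e i x)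
    (hy : HasParity e j y) : signedMul e (x ⊗ₜ y) = sgn K ((i + 1) * j) • (y * x) := by
  simp only [signedMul, LinearMap.comp_apply, LinearMap.lTensor_tmul, AlgHom.toLinearMap_apply,
    LinearEquiv.coe_coe]
  rw [hy, TensorProduct.tmul_smul, map_smul, gradedFlip_tmul e hx hy, smul_smul, ← sgn_add,
    map_smul, LinearMap.mul'_apply]
  congr 2
  ring

/-- The cyclic derivative of `a` that belongs to `s`; up to sign, it is `{a, s}`. -/
noncomputable def cyclicDer (s : S) : DAlg K S →ₗ[K] DAlg K S := signedMul e ∘ₗ partialDer e s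

omit [CharZero K] in
theorem parBoth_partialDer_of_parity {i : ℤ} {a : DAlg K S} (ha : HasParity e i a) (s : S) :
    parBoth e 1 (partialDer e s a) = sgn K (i - 1) • partialDer e s a := by
  rw [parBoth_partialDer, ha, map_smul, smul_smul, ← sgn_add]
  congr 1
  exact sgn_congr K ⟨1, by ring⟩

theorem bracket_ofA {p : ℤ} {a : DAlg K S} (ha : HasParity e p a) (s : S) :
    bracket e a (DAlg.ofA K S s) = -cyclicDer e s a := by
  rw [bracket_apply ha, unsignedBracket_ofA, map_neg, map_neg, neg_inj, cyclicDer,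
    LinearMap.comp_apply]
  refine tensor_parity_ext e (F := LinearMap.mul' K (DAlg K S) ∘ₗ
    (parLeft e (p - 1)).toLinearMap ∘ₗ flip'.toLinearMap) (G := signedMul e) (p - 1) ?_ _
    (parBoth_partialDer_of_parity e ha s)
  intro i j x y hx hy hij
  simp only [LinearMap.comp_apply, AlgHom.toLinearMap_apply, AlgEquiv.toLinearMap_apply,
    Algebra.TensorProduct.comm_tmul]
  rw [parLeft_tmul e _ hy, map_smul, LinearMap.mul'_apply, signedMul_tmul e hx hy]
  congr 1
  apply sgn_congr
  simp only [Int.even_sub, Int.even_add, Int.even_mul, Int.not_even_one] at hij ⊢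
  grind

omit [CharZero K] in
include e in
theorem tensor_ext {M : Type*} [AddCommGroup M] [Module K M]
    {F G : DAlg K S ⊗[K] DAlg K S →ₗ[K] M}
    (h : ∀ i j x y, HasParity e i x → HasParity e j y → F (x ⊗ₜ y) = G (x ⊗ₜ y)) : F = G := by
  refine TensorProduct.ext' fun x y => ?_
  induction x using parity_induction e with
  | h0 => simp
  | hadd x x' h1 h2 => rw [TensorProduct.add_tmul, map_add, map_add, h1, h2]
  | h i x hx =>
    induction y using parity_induction e with
    | h0 => simp
    | hadd y y' h1 h2 => rw [TensorProduct.tmul_add, map_add, map_add, h1, h2]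
    | h j y hy => exact h i j x y hx hy

omit [CharZero K] in
include e in
theorem tensor_ext_three {M : Type*} [AddCommGroup M] [Module K M]
    {F G : DAlg K S ⊗[K] (DAlg K S ⊗[K] DAlg K S) →ₗ[K] M}
    (h : ∀ i j k x y z, HasParity e i x → HasParity e j y → HasParity e k z →
      F (x ⊗ₜ (y ⊗ₜ z)) = G (x ⊗ₜ (y ⊗ₜ z))) : F = G := by
  refine TensorProduct.ext' fun x ξ => ?_
  induction x using parity_induction e with
  | h0 => simp
  | hadd x x' h1 h2 => rw [TensorProduct.add_tmul, map_add, map_add, h1, h2]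
  | h i x hx =>
    have := tensor_ext e (F := F ∘ₗ TensorProduct.mk K _ _ x) (G := G ∘ₗ TensorProduct.mk K _ _ x)
      (fun j k y z hy hz => h i j k x y z hx hy hz)
    exact LinearMap.congr_fun this ξ

section Coassociativity

omit [CharZero K]

/-- `(∂_s ⊗ 1) ξ` in `𝔻S ⊗ (𝔻S ⊗ 𝔻S)`. -/
noncomputable def partialLeft (s : S) :
    DAlg K S ⊗[K] DAlg K S →ₗ[K] DAlg K S ⊗[K] (DAlg K S ⊗[K] DAlg K S) :=
  (TensorProduct.assoc K _ _ _).toLinearMap ∘ₗ (partialDer e s).rTensor _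

/-- `(1 ⊗ ∂_s) ξ` in `𝔻S ⊗ (𝔻S ⊗ 𝔻S)`. -/
noncomputable def partialRight (s : S) :
    DAlg K S ⊗[K] DAlg K S →ₗ[K] DAlg K S ⊗[K] (DAlg K S ⊗[K] DAlg K S) :=
  (partialDer e s).lTensor _

theorem assoc_mul (x y : (DAlg K S ⊗[K] DAlg K S) ⊗[K] DAlg K S) :
    TensorProduct.assoc K _ _ _ (x * y) =
      TensorProduct.assoc K _ _ _ x * TensorProduct.assoc K _ _ _ y :=
  map_mul (Algebra.TensorProduct.assoc K K K (DAlg K S) (DAlg K S) (DAlg K S)) x y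

theorem partialLeft_mul_left (s : S) (b : DAlg K S) (ξ : DAlg K S ⊗[K] DAlg K S) :
    partialLeft e s ((b ⊗ₜ 1) * ξ) = (b ⊗ₜ 1) * partialLeft e s ξ +
      TensorProduct.assoc K _ _ _ (partialDer e s b ⊗ₜ 1) * (1 ⊗ₜ ξ) := by
  induction ξ with
  | zero => simp
  | add x y hx hy =>
    simp only [mul_add, map_add, hx, hy, TensorProduct.tmul_add]
    abel
  | tmul x y =>
    have h1 : (b ⊗ₜ[K] (1 : DAlg K S ⊗[K] DAlg K S)) =
      TensorProduct.assoc K _ _ _ ((b ⊗ₜ[K] (1 : DAlg K S)) ⊗ₜ[K] (1 : DAlg K S)) := rfl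
    have h2 : ((1 : DAlg K S) ⊗ₜ[K] (x ⊗ₜ[K] y)) =
      TensorProduct.assoc K _ _ _ (((1 : DAlg K S) ⊗ₜ[K] x) ⊗ₜ[K] y) := rfl
    rw [h1, h2]
    simp only [partialLeft, LinearMap.comp_apply, LinearEquiv.coe_coe]
    rw [← assoc_mul, ← assoc_mul]
    simp only [Algebra.TensorProduct.tmul_mul_tmul, LinearMap.rTensor_tmul, partialDer_mul_right,
      one_mul, TensorProduct.add_tmul, map_add]

theorem partialLeft_mul_right (s : S) (c : DAlg K S) (ξ : DAlg K S ⊗[K] DAlg K S) :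
    partialLeft e s (ξ * (1 ⊗ₜ c)) = partialLeft e s ξ * (1 ⊗ₜ (1 ⊗ₜ c)) := by
  induction ξ with
  | zero => simp
  | add x y hx hy => simp only [add_mul, map_add, hx, hy]
  | tmul x y =>
    have h2 : ((1 : DAlg K S) ⊗ₜ[K] ((1 : DAlg K S) ⊗ₜ[K] c)) =
      TensorProduct.assoc K _ _ _ ((1 : DAlg K S ⊗[K] DAlg K S) ⊗ₜ[K] c) := rfl
    rw [h2]
    simp only [partialLeft, LinearMap.comp_apply, LinearEquiv.coe_coe]
    rw [← assoc_mul]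
    simp only [Algebra.TensorProduct.tmul_mul_tmul, LinearMap.rTensor_tmul, mul_one]

theorem partialRight_mul_left (s : S) (b : DAlg K S) (ξ : DAlg K S ⊗[K] DAlg K S) :
    partialRight e s ((b ⊗ₜ 1) * ξ) = (b ⊗ₜ 1) * partialRight e s ξ := by
  induction ξ with
  | zero => simp
  | add x y hx hy => simp only [mul_add, map_add, hx, hy]
  | tmul x y =>
    simp only [partialRight, Algebra.TensorProduct.tmul_mul_tmul, LinearMap.lTensor_tmul, one_mul]

theorem partialRight_mul_right (s : S) (c : DAlg K S) (ξ : DAlg K S ⊗[K] DAlg K S) :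
    partialRight e s (ξ * (1 ⊗ₜ c)) = partialRight e s ξ * (1 ⊗ₜ (1 ⊗ₜ c)) +
      TensorProduct.assoc K _ _ _ (ξ ⊗ₜ 1) * (1 ⊗ₜ partialDer e s c) := by
  induction ξ with
  | zero => simp
  | add x y hx hy =>
    simp only [add_mul, map_add, hx, hy, TensorProduct.add_tmul]
    abel
  | tmul x y =>
    simp only [partialRight, Algebra.TensorProduct.tmul_mul_tmul, LinearMap.lTensor_tmul, mul_one,
      TensorProduct.assoc_tmul, partialDer_mul_right, TensorProduct.tmul_add]
    rw [add_comm]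

/-- The derivations `partialDer` commute: `(∂_s ⊗ 1) ∂_t = (1 ⊗ ∂_t) ∂_s`. -/
theorem partialLeft_partialDer (s t : S) (a : DAlg K S) :
    partialLeft e s (partialDer e t a) = partialRight e t (partialDer e s a) := by
  have h : IsTwDer (fun b => b ⊗ₜ[K] (1 : DAlg K S ⊗[K] DAlg K S))
      (fun c => (1 : DAlg K S) ⊗ₜ[K] ((1 : DAlg K S) ⊗ₜ[K] c))
      (partialLeft e s ∘ₗ partialDer e t - partialRight e t ∘ₗ partialDer e s) := by
    intro b c
    simp only [LinearMap.sub_apply, LinearMap.comp_apply, partialDer_mul_right, map_add,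
      partialLeft_mul_left, partialLeft_mul_right, partialRight_mul_left, partialRight_mul_right,
      mul_sub, sub_mul]
    abel
  have h0 : IsTwDer (fun b => b ⊗ₜ[K] (1 : DAlg K S ⊗[K] DAlg K S))
      (fun c => (1 : DAlg K S) ⊗ₜ[K] ((1 : DAlg K S) ⊗ₜ[K] c))
      (0 : DAlg K S →ₗ[K] DAlg K S ⊗[K] (DAlg K S ⊗[K] DAlg K S)) := by
    intro b c; simp
  have := IsTwDer.ext e h h0 ?_ ?_
  · exact sub_eq_zero.1 (LinearMap.congr_fun this a)
  · intro u
    simp [partialDer_ofA]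
  · have h1 : ∀ u, partialDer e u (1 : DAlg K S) = 0 := fun u => by
      rw [← DAlg.ofA_one, partialDer_ofA]
    simp [partialDer_gauge, partialLeft, partialRight, partialDer_ofA, h1]

end Coassociativity

/-- `u ⊗ v ⊗ w ↦ (-1)^{(|u| + |v|) |w|} w u ⊗ v`. -/
noncomputable def rotateLeft :
    DAlg K S ⊗[K] (DAlg K S ⊗[K] DAlg K S) →ₗ[K] DAlg K S ⊗[K] DAlg K S :=
  (LinearMap.mul' K (DAlg K S)).rTensor _ ∘ₗ gradedFlip.toLinearMap.rTensor _ ∘ₗ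
    (TensorProduct.assoc K _ _ _).symm.toLinearMap ∘ₗ gradedFlip.toLinearMap.lTensor _

/-- `u ⊗ v ⊗ w ↦ (-1)^{(|u| + 1) (|v| + |w| + 1)} v ⊗ w u`. -/
noncomputable def rotateRight :
    DAlg K S ⊗[K] (DAlg K S ⊗[K] DAlg K S) →ₗ[K] DAlg K S ⊗[K] DAlg K S :=
  -((LinearMap.mul' K (DAlg K S)).lTensor _ ∘ₗ gradedFlip.toLinearMap.lTensor _ ∘ₗ
    (TensorProduct.assoc K _ _ _).toLinearMap ∘ₗ gradedFlip.toLinearMap.rTensor _ ∘ₗ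
    (TensorProduct.assoc K _ _ _).symm.toLinearMap ∘ₗ
    TensorProduct.map (par e 1).toLinearMap (parBoth e 1).toLinearMap)

variable {e} in
theorem rotateLeft_tmul {i j k : ℤ} {x y z : DAlg K S} (hx : HasParity e i x)
    (hy : HasParity e j y) (hz : HasParity e k z) :
    rotateLeft (x ⊗ₜ[K] (y ⊗ₜ[K] z)) = sgn K ((i + j) * k) • ((z * x) ⊗ₜ y) := by
  simp only [rotateLeft, LinearMap.comp_apply, LinearMap.lTensor_tmul, LinearEquiv.coe_coe]
  rw [gradedFlip_tmul e hy hz, TensorProduct.tmul_smul, map_smul, TensorProduct.assoc_symm_tmul,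
    map_smul, LinearMap.rTensor_tmul, LinearEquiv.coe_coe, gradedFlip_tmul e hx hz,
    ← TensorProduct.smul_tmul', smul_smul, map_smul, LinearMap.rTensor_tmul,
    LinearMap.mul'_apply, ← sgn_add]
  congr 2
  ring

theorem rotateRight_tmul {i j k : ℤ} {x y z : DAlg K S} (hx : HasParity e i x)
    (hy : HasParity e j y) (hz : HasParity e k z) :
    rotateRight e (x ⊗ₜ[K] (y ⊗ₜ[K] z)) = sgn K ((i + 1) * (j + k + 1)) • (y ⊗ₜ (z * x)) := by
  have hyz : parBoth e 1 (y ⊗ₜ z) = sgn K (j + k) • (y ⊗ₜ z) := by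
    rw [Algebra.TensorProduct.map_tmul, hy, hz, TensorProduct.tmul_smul,
      ← TensorProduct.smul_tmul', smul_smul, ← sgn_add]
    congr 2
    ring
  simp only [rotateRight, LinearMap.neg_apply, LinearMap.comp_apply, TensorProduct.map_tmul,
    LinearEquiv.coe_coe, AlgHom.toLinearMap_apply]
  rw [hyz, hx]
  simp only [TensorProduct.tmul_smul, ← TensorProduct.smul_tmul', map_smul,
    TensorProduct.assoc_symm_tmul, LinearMap.rTensor_tmul, LinearEquiv.coe_coe,
    gradedFlip_tmul e hx hy, TensorProduct.assoc_tmul, LinearMap.lTensor_tmul,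
    gradedFlip_tmul e hx hz, LinearMap.mul'_apply, smul_smul, ← sgn_add]
  have hs : sgn K ((i + 1) * (j + k + 1)) = -sgn K (j + k + 1 * i + i * j + i * k) :=
    sgn_congr_neg K (by ring_nf; exact odd_one)
  rw [hs]
  exact (neg_smul _ _).symm

/-- The derivation `∂_s` of a product in the cyclic order. -/
theorem partialDer_signedMul (s : S) (ξ : DAlg K S ⊗[K] DAlg K S) :
    partialDer e s (signedMul e ξ) =
      rotateLeft (partialLeft e s ξ) + rotateRight e (partialRight e s ξ) := by
  have := tensor_ext e (F := partialDer e s ∘ₗ signedMul e)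
    (G := rotateLeft ∘ₗ partialLeft e s + rotateRight e ∘ₗ partialRight e s) ?_
  · exact LinearMap.congr_fun this ξ
  intro i j x y hx hy
  simp only [LinearMap.comp_apply, LinearMap.add_apply]
  have h1 : rotateLeft (partialLeft e s (x ⊗ₜ y)) =
      sgn K ((i + 1) * j) • ((y ⊗ₜ 1) * partialDer e s x) := by
    refine tensor_parity_ext e
      (F := rotateLeft ∘ₗ (TensorProduct.assoc K _ _ _).toLinearMap ∘ₗ
        (TensorProduct.mk K _ _).flip y)
      (G := sgn K ((i + 1) * j) • LinearMap.mulLeft K (y ⊗ₜ 1)) (i - 1) ?_ _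
      (parBoth_partialDer_of_parity e hx s)
    intro k l u v hu hv hkl
    simp only [LinearMap.comp_apply, LinearMap.flip_apply, TensorProduct.mk_apply,
      LinearEquiv.coe_coe, TensorProduct.assoc_tmul, LinearMap.smul_apply,
      LinearMap.mulLeft_apply, Algebra.TensorProduct.tmul_mul_tmul, one_mul]
    rw [rotateLeft_tmul hu hv hy]
    congr 1
    apply sgn_congr
    simp only [Int.even_sub, Int.even_add, Int.even_mul, Int.not_even_one] at hkl ⊢
    grind
  have h2 : rotateRight e (partialRight e s (x ⊗ₜ y)) =
      sgn K ((i + 1) * j) • (partialDer e s y * (1 ⊗ₜ x)) := by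
    refine tensor_parity_ext e
      (F := rotateRight e ∘ₗ TensorProduct.mk K _ _ x)
      (G := sgn K ((i + 1) * j) • LinearMap.mulRight K (1 ⊗ₜ x)) (j - 1) ?_ _
      (parBoth_partialDer_of_parity e hy s)
    intro k l u v hu hv hkl
    simp only [LinearMap.comp_apply, TensorProduct.mk_apply, LinearMap.smul_apply,
      LinearMap.mulRight_apply, Algebra.TensorProduct.tmul_mul_tmul, mul_one]
    rw [rotateRight_tmul e hx hu hv]
    congr 1
    apply sgn_congr
    simp only [Int.even_sub, Int.even_add, Int.even_mul, Int.not_even_one] at hkl ⊢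
    grind
  rw [h1, h2, signedMul_tmul e hx hy, map_smul, partialDer_mul_right, smul_add]

/-- The two rotations, applied to the same tensor, differ by the graded flip, up to sign; this
makes the two terms of `partialDer_signedMul` exchange places in `partialDer_cyclicDer`. -/
theorem rotateLeft_eq (ζ : DAlg K S ⊗[K] (DAlg K S ⊗[K] DAlg K S)) :
    rotateLeft ζ = -gradedFlip (parBoth e 1 (rotateRight e ζ)) := by
  have h : (rotateLeft : _ →ₗ[K] DAlg K S ⊗[K] DAlg K S) =
      (-1 : K) • (gradedFlip.toLinearMap ∘ₗ (parBoth e 1).toLinearMap ∘ₗ rotateRight e) := by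
    refine tensor_ext_three e fun i j k x y z hx hy hz => ?_
    simp only [LinearMap.smul_apply, LinearMap.comp_apply, AlgHom.toLinearMap_apply,
      LinearEquiv.coe_coe]
    rw [rotateLeft_tmul hx hy hz, rotateRight_tmul e hx hy hz, map_smul,
      Algebra.TensorProduct.map_tmul, hy, hz.mul hx]
    simp only [TensorProduct.tmul_smul, ← TensorProduct.smul_tmul', map_smul,
      gradedFlip_tmul e hy (hz.mul hx), smul_smul, ← sgn_add, neg_one_mul]
    congr 1
    apply sgn_congr_neg
    simp only [← Int.not_even_iff_odd, Int.even_sub, Int.even_add, Int.even_mul,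
      Int.not_even_one]
    grind
  rw [h]
  exact neg_one_smul K _

theorem rotateRight_eq (ζ : DAlg K S ⊗[K] (DAlg K S ⊗[K] DAlg K S)) :
    rotateRight e ζ = -gradedFlip (parBoth e 1 (rotateLeft ζ)) := by
  have h : rotateRight e =
      (-1 : K) • (gradedFlip.toLinearMap ∘ₗ (parBoth e 1).toLinearMap ∘ₗ rotateLeft) := by
    refine tensor_ext_three e fun i j k x y z hx hy hz => ?_
    simp only [LinearMap.smul_apply, LinearMap.comp_apply, AlgHom.toLinearMap_apply,
      LinearEquiv.coe_coe]
    rw [rotateLeft_tmul hx hy hz, rotateRight_tmul e hx hy hz, map_smul,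
      Algebra.TensorProduct.map_tmul, hy, hz.mul hx]
    simp only [TensorProduct.tmul_smul, ← TensorProduct.smul_tmul', map_smul,
      gradedFlip_tmul e (hz.mul hx) hy, smul_smul, ← sgn_add, neg_one_mul]
    congr 1
    apply sgn_congr_neg
    simp only [← Int.not_even_iff_odd, Int.even_sub, Int.even_add, Int.even_mul,
      Int.not_even_one]
    grind
  rw [h]
  exact neg_one_smul K _

/-- Second cyclic derivatives are symmetric, up to the graded flip. -/
theorem partialDer_cyclicDer (s t : S) (a : DAlg K S) :
    partialDer e s (cyclicDer e t a) =
      -gradedFlip (parBoth e 1 (partialDer e t (cyclicDer e s a))) := by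
  simp only [cyclicDer, LinearMap.comp_apply, partialDer_signedMul]
  rw [partialLeft_partialDer e s t, ← partialLeft_partialDer e t s]
  generalize partialRight e t (partialDer e s a) = X
  generalize partialLeft e t (partialDer e s a) = Y
  rw [rotateLeft_eq e X, rotateRight_eq e Y, map_add, map_add, neg_add, add_comm]

section Jacobi

variable {e}
variable {p q : ℤ} {a b : DAlg K S} (ha : HasParity e p a) (hb : HasParity e q b)

variable (e) in
/-- The extension of `{a, -}` to `𝔻S ⊗ 𝔻S` that is compatible with the derivations `partialDer`;
here `k = |a| - 1`. -/
noncomputable def bracketTensor (k : ℤ) (a : DAlg K S) :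
    DAlg K S ⊗[K] DAlg K S →ₗ[K] DAlg K S ⊗[K] DAlg K S :=
  (bracket e a).rTensor _ + sgn K k • TensorProduct.map (par e k).toLinearMap (bracket e a)

omit [CharZero K] in
theorem bracketTensor_tmul (k : ℤ) (a x y : DAlg K S) : bracketTensor e k a (x ⊗ₜ y) =
    bracket e a x ⊗ₜ y + sgn K k • (par e k x ⊗ₜ bracket e a y) := rfl

include ha

theorem bracketTensor_mul_left (b : DAlg K S) (ξ : DAlg K S ⊗[K] DAlg K S) :
    bracketTensor e (p - 1) a ((b ⊗ₜ 1) * ξ) =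
      (par e (p - 1) b ⊗ₜ 1) * bracketTensor e (p - 1) a ξ + (bracket e a b ⊗ₜ 1) * ξ := by
  induction ξ with
  | zero => simp
  | add x y hx hy =>
    simp only [mul_add, map_add, hx, hy]
    abel
  | tmul x y =>
    simp only [Algebra.TensorProduct.tmul_mul_tmul, one_mul, bracketTensor_tmul,
      isTwDer_bracket ha b x, map_mul, TensorProduct.add_tmul, mul_add, mul_smul_comm, id]
    abel

theorem bracketTensor_mul_right (c : DAlg K S) (ξ : DAlg K S ⊗[K] DAlg K S) :
    bracketTensor e (p - 1) a (ξ * (1 ⊗ₜ c)) =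
      bracketTensor e (p - 1) a ξ * (1 ⊗ₜ c) +
        sgn K (p - 1) • (parBoth e (p - 1) ξ * (1 ⊗ₜ bracket e a c)) := by
  induction ξ with
  | zero => simp
  | add x y hx hy =>
    simp only [add_mul, map_add, hx, hy, smul_add]
    abel
  | tmul x y =>
    simp only [Algebra.TensorProduct.tmul_mul_tmul, mul_one, bracketTensor_tmul,
      isTwDer_bracket ha y c, TensorProduct.tmul_add, add_mul, smul_mul_assoc, id, smul_add,
      Algebra.TensorProduct.map_tmul]
    abel

/-- The commutator of `∂_s` with `{a, -}`: both sides of the identity are twisted derivations in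
`b`, and they agree on the generators by the symmetry of second cyclic derivatives. -/
theorem partialDer_bracket (s : S) (b : DAlg K S) :
    partialDer e s (bracket e a b) = bracketTensor e (p - 1) a (partialDer e s b) -
      sgn K (p - 1) • parLeft e (p - 1)
        (unsignedBracket e (bracket e a (DAlg.ofA K S s)) b) := by
  have h1 : IsTwDer (fun b => par e (p - 1) b ⊗ₜ[K] (1 : DAlg K S))
      (fun c => (1 : DAlg K S) ⊗ₜ[K] c)
      (partialDer e s ∘ₗ bracket e a - bracketTensor e (p - 1) a ∘ₗ partialDer e s) := by
    intro b c
    simp only [LinearMap.sub_apply, LinearMap.comp_apply, isTwDer_bracket ha b c, map_add,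
      partialDer_mul_right, bracketTensor_mul_left ha, bracketTensor_mul_right ha,
      parBoth_partialDer, smul_mul_assoc, smul_smul, sgn_mul_self, one_smul, id, mul_sub, sub_mul]
    abel
  have h2 : IsTwDer (fun b => par e (p - 1) b ⊗ₜ[K] (1 : DAlg K S))
      (fun c => (1 : DAlg K S) ⊗ₜ[K] c)
      (-(sgn K (p - 1) • ((parLeft e (p - 1)).toLinearMap ∘ₗ
        unsignedBracket e (bracket e a (DAlg.ofA K S s))))) := by
    intro b c
    simp only [LinearMap.neg_apply, LinearMap.smul_apply, LinearMap.comp_apply,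
      AlgHom.toLinearMap_apply, unsignedBracket_mul_right, map_add, map_mul,
      Algebra.TensorProduct.map_tmul, map_one, AlgHom.id_apply, smul_add, mul_neg, neg_mul,
      mul_smul_comm, smul_mul_assoc, neg_add]
  have hs := HasParity.bracket ha (HasParity.ofA e s)
  have hone : bracket e a 1 = 0 := by
    have := isTwDer_bracket ha 1 1
    simpa using this
  have := IsTwDer.ext e h1 h2 ?_ ?_
  · have := LinearMap.congr_fun this b
    simp only [LinearMap.sub_apply, LinearMap.comp_apply, LinearMap.neg_apply,
      LinearMap.smul_apply, AlgHom.toLinearMap_apply] at this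
    rw [sub_eq_iff_eq_add] at this
    rw [this]
    abel
  · intro t
    simp only [LinearMap.sub_apply, LinearMap.comp_apply, LinearMap.neg_apply,
      LinearMap.smul_apply, AlgHom.toLinearMap_apply, partialDer_ofA, map_zero, sub_zero]
    rw [unsignedBracket_ofA, bracket_ofA e ha, bracket_ofA e ha, map_neg (partialDer e s),
      partialDer_cyclicDer, neg_neg, map_neg (partialDer e t), map_neg flip', neg_neg]
    refine Eq.trans ?_ (neg_smul _ _)
    have hc : HasParity e (p - 1) (cyclicDer e s a) := by
      rw [bracket_ofA e ha] at hs
      simpa using hs.neg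
    refine tensor_parity_ext e (F := gradedFlip.toLinearMap ∘ₗ (parBoth e 1).toLinearMap)
      (G := (-sgn K (p - 1)) • ((parLeft e (p - 1)).toLinearMap ∘ₗ flip'.toLinearMap))
      (p - 1 - 1) ?_ _ (parBoth_partialDer_of_parity e hc t)
    intro i j x y hx hy hij
    simp only [LinearMap.comp_apply, AlgHom.toLinearMap_apply, LinearMap.smul_apply,
      LinearEquiv.coe_coe, AlgEquiv.toLinearMap_apply, Algebra.TensorProduct.comm_tmul]
    rw [parLeft_tmul e _ hy, Algebra.TensorProduct.map_tmul, hx, hy]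
    simp only [TensorProduct.tmul_smul, ← TensorProduct.smul_tmul', map_smul,
      gradedFlip_tmul e hx hy, smul_smul, ← sgn_add, neg_mul]
    congr 1
    apply sgn_congr_neg
    simp only [← Int.not_even_iff_odd, Int.even_sub, Int.even_add, Int.even_mul,
      Int.not_even_one] at hij ⊢
    grind
  · simp only [LinearMap.sub_apply, LinearMap.comp_apply, LinearMap.neg_apply,
      LinearMap.smul_apply, AlgHom.toLinearMap_apply, bracket_gauge ha, map_zero, zero_sub,
      partialDer_gauge, unsignedBracket_gauge, map_sub, bracketTensor_tmul, hone,
      TensorProduct.zero_tmul, TensorProduct.tmul_zero, smul_zero, add_zero, zero_add, map_one]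
    rw [parLeft_tmul e _ hs, parLeft_tmul e _ (HasParity.one e), mul_zero, sgn_zero, one_smul,
      smul_sub, smul_smul, ← sgn_add, sgn_of_even K (n := p - 1 + _), one_smul]
    have : p - 1 + (p - 1) * (p + 0 - 1) = (p - 1) * (p - 1 + 1) := by ring
    rw [this]
    exact Int.even_mul_succ_self _

/-- The derivation `{a, -}` commutes with the multiplication in the cyclic order. -/
theorem signedMul_bracketTensor (ξ : DAlg K S ⊗[K] DAlg K S) :
    signedMul e (bracketTensor e (p - 1) a ξ) = bracket e a (signedMul e ξ) := by
  have := tensor_ext e (F := signedMul e ∘ₗ bracketTensor e (p - 1) a)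
    (G := bracket e a ∘ₗ signedMul e) ?_
  · exact LinearMap.congr_fun this ξ
  intro i j x y hx hy
  simp only [LinearMap.comp_apply, bracketTensor_tmul]
  rw [signedMul_tmul e hx hy, map_add, map_smul, map_smul, hx, ← TensorProduct.smul_tmul',
    map_smul, signedMul_tmul e (HasParity.bracket ha hx) hy,
    signedMul_tmul e hx (HasParity.bracket ha hy), isTwDer_bracket ha y x, hy, smul_add,
    smul_mul_assoc, smul_smul, smul_smul, smul_smul, ← sgn_add, ← sgn_add, ← sgn_add]
  congr 2
  · apply sgn_congr
    simp only [Int.even_sub, Int.even_add, Int.even_mul, Int.not_even_one]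
    grind
  · apply sgn_congr
    simp only [Int.even_sub, Int.even_add, Int.even_mul, Int.not_even_one]
    grind

set_option maxHeartbeats 1000000 in
include hb in
/-- The cyclic derivative of a bracket. This is the Jacobi identity for `a`, `b` and `s ∈ S`, since
cyclic derivatives are brackets with elements of `S`. -/
theorem cyclicDer_bracket (s : S) : cyclicDer e s (bracket e a b) =
    bracket e a (cyclicDer e s b) +
      sgn K ((p - 1) * (q - 1)) • bracket e b (bracket e a (DAlg.ofA K S s)) := by
  have hs := HasParity.bracket ha (HasParity.ofA e s)
  rw [cyclicDer, LinearMap.comp_apply, partialDer_bracket ha, map_sub,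
    signedMul_bracketTensor ha, LinearMap.comp_apply, sub_eq_add_neg]
  congr 1
  rw [bracket_apply hb, unsignedBracket_swap e b, map_neg, map_neg, smul_neg, neg_inj, map_smul]
  refine tensor_parity_ext e
    (F := sgn K (p - 1) • (signedMul e ∘ₗ (parLeft e (p - 1)).toLinearMap))
    (G := sgn K ((p - 1) * (q - 1)) • (LinearMap.mul' K (DAlg K S) ∘ₗ
      (parLeft e (q - 1)).toLinearMap ∘ₗ flip'.toLinearMap)) _ ?_ _
    (parBoth_unsignedBracket_of_parity e hs hb)
  intro i j x y hx hy hij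
  simp only [LinearMap.comp_apply, AlgHom.toLinearMap_apply, LinearMap.smul_apply,
    AlgEquiv.toLinearMap_apply, Algebra.TensorProduct.comm_tmul]
  rw [parLeft_tmul e _ hx, parLeft_tmul e _ hy, map_smul, map_smul, signedMul_tmul e hx hy,
    LinearMap.mul'_apply, smul_smul, smul_smul, smul_smul, ← sgn_add, ← sgn_add, ← sgn_add]
  congr 1
  apply sgn_congr
  simp only [Int.even_sub, Int.even_add, Int.even_mul, Int.not_even_one] at hij ⊢
  grind

include hb in
/-- The graded Jacobi identity of the bracket on `𝔻S`, in the form of the statement that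
`a ↦ {a, -}` is compatible with super commutators of derivations: both sides are derivations in
`c`, and they agree on the generators. -/
theorem bracket_jacobi (c : DAlg K S) : bracket e a (bracket e b c) =
    bracket e (bracket e a b) c + sgn K ((p - 1) * (q - 1)) • bracket e b (bracket e a c) := by
  have hab := HasParity.bracket ha hb
  have h1 : IsTwDer (par e (p + q - 2)) id (bracket e a ∘ₗ bracket e b -
      sgn K ((p - 1) * (q - 1)) • (bracket e b ∘ₗ bracket e a)) := by
    intro x y
    have e1 : par e (p - 1) (par e (q - 1) x) = par e (p + q - 2) x := by
      rw [par_par]; congr 2; ring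
    have e2 : par e (q - 1) (par e (p - 1) x) = par e (p + q - 2) x := by
      rw [par_par]; congr 2; ring
    have e3 := par_bracket ha (q - 1) x
    have e4 := par_bracket hb (p - 1) x
    simp only [LinearMap.sub_apply, LinearMap.smul_apply, LinearMap.comp_apply,
      isTwDer_bracket ha x y, isTwDer_bracket hb x y, map_add, id]
    simp only [isTwDer_bracket ha _ y, isTwDer_bracket hb _ y,
      isTwDer_bracket ha _ (bracket e b y), isTwDer_bracket hb _ (bracket e a y), id,
      e1, e2, e3, e4, smul_add, sub_mul, mul_sub, smul_mul_assoc, mul_smul_comm, smul_smul,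
      mul_comm (q - 1) (p - 1), sgn_mul_self, one_smul]
    abel
  have h2 : IsTwDer (par e (p + q - 2)) id (bracket e (bracket e a b)) := by
    have := isTwDer_bracket hab
    rwa [show p + q - 1 - 1 = p + q - 2 by ring] at this
  have := IsTwDer.ext e h1 h2 ?_ ?_
  · have := LinearMap.congr_fun this c
    rw [← this]
    simp
  · intro s
    simp only [LinearMap.sub_apply, LinearMap.smul_apply, LinearMap.comp_apply]
    rw [bracket_ofA e hab, cyclicDer_bracket ha hb, bracket_ofA e hb, map_neg]
    abel
  · simp only [LinearMap.sub_apply, LinearMap.smul_apply, LinearMap.comp_apply]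
    rw [bracket_gauge hab, bracket_gauge ha, bracket_gauge hb, map_zero, map_zero, smul_zero,
      sub_zero]

end Jacobi

end Bracket

/-! ### Graded Lie algebras on quotients by super commutators -/

section CyclicQuotient

variable {K : Type*} [Field K] {A : Type*} [Ring A] [Algebra K A] {𝒜 : ℕ → Submodule K A}

theorem cyc_mul_comm {p q : ℕ} {a b : A} (ha : a ∈ 𝒜 p) (hb : b ∈ 𝒜 q) :
    cyc 𝒜 (a * b) = sgn K ((p : ℤ) * q) • cyc 𝒜 (b * a) := by
  rw [← map_smul, ← sub_eq_zero, ← map_sub]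
  exact (Submodule.Quotient.mk_eq_zero _).2 (Submodule.subset_span ⟨p, q, a, ha, b, hb, rfl⟩)

theorem cyc_mem_shiftedGrading {n : ℕ} {a : A} (ha : a ∈ 𝒜 n) {p : ℤ} (hp : (n : ℤ) = p + 1) :
    cyc 𝒜 a ∈ shiftedGrading 𝒜 p := by
  rw [shiftedGrading, ← hp, if_pos (Int.natCast_nonneg n), Int.toNat_natCast]
  exact ⟨a, ha, rfl⟩

theorem exists_of_mem_shiftedGrading {p : ℤ} {x : SuperCyclic 𝒜} (hx : x ∈ shiftedGrading 𝒜 p) :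
    x = 0 ∨ ∃ n : ℕ, (n : ℤ) = p + 1 ∧ ∃ a ∈ 𝒜 n, cyc 𝒜 a = x := by
  rw [shiftedGrading] at hx
  split_ifs at hx with h
  · obtain ⟨a, ha, rfl⟩ := hx
    exact .inr ⟨_, Int.toNat_of_nonneg h, a, ha, rfl⟩
  · exact .inl hx

/-- The super commutators form a graded subspace, so the quotient is graded. -/
theorem isInternal_shiftedGrading [GradedAlgebra 𝒜] :
    DirectSum.IsInternal (shiftedGrading 𝒜) := by
  let π (n : ℕ) : A →ₗ[K] A := (𝒜 n).subtype ∘ₗ DirectSum.component K ℕ (fun n => 𝒜 n) n ∘ₗ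
    (DirectSum.decomposeLinearEquiv 𝒜).toLinearMap
  have hπ : ∀ n x, π n x = DirectSum.decompose 𝒜 x n := fun n x => rfl
  have hker : ∀ n, superCommutators 𝒜 ≤ (superCommutators 𝒜).comap (π n) := by
    intro n
    rw [superCommutators, Submodule.span_le]
    rintro _ ⟨p, q, a, ha, b, hb, rfl⟩
    have hmem : a * b - sgn K ((p : ℤ) * q) • (b * a) ∈ 𝒜 (p + q) :=
      sub_mem (SetLike.mul_mem_graded ha hb)
        (Submodule.smul_mem _ _ (by rw [add_comm p q]; exact SetLike.mul_mem_graded hb ha))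
    rw [SetLike.mem_coe, Submodule.mem_comap, hπ]
    by_cases h : p + q = n
    · subst h
      rw [DirectSum.decompose_of_mem_same _ hmem]
      exact Submodule.subset_span ⟨p, q, a, ha, b, hb, rfl⟩
    · rw [DirectSum.decompose_of_mem_ne _ hmem h]
      exact zero_mem _
  let P (n : ℕ) : SuperCyclic 𝒜 →ₗ[K] SuperCyclic 𝒜 := Submodule.mapQ _ _ (π n) (hker n)
  have hP : ∀ n a, P n (cyc 𝒜 a) = cyc 𝒜 (π n a) := fun n a => rfl
  rw [DirectSum.isInternal_submodule_iff_iSupIndep_and_iSup_eq_top]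
  constructor
  · intro p
    rw [Submodule.disjoint_def]
    intro x hx hx'
    rcases exists_of_mem_shiftedGrading hx with h0 | ⟨n, hn, a, ha, rfl⟩
    · exact h0
    have hle : (⨆ (j : ℤ) (_ : j ≠ p), shiftedGrading 𝒜 j) ≤ LinearMap.ker (P n) := by
      refine iSup₂_le fun j hj y hy => ?_
      rcases exists_of_mem_shiftedGrading hy with rfl | ⟨m, hm, b, hb, rfl⟩
      · exact zero_mem _
      · rw [LinearMap.mem_ker, hP, hπ, DirectSum.decompose_of_mem_ne _ hb (by omega), map_zero]
    have h1 := hle hx'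
    rwa [LinearMap.mem_ker, hP, hπ, DirectSum.decompose_of_mem_same _ ha] at h1
  · rw [eq_top_iff]
    rintro x -
    obtain ⟨a, rfl⟩ := Submodule.mkQ_surjective _ x
    induction a using DirectSum.Decomposition.inductionOn 𝒜 with
    | zero => rw [map_zero]; exact zero_mem _
    | add a b ha hb => rw [map_add]; exact add_mem ha hb
    | @homogeneous n a =>
      exact Submodule.mem_iSup_of_mem ((n : ℤ) - 1)
        (cyc_mem_shiftedGrading a.2 (by ring))

/-- The axioms of a graded Lie algebra for a bracket on the quotient can be checked on homogeneous
representatives. -/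
theorem isGradedLie_of_homogeneous [GradedAlgebra 𝒜]
    {L : SuperCyclic 𝒜 →ₗ[K] SuperCyclic 𝒜 →ₗ[K] SuperCyclic 𝒜}
    (hmem : ∀ p q : ℕ, ∀ a ∈ 𝒜 p, ∀ b ∈ 𝒜 q,
      L (cyc 𝒜 a) (cyc 𝒜 b) ∈ shiftedGrading 𝒜 ((p : ℤ) + q - 2))
    (hanti : ∀ p q : ℕ, ∀ a ∈ 𝒜 p, ∀ b ∈ 𝒜 q, L (cyc 𝒜 a) (cyc 𝒜 b) =
      -(sgn K (((p : ℤ) - 1) * ((q : ℤ) - 1)) • L (cyc 𝒜 b) (cyc 𝒜 a)))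
    (hjac : ∀ p q : ℕ, ∀ a ∈ 𝒜 p, ∀ b ∈ 𝒜 q, ∀ c : A,
      L (cyc 𝒜 a) (L (cyc 𝒜 b) (cyc 𝒜 c)) = L (L (cyc 𝒜 a) (cyc 𝒜 b)) (cyc 𝒜 c) +
        sgn K (((p : ℤ) - 1) * ((q : ℤ) - 1)) • L (cyc 𝒜 b) (L (cyc 𝒜 a) (cyc 𝒜 c))) :
    IsGradedLie (shiftedGrading 𝒜) L where
  isInternal := isInternal_shiftedGrading
  bracket_mem p q x hx y hy := by
    rcases exists_of_mem_shiftedGrading hx with rfl | ⟨m, hm, a, ha, rfl⟩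
    · simp
    rcases exists_of_mem_shiftedGrading hy with rfl | ⟨n, hn, b, hb, rfl⟩
    · simp
    have := hmem m n a ha b hb
    rwa [hm, hn, show p + 1 + (q + 1) - 2 = p + q by ring] at this
  antisymm p q x hx y hy := by
    rcases exists_of_mem_shiftedGrading hx with rfl | ⟨m, hm, a, ha, rfl⟩
    · simp
    rcases exists_of_mem_shiftedGrading hy with rfl | ⟨n, hn, b, hb, rfl⟩
    · simp
    have := hanti m n a ha b hb
    rwa [hm, hn, add_sub_cancel_right, add_sub_cancel_right] at this
  jacobi p q x hx y hy z := by
    obtain ⟨c, rfl⟩ := Submodule.mkQ_surjective _ z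
    rcases exists_of_mem_shiftedGrading hx with rfl | ⟨m, hm, a, ha, rfl⟩
    · simp
    rcases exists_of_mem_shiftedGrading hy with rfl | ⟨n, hn, b, hb, rfl⟩
    · simp
    have := hjac m n a ha b hb c
    rwa [hm, hn, add_sub_cancel_right, add_sub_cancel_right] at this

/-- Transport of a graded Lie algebra along a linear isomorphism. -/
theorem IsGradedLie.transport {V W : Type*} [AddCommGroup V] [Module K V] [AddCommGroup W]
    [Module K W] {𝒱 : ℤ → Submodule K V} {𝒲 : ℤ → Submodule K W} {L : V →ₗ[K] V →ₗ[K] V}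
    {N : W →ₗ[K] W →ₗ[K] W} (h : IsGradedLie 𝒱 L) (φ : V ≃ₗ[K] W)
    (hφ : ∀ p, (𝒱 p).map φ.toLinearMap = 𝒲 p) (hN : ∀ x y, φ (L x y) = N (φ x) (φ y)) :
    IsGradedLie 𝒲 N := by
  have hmem : ∀ p x, x ∈ 𝒲 p → ∃ y ∈ 𝒱 p, φ y = x := by
    intro p x hx
    rw [← hφ] at hx
    exact hx
  have hmem' : ∀ p x, x ∈ 𝒱 p → φ x ∈ 𝒲 p := by
    intro p x hx
    rw [← hφ]
    exact ⟨x, hx, rfl⟩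
  refine ⟨?_, ?_, ?_, ?_⟩
  · have h1 := h.isInternal
    rw [DirectSum.isInternal_submodule_iff_iSupIndep_and_iSup_eq_top] at h1 ⊢
    have h2 : 𝒲 = fun p => Submodule.orderIsoMapComap φ (𝒱 p) := funext fun p => (hφ p).symm
    constructor
    · rw [h2]
      exact (iSupIndep_map_orderIso_iff (Submodule.orderIsoMapComap φ)).2 h1.1
    · rw [h2, ← OrderIso.map_iSup, h1.2, OrderIso.map_top]
  · intro p q x hx y hy
    obtain ⟨x, hx', rfl⟩ := hmem p x hx
    obtain ⟨y, hy', rfl⟩ := hmem q y hy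
    rw [← hN]
    exact hmem' _ _ (h.bracket_mem p q x hx' y hy')
  · intro p q x hx y hy
    obtain ⟨x, hx', rfl⟩ := hmem p x hx
    obtain ⟨y, hy', rfl⟩ := hmem q y hy
    rw [← hN, h.antisymm p q x hx' y hy', map_neg, map_smul, hN]
  · intro p q x hx y hy z
    obtain ⟨x, hx', rfl⟩ := hmem p x hx
    obtain ⟨y, hy', rfl⟩ := hmem q y hy
    obtain ⟨z, rfl⟩ := φ.surjective z
    rw [← hN, ← hN, h.jacobi p q x hx' y hy' z, map_add, map_smul, hN, hN, hN, hN]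

end CyclicQuotient

/-! ### The induced bracket on `𝔻S / [𝔻S, 𝔻S]` -/

section Degrees

variable {K : Type*} [Field K] {ι : Type*} [DecidableEq ι] [Fintype ι] {d : ι → ℕ}
  [∀ i, NeZero (d i)] {S : Type*} [Ring S]
  [Algebra K S] (e : S ≃ₐ[K] ((i : ι) → Matrix (Fin (d i)) (Fin (d i)) K))

variable (K S) in
/-- The part of `𝔻S ⊗ 𝔻S` of total degree `n`; it is zero if `n` is negative. -/
noncomputable def tensorDeg (n : ℤ) : Submodule K (DAlg K S ⊗[K] DAlg K S) :=
  Submodule.span K {ξ | ∃ i j : ℕ, ∃ x ∈ DAlg.deg K S i, ∃ y ∈ DAlg.deg K S j,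
    (i : ℤ) + j = n ∧ ξ = x ⊗ₜ y}

theorem tmul_mem_tensorDeg {i j : ℕ} {x y : DAlg K S} (hx : x ∈ DAlg.deg K S i)
    (hy : y ∈ DAlg.deg K S j) {n : ℤ} (h : (i : ℤ) + j = n) : x ⊗ₜ y ∈ tensorDeg K S n :=
  Submodule.subset_span ⟨i, j, x, hx, y, hy, h, rfl⟩

theorem tensorDeg_le {M : Type*} [AddCommGroup M] [Module K M] {n : ℤ}
    {f : DAlg K S ⊗[K] DAlg K S →ₗ[K] M} {T : Submodule K M}
    (h : ∀ i j : ℕ, ∀ x ∈ DAlg.deg K S i, ∀ y ∈ DAlg.deg K S j, (i : ℤ) + j = n → f (x ⊗ₜ y) ∈ T)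
    {ξ : DAlg K S ⊗[K] DAlg K S} (hξ : ξ ∈ tensorDeg K S n) : f ξ ∈ T := by
  have : tensorDeg K S n ≤ T.comap f := by
    rw [tensorDeg, Submodule.span_le]
    rintro _ ⟨i, j, x, hx, y, hy, hij, rfl⟩
    exact h i j x hx y hy hij
  exact this hξ

theorem mul_left_mem_tensorDeg {m : ℕ} {n : ℤ} {b : DAlg K S} (hb : b ∈ DAlg.deg K S m)
    {ξ : DAlg K S ⊗[K] DAlg K S} (hξ : ξ ∈ tensorDeg K S n) :
    (b ⊗ₜ 1) * ξ ∈ tensorDeg K S (m + n) := by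
  refine tensorDeg_le (f := LinearMap.mulLeft K (b ⊗ₜ 1)) ?_ hξ
  intro i j x hx y hy hij
  rw [LinearMap.mulLeft_apply, Algebra.TensorProduct.tmul_mul_tmul, one_mul]
  exact tmul_mem_tensorDeg (SetLike.mul_mem_graded hb hx) hy (by push_cast; omega)

theorem mul_right_mem_tensorDeg {m : ℕ} {n : ℤ} {b : DAlg K S} (hb : b ∈ DAlg.deg K S m)
    {ξ : DAlg K S ⊗[K] DAlg K S} (hξ : ξ ∈ tensorDeg K S n) :
    ξ * (1 ⊗ₜ b) ∈ tensorDeg K S (n + m) := by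
  refine tensorDeg_le (f := LinearMap.mulRight K (1 ⊗ₜ b)) ?_ hξ
  intro i j x hx y hy hij
  rw [LinearMap.mulRight_apply, Algebra.TensorProduct.tmul_mul_tmul, mul_one]
  exact tmul_mem_tensorDeg hx (SetLike.mul_mem_graded hy hb) (by push_cast; omega)

include e in
/-- An outer derivation shifts all degrees by `k` if it does so on the generators. -/
theorem outer_mem_tensorDeg {δ : DAlg K S →ₗ[K] DAlg K S ⊗[K] DAlg K S} (hδ : IsOuter δ) (k : ℤ)
    (hA : ∀ s, δ (DAlg.ofA K S s) ∈ tensorDeg K S k)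
    (hE : δ (gauge K S) ∈ tensorDeg K S (k + 1)) {n : ℕ} {a : DAlg K S}
    (ha : a ∈ DAlg.deg K S n) : δ a ∈ tensorDeg K S (k + n) := by
  have := DAlg.deg_le e (F := fun n => DAlg.deg K S n ⊓ (tensorDeg K S (k + n)).comap δ)
    (fun s => ⟨DAlg.ofA_mem s, by simpa using hA s⟩) ⟨gauge_mem, by simpa using hE⟩ ?_ n ha
  · exact this.2
  · rintro m n x y ⟨hx, hx'⟩ ⟨hy, hy'⟩
    refine ⟨SetLike.mul_mem_graded hx hy, ?_⟩
    rw [SetLike.mem_coe, Submodule.mem_comap, hδ x y]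
    refine add_mem ?_ ?_
    · have := mul_left_mem_tensorDeg hx hy'
      rwa [show (m : ℤ) + (k + n) = k + (m + n : ℕ) by push_cast; ring] at this
    · have := mul_right_mem_tensorDeg hy hx'
      rwa [show k + (m : ℤ) + n = k + (m + n : ℕ) by push_cast; ring] at this

theorem partialDer_mem_tensorDeg (s : S) {n : ℕ} {a : DAlg K S} (ha : a ∈ DAlg.deg K S n) :
    partialDer e s a ∈ tensorDeg K S (n - 1) := by
  have h1 : (1 : DAlg K S) ∈ DAlg.deg K S 0 := by rw [← DAlg.ofA_one]; exact DAlg.ofA_mem 1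
  have := outer_mem_tensorDeg e (isOuter_partialDer e s) (-1)
    (fun t => by rw [partialDer_ofA]; exact zero_mem _) ?_ ha
  · rwa [neg_add_eq_sub] at this
  · rw [partialDer_gauge]
    exact sub_mem (tmul_mem_tensorDeg h1 (DAlg.ofA_mem s) rfl)
      (tmul_mem_tensorDeg (DAlg.ofA_mem s) h1 rfl)

theorem unsignedBracket_mem_tensorDeg {p q : ℕ} {a b : DAlg K S} (ha : a ∈ DAlg.deg K S p)
    (hb : b ∈ DAlg.deg K S q) : unsignedBracket e a b ∈ tensorDeg K S (p + q - 1) := by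
  have h1 : (1 : DAlg K S) ∈ DAlg.deg K S 0 := by rw [← DAlg.ofA_one]; exact DAlg.ofA_mem 1
  have := outer_mem_tensorDeg e (isOuter_unsignedBracket e a) (p - 1) ?_ ?_ hb
  · rwa [sub_add_eq_add_sub] at this
  · intro s
    rw [unsignedBracket_ofA]
    refine neg_mem (tensorDeg_le (f := flip'.toLinearMap) ?_ (partialDer_mem_tensorDeg e s ha))
    intro i j x hx y hy hij
    exact tmul_mem_tensorDeg hy hx (by omega)
  · rw [unsignedBracket_gauge]
    exact sub_mem (tmul_mem_tensorDeg h1 ha (by push_cast; ring))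
      (tmul_mem_tensorDeg ha h1 (by push_cast; ring))

variable [CharZero K]

theorem cyc_bracket_mem {p q : ℕ} {a b : DAlg K S} (ha : a ∈ DAlg.deg K S p)
    (hb : b ∈ DAlg.deg K S q) :
    cyc (DAlg.deg K S) (bracket e a b) ∈ shiftedGrading (DAlg.deg K S) ((p : ℤ) + q - 2) := by
  rw [bracket_apply (HasParity.of_mem_deg e ha)]
  refine tensorDeg_le (f := cyc (DAlg.deg K S) ∘ₗ LinearMap.mul' K _ ∘ₗ
    (parLeft e (p - 1)).toLinearMap) ?_ (unsignedBracket_mem_tensorDeg e ha hb)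
  intro i j x hx y hy hij
  simp only [LinearMap.comp_apply, AlgHom.toLinearMap_apply]
  rw [parLeft_tmul e _ (HasParity.of_mem_deg e hx), map_smul, map_smul]
  exact Submodule.smul_mem _ _ (cyc_mem_shiftedGrading (SetLike.mul_mem_graded hx hy)
    (by push_cast; omega))

omit [CharZero K] in
/-- Modulo super commutators the product does not depend on the order of the factors, up to the
sign of the graded flip. -/
theorem cyc_mul'_gradedFlip (ξ : DAlg K S ⊗[K] DAlg K S) :
    cyc (DAlg.deg K S) (LinearMap.mul' K _ (gradedFlip ξ)) =
      cyc (DAlg.deg K S) (LinearMap.mul' K _ ξ) := by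
  induction ξ with
  | zero => simp
  | add x y hx hy => simp only [map_add, hx, hy]
  | tmul x y =>
    induction x using DirectSum.Decomposition.inductionOn (DAlg.deg K S) with
    | zero => simp
    | add x x' h1 h2 => simp only [TensorProduct.add_tmul, map_add, h1, h2]
    | @homogeneous i x =>
      induction y using DirectSum.Decomposition.inductionOn (DAlg.deg K S) with
      | zero => simp
      | add y y' h1 h2 => simp only [TensorProduct.tmul_add, map_add, h1, h2]
      | @homogeneous j y =>
        rw [gradedFlip_homogeneous i j x.1 y.1 x.2 y.2, map_smul, map_smul, LinearMap.mul'_apply,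
          LinearMap.mul'_apply, ← cyc_mul_comm x.2 y.2]

theorem cyc_bracket_antisymm {p q : ℕ} {a b : DAlg K S} (ha : a ∈ DAlg.deg K S p)
    (hb : b ∈ DAlg.deg K S q) : cyc (DAlg.deg K S) (bracket e a b) =
      -(sgn K (((p : ℤ) - 1) * ((q : ℤ) - 1)) • cyc (DAlg.deg K S) (bracket e b a)) := by
  rw [bracket_def, (isDoubleSchouten_superBracket e).antisymm p q a ha b hb, map_neg, map_neg,
    map_smul, map_smul, cyc_mul'_gradedFlip, ← bracket_def]

/-- The bracket `{a, -}` maps super commutators to super commutators, since it is a derivation for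
every homogeneous `a`. -/
theorem cyc_bracket_superCommutator (a : DAlg K S) {x : DAlg K S}
    (hx : x ∈ superCommutators (DAlg.deg K S)) : cyc (DAlg.deg K S) (bracket e a x) = 0 := by
  induction a using DirectSum.Decomposition.inductionOn (DAlg.deg K S) with
  | zero => simp
  | add a b ha hb => rw [map_add, LinearMap.add_apply, map_add, ha, hb, add_zero]
  | @homogeneous p a =>
    have hle : superCommutators (DAlg.deg K S) ≤
        LinearMap.ker (cyc (DAlg.deg K S) ∘ₗ bracket e (a : DAlg K S)) := by
      refine Submodule.span_le.2 ?_
      rintro _ ⟨m, n, x, hx, y, hy, rfl⟩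
      have ha := HasParity.of_mem_deg e a.2
      have hx' := HasParity.of_mem_deg e hx
      have hy' := HasParity.of_mem_deg e hy
      have hc : ∀ {i j : ℤ} {u v : DAlg K S}, HasParity e i u → HasParity e j v →
          cyc (DAlg.deg K S) (u * v) = sgn K (i * j) • cyc (DAlg.deg K S) (v * u) := by
        intro i j u v hu hv
        have := cyc_mul'_gradedFlip (u ⊗ₜ[K] v)
        rw [gradedFlip_tmul e hu hv, map_smul, map_smul, LinearMap.mul'_apply,
          LinearMap.mul'_apply] at this
        exact this.symm
      rw [SetLike.mem_coe, LinearMap.mem_ker, LinearMap.comp_apply, map_sub, map_smul, map_sub,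
        map_smul, isTwDer_bracket ha x y, isTwDer_bracket ha y x, hx', hy', map_add, map_add,
        smul_mul_assoc, smul_mul_assoc, map_smul, map_smul, id, id,
        hc (HasParity.bracket ha hy') hx', hc hy' (HasParity.bracket ha hx'), smul_add]
      simp only [smul_smul, ← sgn_add]
      rw [sgn_of_even K (n := _ + (_ + (n : ℤ) * _)), one_smul,
        sgn_congr K (m := (m : ℤ) * n + _) (n := ((p : ℤ) - 1) * m)]
      · abel
      · simp only [Int.even_sub, Int.even_add, Int.even_mul, Int.not_even_one]
        grind
      · simp only [Int.even_sub, Int.even_add, Int.even_mul, Int.not_even_one]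
        grind
    exact hle hx

/-- In the first argument, the claim follows from the antisymmetry of the bracket modulo super
commutators. -/
theorem cyc_bracket_superCommutator_left {x : DAlg K S}
    (hx : x ∈ superCommutators (DAlg.deg K S)) (b : DAlg K S) :
    cyc (DAlg.deg K S) (bracket e x b) = 0 := by
  induction b using DirectSum.Decomposition.inductionOn (DAlg.deg K S) with
  | zero => simp
  | add a b ha hb => rw [map_add, map_add, ha, hb, add_zero]
  | @homogeneous q b =>
    have hle : superCommutators (DAlg.deg K S) ≤
        LinearMap.ker (cyc (DAlg.deg K S) ∘ₗ (bracket e).flip (b : DAlg K S)) := by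
      refine Submodule.span_le.2 ?_
      rintro _ ⟨m, n, x, hx, y, hy, rfl⟩
      have hmem : x * y - sgn K ((m : ℤ) * n) • (y * x) ∈ DAlg.deg K S (m + n) :=
        sub_mem (SetLike.mul_mem_graded hx hy)
          (Submodule.smul_mem _ _ (by rw [add_comm m n]; exact SetLike.mul_mem_graded hy hx))
      rw [SetLike.mem_coe, LinearMap.mem_ker, LinearMap.comp_apply, LinearMap.flip_apply,
        cyc_bracket_antisymm e hmem b.2, cyc_bracket_superCommutator e b.1
          (Submodule.subset_span ⟨m, n, x, hx, y, hy, rfl⟩), smul_zero, neg_zero]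
    exact hle hx

/-- The bracket that `bracket` induces on `𝔻S / [𝔻S, 𝔻S]`. -/
noncomputable def cyclicBracket : SuperCyclic (DAlg.deg K S) →ₗ[K]
    SuperCyclic (DAlg.deg K S) →ₗ[K] SuperCyclic (DAlg.deg K S) :=
  Submodule.liftQ _ (LinearMap.flip (Submodule.liftQ _
    (((bracket e).compr₂ (cyc (DAlg.deg K S))).flip) fun x hx => by
      refine LinearMap.ext fun a => ?_
      exact cyc_bracket_superCommutator e a hx)) fun x hx => by
    refine LinearMap.ext fun y => ?_
    obtain ⟨b, rfl⟩ := Submodule.mkQ_surjective _ y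
    exact cyc_bracket_superCommutator_left e hx b

theorem cyclicBracket_cyc (a b : DAlg K S) : cyclicBracket e (cyc _ a) (cyc _ b) =
    cyc (DAlg.deg K S) (bracket e a b) := rfl

theorem isGradedLie_cyclicBracket :
    IsGradedLie (shiftedGrading (DAlg.deg K S)) (cyclicBracket e) := by
  refine isGradedLie_of_homogeneous (fun p q a ha b hb => cyc_bracket_mem e ha hb)
    (fun p q a ha b hb => cyc_bracket_antisymm e ha hb) fun p q a ha b hb c => ?_
  simp only [cyclicBracket_cyc]
  rw [bracket_jacobi (HasParity.of_mem_deg e ha) (HasParity.of_mem_deg e hb), map_add, map_smul]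

end Degrees

/-! ### The path algebra -/

section PathAlgebraFacts

variable {K V : Type*} [Field K] [Quiver V] [DecidableEq V] [Fintype V]

theorem PathAlgebra.path_mem_deg {a b : V} (p : Quiver.Path a b) :
    path K p ∈ PathAlgebra.deg K V p.length :=
  Submodule.subset_span ⟨a, b, p, rfl, rfl⟩

theorem PathAlgebra.vertex_mem_deg (a : V) : vertex K a ∈ PathAlgebra.deg K V 0 :=
  path_mem_deg (K := K) (Quiver.Path.nil : Quiver.Path a a)

theorem PathAlgebra.arrow_mem_deg (a : Quiver.Total V) : arrow K a ∈ PathAlgebra.deg K V 1 :=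
  path_mem_deg a.hom.toPath

theorem PathAlgebra.sum_vertex : ∑ a : V, vertex K a = 1 := rfl

instance PathAlgebra.gradedMonoid : SetLike.GradedMonoid (PathAlgebra.deg K V) where
  one_mem := by
    rw [← sum_vertex]
    exact sum_mem fun a _ => vertex_mem_deg a
  mul_mem := by
    intro m n x y hx hy
    have h : PathAlgebra.deg K V m * PathAlgebra.deg K V n ≤ PathAlgebra.deg K V (m + n) := by
      rw [PathAlgebra.deg, PathAlgebra.deg, Submodule.span_mul_span, Submodule.span_le]
      rintro _ ⟨_, ⟨a, b, p, hp, rfl⟩, _, ⟨c, f, q, hq, rfl⟩, rfl⟩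
      change path K p * path K q ∈ _
      by_cases hbc : b = c
      · subst hbc
        rw [path_mul_comp, ← hp, ← hq, ← Quiver.Path.length_comp]
        exact path_mem_deg _
      · rw [path_mul_ne _ _ hbc]
        exact zero_mem _
    exact h (Submodule.mul_mem_mul hx hy)

theorem PathAlgebra.vertex_mul_path {a b : V} (p : Quiver.Path a b) (c : V) :
    vertex K c * path K p = if c = a then path K p else 0 := by
  split_ifs with h
  · subst h
    rw [vertex, path_mul_comp, Quiver.Path.nil_comp]
  · exact path_mul_ne _ _ h

theorem PathAlgebra.path_mul_vertex {a b : V} (p : Quiver.Path a b) (c : V) :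
    path K p * vertex K c = if b = c then path K p else 0 := by
  split_ifs with h
  · subst h
    rw [vertex, path_mul_comp, Quiver.Path.comp_nil]
  · exact path_mul_ne _ _ h

theorem PathAlgebra.vertex_mul_vertex (a b : V) :
    vertex K a * vertex K b = if a = b then vertex K a else 0 := by
  rw [vertex, path_mul_vertex]

/-- A path that is not closed is a super commutator. -/
theorem PathAlgebra.cyc_path_of_ne {a b : V} (h : a ≠ b) (p : Quiver.Path a b) :
    cyc (PathAlgebra.deg K V) (path K p) = 0 := by
  have := cyc_mul_comm (vertex_mem_deg (K := K) a) (path_mem_deg (K := K) p)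
  rwa [vertex_mul_path, if_pos rfl, path_mul_vertex, if_neg h.symm, map_zero, smul_zero] at this

end PathAlgebraFacts

/-! ### Coloured arrows -/

section Colours

variable {K : Type*} [Field K] {ι : Type*} [DecidableEq ι] [Fintype ι] {d : ι → ℕ}

theorem colouredArrow_of_arrow (a : Quiver.Total (DDQuiver d)) :
    colouredArrow K a.left a.right (prim a) (sec a) = PathAlgebra.arrow K a := by
  exact dif_neg a.hom.2

theorem colouredArrow_mem_deg (j i : DDQuiver d) (p : Fin (d i.idx)) (q : Fin (d j.idx)) :
    colouredArrow K j i p q ∈ PathAlgebra.deg K (DDQuiver d) 1 := by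
  unfold colouredArrow
  split_ifs with h
  · exact neg_mem (sum_mem fun r _ => PathAlgebra.arrow_mem_deg _)
  · exact PathAlgebra.arrow_mem_deg _

theorem vertex_mul_colouredArrow (c j i : DDQuiver d) (p : Fin (d i.idx)) (q : Fin (d j.idx)) :
    PathAlgebra.vertex K c * colouredArrow K j i p q =
      if c = j then colouredArrow K j i p q else 0 := by
  unfold colouredArrow
  split_ifs with h1 h2 h2
  · obtain ⟨rfl, -⟩ := h1
    subst h2
    rw [mul_neg, Finset.mul_sum]
    congr 1
    refine Finset.sum_congr rfl fun r _ => ?_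
    rw [PathAlgebra.arrow, PathAlgebra.vertex_mul_path, if_pos rfl]
  · obtain ⟨rfl, -⟩ := h1
    rw [mul_neg, Finset.mul_sum, Finset.sum_eq_zero, neg_zero]
    intro r _
    rw [PathAlgebra.arrow, PathAlgebra.vertex_mul_path, if_neg h2]
  · rw [PathAlgebra.arrow, PathAlgebra.vertex_mul_path, if_pos h2]
  · rw [PathAlgebra.arrow, PathAlgebra.vertex_mul_path, if_neg h2]

theorem colouredArrow_mul_vertex (c j i : DDQuiver d) (p : Fin (d i.idx)) (q : Fin (d j.idx)) :
    colouredArrow K j i p q * PathAlgebra.vertex K c =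
      if i = c then colouredArrow K j i p q else 0 := by
  unfold colouredArrow
  split_ifs with h1 h2 h2
  · obtain ⟨rfl, -⟩ := h1
    subst h2
    rw [neg_mul, Finset.sum_mul]
    congr 1
    refine Finset.sum_congr rfl fun r _ => ?_
    rw [PathAlgebra.arrow, PathAlgebra.path_mul_vertex, if_pos rfl]
  · obtain ⟨rfl, -⟩ := h1
    rw [neg_mul, Finset.sum_mul, Finset.sum_eq_zero, neg_zero]
    intro r _
    rw [PathAlgebra.arrow, PathAlgebra.path_mul_vertex, if_neg h2]
  · rw [PathAlgebra.arrow, PathAlgebra.path_mul_vertex, if_pos h2]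
  · rw [PathAlgebra.arrow, PathAlgebra.path_mul_vertex, if_neg h2]

variable [∀ i, NeZero (d i)]

/-- The loops of equal colours at a vertex sum to zero, by the convention on the colour `(1, 1)`. -/
theorem sum_colouredArrow_loop (i : DDQuiver d) : ∑ p, colouredArrow K i i p p = 0 := by
  classical
  rw [← Finset.add_sum_erase Finset.univ _ (Finset.mem_univ 0), colouredArrow,
    dif_pos ⟨rfl, rfl, rfl⟩, neg_add_eq_zero,
    Finset.sum_subtype (p := fun r => r.val ≠ 0) (Finset.univ.erase (0 : Fin (d i.idx)))]
  · refine Finset.sum_congr rfl fun r _ => ?_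
    exact (colouredArrow_of_arrow (⟨i, i, ⟨(r.1, r.1), fun h => r.2 h.2.1⟩⟩ :
      Quiver.Total (DDQuiver d))).symm
  · intro r
    simp only [Finset.mem_erase, Finset.mem_univ, and_true, ne_eq, Fin.ext_iff, Fin.val_zero]

end Colours

/-! ### The representation of `𝔻S` by matrices of paths -/

section Representation

variable {K : Type*} [Field K] {ι : Type*} [DecidableEq ι] [Fintype ι] {d : ι → ℕ}
  [∀ i, NeZero (d i)] {S : Type*} [Ring S]
  [Algebra K S] (e : S ≃ₐ[K] ((i : ι) → Matrix (Fin (d i)) (Fin (d i)) K))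

/-- `S` as an algebra of block diagonal matrices, with entries in the path algebra. -/
noncomputable def blockHom :
    S →ₐ[K] Matrix (Σ i, Fin (d i)) (Σ i, Fin (d i)) (PathAlgebra K (DDQuiver d)) :=
  AlgHom.ofLinearMap
    { toFun := fun s => (Matrix.blockDiagonal' (e s)).map (algebraMap K _)
      map_add' := fun s t => by
        rw [map_add, Matrix.blockDiagonal'_add]
        exact Matrix.map_add _ (map_add _) _ _
      map_smul' := fun c s => by
        rw [map_smul, Matrix.blockDiagonal'_smul, RingHom.id_apply]
        ext I J
        rw [Matrix.map_apply, Matrix.smul_apply, smul_eq_mul, map_mul, Matrix.smul_apply,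
          Algebra.smul_def]
        rfl }
    (by
      change (Matrix.blockDiagonal' (e 1)).map (algebraMap K _) = 1
      rw [map_one, Matrix.blockDiagonal'_one]
      exact Matrix.map_one _ (map_zero _) (map_one _))
    (fun s t => by
      change (Matrix.blockDiagonal' (e (s * t))).map (algebraMap K _) = _
      rw [map_mul]
      change (Matrix.blockDiagonal' (fun i => e s i * e t i)).map (algebraMap K _) = _
      rw [Matrix.blockDiagonal'_mul]
      exact Matrix.map_mul)

omit [∀ i, NeZero (d i)] in
theorem blockHom_apply (s : S) : blockHom e s =
    (Matrix.blockDiagonal' (e s)).map (algebraMap K (PathAlgebra K (DDQuiver d))) := rfl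

omit [∀ i, NeZero (d i)] in
theorem blockHom_matUnit (i : ι) (p q : Fin (d i)) :
    blockHom e (matUnit e i p q) = Matrix.single ⟨i, p⟩ ⟨i, q⟩ 1 := by
  rw [blockHom_apply, matUnit, AlgEquiv.apply_symm_apply]
  ext ⟨j, a⟩ ⟨k, b⟩
  rw [Matrix.map_apply, Matrix.blockDiagonal'_apply, Matrix.single_apply]
  by_cases hjk : j = k
  · subst hjk
    by_cases hij : i = j
    · subst hij
      simp [Matrix.single_apply, apply_ite (algebraMap K (PathAlgebra K (DDQuiver d)))]
    · simp [hij]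
  · have : ¬ (i = j ∧ i = k) := fun h => hjk (h.1.symm.trans h.2)
    rw [dif_neg hjk, map_zero, if_neg]
    rintro ⟨h1, h2⟩
    exact this ⟨congrArg Sigma.fst h1, congrArg Sigma.fst h2⟩

/-- The matrix of all arrows: its entry at `((j, q), (i, p))` is the arrow `j ⟶ i` of colour
`(p, q)`. -/
noncomputable def arrowMatrix (K : Type*) [Field K] (d : ι → ℕ) :
    Matrix (Σ i, Fin (d i)) (Σ i, Fin (d i)) (PathAlgebra K (DDQuiver d)) :=
  fun J I => colouredArrow K ⟨J.1⟩ ⟨I.1⟩ I.2 J.2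

/-- The matrix of arrows satisfies the defining relation of `𝔻S`: this is the convention on the
loops of colour `(1, 1)`. -/
theorem sum_row_arrowMatrix_col :
    ∑ I, blockHom e (row e I) * arrowMatrix K d * blockHom e (col e I) = 0 := by
  rw [Fintype.sum_sigma]
  refine Finset.sum_eq_zero fun i _ => ?_
  simp only [row, col, blockHom_matUnit, Matrix.single_mul_mul_single, one_mul, mul_one]
  have h : ∑ p, arrowMatrix K d ⟨i, p⟩ ⟨i, p⟩ = 0 := sum_colouredArrow_loop (K := K) ⟨i⟩
  refine (map_sum (Matrix.singleAddMonoidHom (⟨i, 0⟩ : Σ i, Fin (d i)) (⟨i, 0⟩ : Σ i, Fin (d i)))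
    (fun p => arrowMatrix K d ⟨i, p⟩ ⟨i, p⟩) Finset.univ).symm.trans ?_
  rw [h, map_zero]

/-- The representation of `𝔻S` by matrices over the path algebra, which sends the gauge element to
the matrix of all arrows. -/
noncomputable def rep :
    DAlg K S →ₐ[K] Matrix (Σ i, Fin (d i)) (Σ i, Fin (d i)) (PathAlgebra K (DDQuiver d)) :=
  DAlg.lift e (blockHom e) (arrowMatrix K d) (sum_row_arrowMatrix_col e)

theorem rep_ofA (s : S) : rep e (DAlg.ofA K S s) = blockHom e s := DAlg.lift_ofA _ _ _ _ _

theorem rep_gauge : rep e (gauge K S) = arrowMatrix K d := DAlg.lift_gauge _ _ _ _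

theorem rep_mem_deg {n : ℕ} {x : DAlg K S} (hx : x ∈ DAlg.deg K S n) (I J : Σ i, Fin (d i)) :
    rep e x I J ∈ PathAlgebra.deg K (DDQuiver d) n := by
  have := DAlg.deg_le e (F := fun n =>
    ⨅ I, ⨅ J, (PathAlgebra.deg K (DDQuiver d) n).comap
      (Matrix.entryLinearMap K _ I J ∘ₗ (rep e).toLinearMap)) ?_ ?_ ?_ n hx
  · simp only [Submodule.mem_iInf, Submodule.mem_comap] at this
    exact this I J
  · intro s
    simp only [Submodule.mem_iInf, Submodule.mem_comap]
    intro I J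
    change rep e (DAlg.ofA K S s) I J ∈ _
    rw [rep_ofA, blockHom_apply, Matrix.map_apply, Algebra.algebraMap_eq_smul_one]
    exact Submodule.smul_mem _ _ SetLike.GradedOne.one_mem
  · simp only [Submodule.mem_iInf, Submodule.mem_comap]
    intro I J
    change rep e (gauge K S) I J ∈ _
    rw [rep_gauge]
    exact colouredArrow_mem_deg _ _ _ _
  · intro m n x y hx hy
    simp only [Submodule.mem_iInf, Submodule.mem_comap] at hx hy ⊢
    intro I J
    change rep e (x * y) I J ∈ _
    rw [map_mul, Matrix.mul_apply]
    exact sum_mem fun L _ => SetLike.mul_mem_graded (hx I L) (hy L J)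

/-- The entry of `rep` at `(I, J)` is a combination of paths that begin and end compatibly:
multiplying by the vertex of `I` on the left is the same as multiplying by the vertex of `J` on the
right. -/
theorem vertex_mul_rep (x : DAlg K S) (I J : Σ i, Fin (d i)) :
    PathAlgebra.vertex K ⟨I.1⟩ * rep e x I J = rep e x I J * PathAlgebra.vertex K ⟨J.1⟩ := by
  induction x using DAlg.induction e generalizing I J with
  | hA s =>
    obtain ⟨i, p⟩ := I
    obtain ⟨j, q⟩ := J
    rw [rep_ofA, blockHom_apply, Matrix.map_apply, Matrix.blockDiagonal'_apply]
    by_cases h : i = j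
    · subst h
      exact (Algebra.commutes _ _).symm
    · rw [dif_neg h, map_zero, mul_zero, zero_mul]
  | hE =>
    rw [rep_gauge]
    change _ * colouredArrow K _ _ _ _ = colouredArrow K _ _ _ _ * _
    rw [vertex_mul_colouredArrow, colouredArrow_mul_vertex, if_pos rfl, if_pos rfl]
  | hadd x y hx hy => rw [map_add, Matrix.add_apply, mul_add, add_mul, hx, hy]
  | hmul x y hx hy =>
    rw [map_mul, Matrix.mul_apply, Finset.mul_sum, Finset.sum_mul]
    refine Finset.sum_congr rfl fun L _ => ?_
    rw [← mul_assoc, hx, mul_assoc, hy, mul_assoc]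

/-- The trace of the representation `rep`, cut down by the vertices. -/
noncomputable def repTrace : DAlg K S →ₗ[K] PathAlgebra K (DDQuiver d) :=
  ∑ I : Σ i, Fin (d i), LinearMap.mulLeft K (PathAlgebra.vertex K ⟨I.1⟩) ∘ₗ
    Matrix.entryLinearMap K _ I I ∘ₗ (rep e).toLinearMap

theorem repTrace_apply (x : DAlg K S) :
    repTrace e x = ∑ I : Σ i, Fin (d i), PathAlgebra.vertex K ⟨I.1⟩ * rep e x I I := by
  rw [repTrace, LinearMap.sum_apply]
  rfl

theorem repTrace_mem_deg {n : ℕ} {x : DAlg K S} (hx : x ∈ DAlg.deg K S n) :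
    repTrace e x ∈ PathAlgebra.deg K (DDQuiver d) n := by
  rw [repTrace_apply]
  refine sum_mem fun I _ => ?_
  have := SetLike.mul_mem_graded (PathAlgebra.vertex_mem_deg (K := K) (⟨I.1⟩ : DDQuiver d))
    (rep_mem_deg e hx I I)
  rwa [zero_add] at this

/-- The trace property of `repTrace`, modulo super commutators. -/
theorem cyc_repTrace_mul {m n : ℕ} {x y : DAlg K S} (hx : x ∈ DAlg.deg K S m)
    (hy : y ∈ DAlg.deg K S n) : cyc (PathAlgebra.deg K (DDQuiver d)) (repTrace e (x * y)) =
      sgn K ((m : ℤ) * n) • cyc (PathAlgebra.deg K (DDQuiver d)) (repTrace e (y * x)) := by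
  have h : ∀ I J : Σ i, Fin (d i), cyc (PathAlgebra.deg K (DDQuiver d))
      (PathAlgebra.vertex K ⟨I.1⟩ * (rep e x I J * rep e y J I)) = sgn K ((m : ℤ) * n) •
      cyc (PathAlgebra.deg K (DDQuiver d))
        (PathAlgebra.vertex K ⟨J.1⟩ * (rep e y J I * rep e x I J)) := by
    intro I J
    have hv := SetLike.mul_mem_graded (PathAlgebra.vertex_mem_deg (K := K) (⟨I.1⟩ : DDQuiver d))
      (rep_mem_deg e hx I J)
    rw [zero_add] at hv
    rw [← mul_assoc, cyc_mul_comm hv (rep_mem_deg e hy J I), ← mul_assoc (rep e y J I),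
      ← vertex_mul_rep, mul_assoc]
  simp only [repTrace_apply, map_mul, Matrix.mul_apply, Finset.mul_sum, map_sum, h,
    Finset.smul_sum]
  exact Finset.sum_comm

/-- The trace of `rep` induces a map from `𝔻S / [𝔻S, 𝔻S]` to the necklaces. -/
noncomputable def toNecklaces : SuperCyclic (DAlg.deg K S) →ₗ[K] Necklaces K d :=
  Submodule.liftQ _ (cyc (PathAlgebra.deg K (DDQuiver d)) ∘ₗ repTrace e) <| by
    refine Submodule.span_le.2 ?_
    rintro _ ⟨p, q, a, ha, b, hb, rfl⟩
    rw [SetLike.mem_coe, LinearMap.mem_ker, LinearMap.comp_apply, map_sub, map_sub, map_smul,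
      map_smul, cyc_repTrace_mul e ha hb, sub_self]

end Representation

/-! ### The isomorphism with the space of necklaces -/

section Realization

variable {K : Type*} [Field K] {ι : Type*} [DecidableEq ι] [Fintype ι] {d : ι → ℕ}
  [∀ i, NeZero (d i)] {S : Type*} [Ring S]
  [Algebra K S] (e : S ≃ₐ[K] ((i : ι) → Matrix (Fin (d i)) (Fin (d i)) K))

/-- The element of `𝔻S` of a path: the product of the elements of its arrows, or the idempotent of
its vertex if the path is trivial. -/
noncomputable def pathElem : ∀ {a b : DDQuiver d}, Quiver.Path a b → DAlg K S
  | a, _, .nil => genVertex e a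
  | _, _, .cons p f => pathElem p * gen e ⟨_, _, f⟩

omit [Fintype ι] in
theorem pathElem_nil (a : DDQuiver d) :
    pathElem e (Quiver.Path.nil : Quiver.Path a a) = genVertex e a := by
  rw [pathElem]

omit [Fintype ι] in
theorem pathElem_cons {a b c : DDQuiver d} (p : Quiver.Path a b) (f : b ⟶ c) :
    pathElem e (p.cons f) = pathElem e p * gen e ⟨b, c, f⟩ := by
  rw [pathElem]

omit [Fintype ι] in
theorem genVertex_eq (a : DDQuiver d) : genVertex e a = DAlg.ofA K S (idem e a.idx) := rfl

omit [Fintype ι] in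
/-- The element of an arrow is a corner of the gauge element. -/
theorem gen_eq (a : Quiver.Total (DDQuiver d)) : gen e a =
    DAlg.ofA K S (row e ⟨a.left.idx, sec a⟩) * gauge K S *
      DAlg.ofA K S (col e ⟨a.right.idx, prim a⟩) :=
  ofD_inner_tmul _ _

omit [Fintype ι] in
theorem genVertex_mul_genVertex (a b : DDQuiver d) :
    genVertex e a * genVertex e b = if a = b then genVertex e a else 0 := by
  rw [genVertex_eq, genVertex_eq, ← DAlg.ofA_mul, idem_mul_idem]
  simp only [DDQuiver.ext_iff]
  split_ifs
  · rfl
  · exact map_zero _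

omit [Fintype ι] in
theorem genVertex_mul_gen (a : Quiver.Total (DDQuiver d)) :
    genVertex e a.left * gen e a = gen e a := by
  rw [genVertex_eq, gen_eq, ← mul_assoc, ← mul_assoc, ← DAlg.ofA_mul]
  rw [idem_mul_row e ⟨a.left.idx, sec a⟩]

omit [Fintype ι] in
theorem gen_mul_genVertex (a : Quiver.Total (DDQuiver d)) :
    gen e a * genVertex e a.right = gen e a := by
  rw [genVertex_eq, gen_eq, mul_assoc, ← DAlg.ofA_mul]
  rw [col_mul_idem e ⟨a.right.idx, prim a⟩]

omit [Fintype ι] in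
theorem pathElem_mul_genVertex {a b : DDQuiver d} (p : Quiver.Path a b) :
    pathElem e p * genVertex e b = pathElem e p := by
  cases p with
  | nil => rw [pathElem_nil, genVertex_mul_genVertex, if_pos rfl]
  | cons p f => rw [pathElem_cons, mul_assoc, gen_mul_genVertex e ⟨_, _, f⟩]

omit [Fintype ι] in
theorem genVertex_mul_pathElem {a b : DDQuiver d} (p : Quiver.Path a b) :
    genVertex e a * pathElem e p = pathElem e p := by
  induction p with
  | nil => rw [pathElem_nil, genVertex_mul_genVertex, if_pos rfl]
  | cons p f ih => rw [pathElem_cons, ← mul_assoc, ih]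

omit [Fintype ι] in
theorem pathElem_comp {a b c : DDQuiver d} (p : Quiver.Path a b) (q : Quiver.Path b c) :
    pathElem e (p.comp q) = pathElem e p * pathElem e q := by
  induction q with
  | nil => rw [Quiver.Path.comp_nil, pathElem_nil, pathElem_mul_genVertex]
  | cons q f ih => rw [Quiver.Path.comp_cons, pathElem_cons, ih, pathElem_cons, mul_assoc]

omit [Fintype ι] in
theorem pathElem_mem_deg {a b : DDQuiver d} (p : Quiver.Path a b) :
    pathElem e p ∈ DAlg.deg K S p.length := by
  induction p with
  | nil =>
    rw [pathElem_nil]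
    exact DAlg.ofA_mem _
  | cons p f ih =>
    rw [pathElem_cons]
    exact SetLike.mul_mem_graded ih (DAlg.ofD_mem _)

/-- The linear map from the path algebra to `𝔻S` that sends a path to the product of the elements
of its arrows. It is multiplicative, but not unital. -/
noncomputable def realize : PathAlgebra K (DDQuiver d) →ₗ[K] DAlg K S :=
  PathAlgebra.lift fun p => pathElem e p.2.2

theorem realize_path {a b : DDQuiver d} (p : Quiver.Path a b) :
    realize e (PathAlgebra.path K p) = pathElem e p := PathAlgebra.lift_path _ p

theorem realize_vertex (a : DDQuiver d) :
    realize e (PathAlgebra.vertex K a) = genVertex e a := by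
  rw [PathAlgebra.vertex, realize_path, pathElem_nil]

theorem realize_arrow (a : Quiver.Total (DDQuiver d)) :
    realize e (PathAlgebra.arrow K a) = gen e a := by
  rw [PathAlgebra.arrow, realize_path, Quiver.Hom.toPath, pathElem_cons, pathElem_nil]
  exact genVertex_mul_gen e a

theorem realize_mul (x y : PathAlgebra K (DDQuiver d)) :
    realize e (x * y) = realize e x * realize e y := by
  have h : (LinearMap.mul K (PathAlgebra K (DDQuiver d))).compr₂ (realize e) =
      (LinearMap.mul K (DAlg K S)).compl₁₂ (realize e) (realize e) := by
    apply PathAlgebra.hom_ext; intro a b p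
    apply PathAlgebra.hom_ext; intro c f q
    change realize e (PathAlgebra.path K p * PathAlgebra.path K q) =
      realize e (PathAlgebra.path K p) * realize e (PathAlgebra.path K q)
    rw [realize_path, realize_path]
    by_cases hbc : b = c
    · subst hbc
      rw [PathAlgebra.path_mul_comp, realize_path, pathElem_comp]
    · rw [PathAlgebra.path_mul_ne _ _ hbc, map_zero, ← pathElem_mul_genVertex,
        ← genVertex_mul_pathElem e q, mul_assoc, ← mul_assoc (genVertex e b),
        genVertex_mul_genVertex, if_neg hbc, zero_mul, mul_zero]
  exact LinearMap.congr_fun₂ h x y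

theorem realize_mem_deg {n : ℕ} {x : PathAlgebra K (DDQuiver d)}
    (hx : x ∈ PathAlgebra.deg K (DDQuiver d) n) : realize e x ∈ DAlg.deg K S n := by
  have : PathAlgebra.deg K (DDQuiver d) n ≤ (DAlg.deg K S n).comap (realize e) := by
    refine Submodule.span_le.2 ?_
    rintro _ ⟨a, b, p, rfl, rfl⟩
    rw [SetLike.mem_coe, Submodule.mem_comap, realize_path]
    exact pathElem_mem_deg e p
  exact this hx

theorem realize_word {u : List (Quiver.Total (DDQuiver d))} (hu : u ≠ []) :
    realize e (PathAlgebra.word K u) = (u.map (gen e)).prod := by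
  induction u with
  | nil => exact absurd rfl hu
  | cons a u ih =>
    rw [PathAlgebra.word, List.map_cons, List.prod_cons, realize_mul, realize_arrow,
      List.map_cons, List.prod_cons]
    rcases eq_or_ne u [] with rfl | hu'
    · have h1 : realize e (1 : PathAlgebra K (DDQuiver d)) = ∑ b, genVertex e b := by
        rw [← PathAlgebra.sum_vertex, map_sum]
        exact Finset.sum_congr rfl fun b _ => realize_vertex e b
      rw [List.map_nil, List.prod_nil, List.map_nil, List.prod_nil, h1, mul_one,
        ← gen_mul_genVertex, mul_assoc, Finset.mul_sum]
      simp only [genVertex_mul_genVertex, Finset.sum_ite_eq, Finset.mem_univ, if_true]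
    · rw [← ih hu']
      rfl

/-- The element of a coloured arrow, including the excluded colour `(1, 1)`. -/
theorem realize_colouredArrow (j i : DDQuiver d) (p : Fin (d i.idx)) (q : Fin (d j.idx)) :
    realize e (colouredArrow K j i p q) =
      DAlg.ofA K S (row e ⟨j.idx, q⟩) * gauge K S * DAlg.ofA K S (col e ⟨i.idx, p⟩) := by
  by_cases h : j = i ∧ p.val = 0 ∧ q.val = 0
  · obtain ⟨rfl, hp, hq⟩ := h
    obtain rfl : p = 0 := Fin.ext (by simpa using hp)
    obtain rfl : q = 0 := Fin.ext (by simpa using hq)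
    have h1 : ∑ r, realize e (colouredArrow K j j r r) = 0 := by
      rw [← map_sum, sum_colouredArrow_loop, map_zero]
    have h2 : ∑ r, DAlg.ofA K S (row e ⟨j.idx, r⟩) * gauge K S *
        DAlg.ofA K S (col e ⟨j.idx, r⟩) = 0 := by
      have h3 : DAlg.ofA K S (idem e j.idx) * ∑ I, DAlg.ofA K S (row e I) * gauge K S *
          DAlg.ofA K S (col e I) = 0 := by rw [sum_row_gauge_col, mul_zero]
      rw [Fintype.sum_sigma, Finset.mul_sum, Finset.sum_eq_single j.idx] at h3
      · rw [← h3, Finset.mul_sum]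
        refine Finset.sum_congr rfl fun r _ => ?_
        rw [← mul_assoc, ← mul_assoc, ← DAlg.ofA_mul, idem_mul_row e ⟨j.idx, r⟩]
      · intro k _ hk
        rw [Finset.mul_sum]
        refine Finset.sum_eq_zero fun r _ => ?_
        rw [← mul_assoc, ← mul_assoc, ← DAlg.ofA_mul, row, idem, matUnit_mul_ne e hk.symm,
          map_zero, zero_mul, zero_mul]
      · simp
    rw [← Finset.add_sum_erase Finset.univ _ (Finset.mem_univ 0)] at h1 h2
    rw [eq_neg_of_add_eq_zero_left h1, eq_neg_of_add_eq_zero_left h2]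
    congr 1
    refine Finset.sum_congr rfl fun r hr => ?_
    have hr' : ¬ (j = j ∧ r.val = 0 ∧ r.val = 0) := fun h =>
      Finset.ne_of_mem_erase hr (Fin.ext (by simpa using h.2.1))
    have := colouredArrow_of_arrow (K := K)
      (⟨j, j, ⟨(r, r), hr'⟩⟩ : Quiver.Total (DDQuiver d))
    have h5 := realize_arrow e (⟨j, j, ⟨(r, r), hr'⟩⟩ : Quiver.Total (DDQuiver d))
    rw [← this, gen_eq] at h5
    exact h5
  · have := colouredArrow_of_arrow (K := K) (⟨j, i, ⟨(p, q), h⟩⟩ : Quiver.Total (DDQuiver d))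
    have h5 := realize_arrow e (⟨j, i, ⟨(p, q), h⟩⟩ : Quiver.Total (DDQuiver d))
    rw [← this, gen_eq] at h5
    exact h5

/-- The corners of an element of `𝔻S` are recovered from its matrix. -/
theorem realize_rep (x : DAlg K S) (I J : Σ i, Fin (d i)) :
    realize e (PathAlgebra.vertex K ⟨I.1⟩ * rep e x I J) =
      DAlg.ofA K S (row e I) * x * DAlg.ofA K S (col e J) := by
  induction x using DAlg.induction e generalizing I J with
  | hA s =>
    obtain ⟨i, p⟩ := I
    obtain ⟨j, q⟩ := J
    rw [rep_ofA, ← DAlg.ofA_mul, ← DAlg.ofA_mul]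
    have hs : ∀ s, realize e (PathAlgebra.vertex K ⟨i⟩ * blockHom e s ⟨i, p⟩ ⟨j, q⟩) =
        DAlg.ofA K S (row e ⟨i, p⟩ * s * col e ⟨j, q⟩) := by
      intro s
      have h : ∀ (k : ι) (a b : Fin (d k)),
          realize e (PathAlgebra.vertex K ⟨i⟩ * blockHom e (matUnit e k a b) ⟨i, p⟩ ⟨j, q⟩) =
            DAlg.ofA K S (row e ⟨i, p⟩ * matUnit e k a b * col e ⟨j, q⟩) := by
        intro k a b
        rw [blockHom_matUnit, ← col_mul_row_same, ← mul_assoc, row_mul_col, mul_assoc,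
          row_mul_col, Matrix.single_apply]
        simp only [eq_comm (a := (⟨k, a⟩ : Σ i, Fin (d i)))]
        by_cases h1 : (⟨i, p⟩ : Σ i, Fin (d i)) = ⟨k, a⟩
        · by_cases h2 : (⟨k, b⟩ : Σ i, Fin (d i)) = ⟨j, q⟩
          · rw [if_pos ⟨h1, h2⟩, if_pos h1, if_pos h2, mul_one, realize_vertex, genVertex_eq,
              idem_mul_idem, if_pos (congrArg Sigma.fst h1)]
          · rw [if_neg (fun h => h2 h.2), if_neg h2, mul_zero, mul_zero, map_zero, map_zero]
        · rw [if_neg (fun h => h1 h.1), if_neg h1, mul_zero, zero_mul, map_zero, map_zero]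
      rw [sum_matUnit e s]
      simp only [map_sum, map_smul, Matrix.sum_apply, Matrix.smul_apply, Finset.mul_sum,
        Finset.sum_mul, mul_smul_comm, smul_mul_assoc, h]
    exact hs s
  | hE =>
    rw [rep_gauge]
    change realize e (_ * colouredArrow K _ _ _ _) = _
    rw [vertex_mul_colouredArrow, if_pos rfl, realize_colouredArrow]
  | hadd x y hx hy => rw [map_add, Matrix.add_apply, mul_add, mul_add, add_mul, map_add, hx, hy]
  | hmul x y hx hy =>
    have h0 : ∑ L, DAlg.ofA K S (col e L) * DAlg.ofA K S (row e L) = 1 := by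
      simp only [← DAlg.ofA_mul]
      rw [← map_sum, sum_col_mul_row, DAlg.ofA_one]
    have h1 : x * y = ∑ L, x * DAlg.ofA K S (col e L) * (DAlg.ofA K S (row e L) * y) := by
      conv_lhs => rw [← one_mul y, ← h0, Finset.sum_mul, Finset.mul_sum]
      simp only [mul_assoc]
    rw [map_mul (rep e), Matrix.mul_apply, h1, Finset.mul_sum, Finset.mul_sum, Finset.sum_mul, map_sum]
    refine Finset.sum_congr rfl fun L _ => ?_
    have h2 : PathAlgebra.vertex K (⟨I.1⟩ : DDQuiver d) * (rep e x I L * rep e y L J) =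
        (PathAlgebra.vertex K ⟨I.1⟩ * rep e x I L) *
          (PathAlgebra.vertex K ⟨L.1⟩ * rep e y L J) := by
      rw [← mul_assoc _ (PathAlgebra.vertex K _), mul_assoc _ _ (PathAlgebra.vertex K _),
        ← vertex_mul_rep, ← mul_assoc (PathAlgebra.vertex K _) (PathAlgebra.vertex K _), PathAlgebra.vertex_mul_vertex,
        if_pos rfl, mul_assoc]
    rw [h2, realize_mul, hx, hy]
    simp only [mul_assoc]

/-- The matrix of the element of a path has the path as its only entry. -/
theorem vertex_mul_rep_pathElem {a b : DDQuiver d} (p : Quiver.Path a b)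
    (I J : Σ i, Fin (d i)) : PathAlgebra.vertex K ⟨I.1⟩ * rep e (pathElem e p) I J =
      (Matrix.single ⟨a.idx, 0⟩ ⟨b.idx, 0⟩ (PathAlgebra.path K p) :
        Matrix (Σ i, Fin (d i)) (Σ i, Fin (d i)) (PathAlgebra K (DDQuiver d))) I J := by
  induction p generalizing I J with
  | nil =>
    rw [pathElem_nil, genVertex_eq, rep_ofA, idem, blockHom_matUnit, Matrix.single_apply,
      Matrix.single_apply]
    split_ifs with h
    · rw [mul_one, ← h.1]
      rfl
    · exact mul_zero _
  | @cons b c p f ih =>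
    have h1 : rep e (gen e ⟨b, c, f⟩) =
        Matrix.single ⟨b.idx, 0⟩ ⟨c.idx, 0⟩ (PathAlgebra.arrow K ⟨b, c, f⟩) := by
      rw [gen_eq, map_mul, map_mul, rep_ofA, rep_ofA, rep_gauge, row, col, blockHom_matUnit,
        blockHom_matUnit, Matrix.single_mul_mul_single, one_mul, mul_one,
        ← colouredArrow_of_arrow]
      rfl
    rw [pathElem_cons, map_mul, Matrix.mul_apply, Finset.mul_sum]
    simp only [← mul_assoc, ih]
    rw [← Matrix.mul_apply, h1, Matrix.single_mul_single_same, PathAlgebra.arrow,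
      PathAlgebra.path_mul_comp]
    rfl

/-- A closed path is a diagonal entry of its own matrix, and paths that are not closed vanish among
the necklaces. -/
theorem cyc_repTrace_realize (x : PathAlgebra K (DDQuiver d)) :
    cyc (PathAlgebra.deg K (DDQuiver d)) (repTrace e (realize e x)) = cyc _ x := by
  have h : cyc (PathAlgebra.deg K (DDQuiver d)) ∘ₗ repTrace e ∘ₗ realize e = cyc _ := by
    refine PathAlgebra.hom_ext fun a b p => ?_
    rw [LinearMap.comp_apply, LinearMap.comp_apply, realize_path, repTrace_apply]
    simp only [vertex_mul_rep_pathElem, Matrix.single_apply]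
    rw [Finset.sum_eq_single ⟨a.idx, 0⟩]
    · split_ifs with h
      · rfl
      · rw [map_zero, PathAlgebra.cyc_path_of_ne]
        rintro rfl
        exact h ⟨rfl, rfl⟩
    · intro I _ hI
      rw [if_neg fun h => hI h.1.symm]
    · simp
  exact LinearMap.congr_fun h x

theorem cyc_ofA_mul (s : S) (x : DAlg K S) :
    cyc (DAlg.deg K S) (DAlg.ofA K S s * x) = cyc _ (x * DAlg.ofA K S s) := by
  induction x using DirectSum.Decomposition.inductionOn (DAlg.deg K S) with
  | zero => simp
  | add a b ha hb => rw [mul_add, map_add, add_mul, map_add, ha, hb]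
  | @homogeneous n a =>
    rw [cyc_mul_comm (DAlg.ofA_mem s) a.2, Nat.cast_zero, zero_mul, sgn_zero, one_smul]

/-- The trace recovers `∑ e_{1p} x e_{p1}`, which equals `x` modulo super commutators since `∑
e_{p1} e_{1p} = 1`. -/
theorem cyc_realize_repTrace (x : DAlg K S) :
    cyc (DAlg.deg K S) (realize e (repTrace e x)) = cyc _ x := by
  have h1 : x = ∑ L, DAlg.ofA K S (col e L) * (DAlg.ofA K S (row e L) * x) := by
    simp only [← mul_assoc, ← DAlg.ofA_mul]
    rw [← Finset.sum_mul, ← map_sum, sum_col_mul_row, DAlg.ofA_one, one_mul]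
  conv_rhs => rw [h1]
  rw [repTrace_apply, map_sum, map_sum, map_sum]
  refine Finset.sum_congr rfl fun I _ => ?_
  rw [realize_rep, cyc_ofA_mul]

/-- The isomorphism from `𝔻S / [𝔻S, 𝔻S]` to the space of necklaces. -/
noncomputable def necklaceEquiv : SuperCyclic (DAlg.deg K S) ≃ₗ[K] Necklaces K d :=
  LinearEquiv.ofLinearMap (toNecklaces e)
    (Submodule.liftQ _ (cyc (DAlg.deg K S) ∘ₗ realize e) <| by
      refine Submodule.span_le.2 ?_
      rintro _ ⟨p, q, a, ha, b, hb, rfl⟩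
      rw [SetLike.mem_coe, LinearMap.mem_ker, LinearMap.comp_apply, map_sub, map_sub, map_smul,
        map_smul, realize_mul, realize_mul,
        cyc_mul_comm (realize_mem_deg e ha) (realize_mem_deg e hb), sub_self])
    (by
      refine LinearMap.ext fun y => ?_
      obtain ⟨x, rfl⟩ := Submodule.mkQ_surjective _ y
      exact cyc_repTrace_realize e x)
    (by
      refine LinearMap.ext fun y => ?_
      obtain ⟨x, rfl⟩ := Submodule.mkQ_surjective _ y
      exact cyc_realize_repTrace e x)

theorem necklaceEquiv_cyc (x : DAlg K S) : necklaceEquiv e (cyc _ x) =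
    cyc (PathAlgebra.deg K (DDQuiver d)) (repTrace e x) := rfl

theorem necklaceEquiv_realize (x : PathAlgebra K (DDQuiver d)) :
    necklaceEquiv e (cyc _ (realize e x)) = cyc (PathAlgebra.deg K (DDQuiver d)) x := by
  rw [necklaceEquiv_cyc, cyc_repTrace_realize]

theorem map_shiftedGrading_necklaceEquiv (p : ℤ) :
    (shiftedGrading (DAlg.deg K S) p).map (necklaceEquiv e).toLinearMap =
      shiftedGrading (PathAlgebra.deg K (DDQuiver d)) p := by
  apply le_antisymm
  · rintro _ ⟨x, hx, rfl⟩
    rcases exists_of_mem_shiftedGrading hx with rfl | ⟨n, hn, a, ha, rfl⟩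
    · rw [map_zero]
      exact zero_mem _
    · exact cyc_mem_shiftedGrading (repTrace_mem_deg e ha) hn
  · intro x hx
    rcases exists_of_mem_shiftedGrading hx with rfl | ⟨n, hn, a, ha, rfl⟩
    · exact zero_mem _
    · exact ⟨_, cyc_mem_shiftedGrading (realize_mem_deg e ha) hn, necklaceEquiv_realize e a⟩

end Realization

/-! ### Cutting and gluing at a pair of arrows -/

section CutAndGlue

variable {K : Type*} [Field K] {ι : Type*} [DecidableEq ι] [Fintype ι] {d : ι → ℕ}
  [∀ i, NeZero (d i)] {S : Type*} [Ring S]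
  [Algebra K S] (e : S ≃ₐ[K] ((i : ι) → Matrix (Fin (d i)) (Fin (d i)) K))

theorem cyc_mul_comm_of_parity {i j : ℤ} {x y : DAlg K S} (hx : HasParity e i x)
    (hy : HasParity e j y) [CharZero K] :
    cyc (DAlg.deg K S) (x * y) = sgn K (i * j) • cyc (DAlg.deg K S) (y * x) := by
  have := cyc_mul'_gradedFlip (x ⊗ₜ[K] y)
  rw [gradedFlip_tmul e hx hy, map_smul, map_smul, LinearMap.mul'_apply,
    LinearMap.mul'_apply] at this
  exact this.symm

/-- The matrix unit at the tail of an arrow. -/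
def tailUnit (a : Quiver.Total (DDQuiver d)) : S := row e ⟨a.left.idx, sec a⟩

/-- The matrix unit at the head of an arrow. -/
def headUnit (a : Quiver.Total (DDQuiver d)) : S := col e ⟨a.right.idx, prim a⟩

omit [Fintype ι] in
theorem gen_eq_units (a : Quiver.Total (DDQuiver d)) : gen e a =
    DAlg.ofA K S (tailUnit e a) * gauge K S * DAlg.ofA K S (headUnit e a) := gen_eq e a

omit [Fintype ι] in
theorem idem_mul_tailUnit (a : Quiver.Total (DDQuiver d)) :
    idem e a.left.idx * tailUnit e a = tailUnit e a := idem_mul_row e ⟨a.left.idx, sec a⟩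

omit [Fintype ι] in
theorem headUnit_mul_idem (a : Quiver.Total (DDQuiver d)) :
    headUnit e a * idem e a.right.idx = headUnit e a := col_mul_idem e ⟨a.right.idx, prim a⟩

omit [Fintype ι] in
/-- No arrow is a loop of colour `(1, 1)`. -/
theorem idem_mul_headUnit_or (a : Quiver.Total (DDQuiver d)) (i : ι) :
    idem e i * headUnit e a = 0 ∨ tailUnit e a * idem e i = 0 := by
  rw [headUnit, tailUnit, idem_mul_col, row_mul_idem]
  by_cases h1 : i = a.right.idx ∧ prim a = 0
  · by_cases h2 : i = a.left.idx ∧ sec a = 0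
    · refine absurd ⟨?_, ?_, ?_⟩ a.hom.2
      · exact DDQuiver.ext (h2.1.symm.trans h1.1)
      · change (prim a).val = 0
        rw [h1.2, Fin.val_zero]
      · change (sec a).val = 0
        rw [h2.2, Fin.val_zero]
    · exact .inr (if_neg h2)
  · exact .inl (if_neg h1)

omit [Fintype ι] in
/-- The colours of two arrows match exactly if the units at their ends have a nonzero product. -/
theorem tailUnit_mul_headUnit (a b : Quiver.Total (DDQuiver d)) :
    DAlg.ofA K S (tailUnit e a * headUnit e b) =
      if b.right = a.left ∧ (prim b).val = (sec a).val then genVertex e a.left else 0 := by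
  have h : ((⟨a.left.idx, sec a⟩ : Σ i, Fin (d i)) = ⟨b.right.idx, prim b⟩) ↔
      (b.right = a.left ∧ (prim b).val = (sec a).val) := by
    generalize sec a = q
    generalize prim b = p
    generalize a.left = A at *
    generalize b.right = B at *
    obtain ⟨A⟩ := A
    obtain ⟨B⟩ := B
    constructor
    · intro h
      cases h
      exact ⟨rfl, rfl⟩
    · rintro ⟨h, h'⟩
      cases h
      exact congrArg _ (Fin.ext h'.symm)
  rw [tailUnit, headUnit, row_mul_col]
  simp only [h]
  split_ifs
  · rfl
  · exact map_zero _

section Term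

variable [CharZero K]
variable {e} {a b : Quiver.Total (DDQuiver d)} {p₁ p₂ q₁ q₂ : DAlg K S} {i i' j j' : ℤ}

/-- The contribution of the arrows `a` and `b` of two closed words to the bracket of the words:
`q₂ q₁` and `p₂ p₁` are the products of the other arrows, in their cyclic order. Of the six terms
of the double bracket of two generators, four vanish since loops of colour `(1, 1)` are
excluded. -/
theorem cyc_bracket_term (hp₁ : HasParity e i p₁) (hp₂ : HasParity e i' p₂)
    (hq₁ : HasParity e j' q₁) (hq₂ : HasParity e j q₂)
    (hW : ∀ x, genVertex e a.left * x = x → genVertex e a.right * (q₂ * q₁ * x) = q₂ * q₁ * x)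
    (hW' : ∀ x, x * genVertex e a.right = x →
      x * (q₂ * q₁) * genVertex e a.left = x * (q₂ * q₁))
    (hU : ∀ x, genVertex e b.left * x = x → genVertex e b.right * (p₂ * p₁ * x) = p₂ * p₁ * x)
    (hU' : ∀ x, x * genVertex e b.right = x →
      x * (p₂ * p₁) * genVertex e b.left = x * (p₂ * p₁)) (k : ℤ) :
    cyc (DAlg.deg K S) (LinearMap.mul' K _ (parLeft e k ((p₁ ⊗ₜ 1) *
      ((1 ⊗ₜ q₁) * unsignedBracket e (gen e a) (gen e b) * (q₂ ⊗ₜ 1)) * (1 ⊗ₜ p₂)))) =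
    sgn K (k * (i + 1 + j)) • cyc (DAlg.deg K S)
      (if b.right = a.left ∧ (prim b).val = (sec a).val then
        p₁ * (DAlg.ofA K S (tailUnit e b) * gauge K S * DAlg.ofA K S (headUnit e a)) *
          (q₂ * q₁) * p₂ else 0) -
    sgn K (k * (i + j)) • cyc (DAlg.deg K S)
      (if b.left = a.right ∧ (sec b).val = (prim a).val then
        p₁ * (q₂ * q₁) *
          (DAlg.ofA K S (tailUnit e a) * gauge K S * DAlg.ofA K S (headUnit e b)) * p₂
        else 0) := by
  have hE := HasParity.gauge e
  have hA := HasParity.ofA e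
  -- the sign and the word that a pure tensor `x ⊗ y` with `|x| = t` contributes
  have hΘ : ∀ (t : ℤ) (x y : DAlg K S), HasParity e t x →
      cyc (DAlg.deg K S) (LinearMap.mul' K _ (parLeft e k ((p₁ ⊗ₜ 1) *
        ((1 ⊗ₜ q₁) * (x ⊗ₜ y) * (q₂ ⊗ₜ 1)) * (1 ⊗ₜ p₂)))) =
      sgn K (k * (i + t + j)) • cyc (DAlg.deg K S) (p₁ * x * (q₂ * q₁) * y * p₂) := by
    intro t x y hx
    simp only [Algebra.TensorProduct.tmul_mul_tmul, one_mul, mul_one]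
    rw [parLeft_tmul e k ((hp₁.mul (hx.mul hq₂)).congr (j := i + t + j) (by
      rw [show i + (t + j) - (i + t + j) = 0 by ring]; exact Even.zero)), map_smul, map_smul,
      LinearMap.mul'_apply]
    simp only [mul_assoc]
  -- the terms in which the cut colours do not match
  have h2 : cyc (DAlg.deg K S) (p₁ * (DAlg.ofA K S (tailUnit e b) * gauge K S *
      DAlg.ofA K S (headUnit e b * headUnit e a)) * (q₂ * q₁) *
      DAlg.ofA K S (tailUnit e a) * p₂) = 0 := by
    rcases idem_mul_headUnit_or e a b.right.idx with h | h
    · rw [← headUnit_mul_idem e b, mul_assoc (headUnit e b), h]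
      simp
    · have h0 : DAlg.ofA K S (tailUnit e a) * (p₂ * p₁ * DAlg.ofA K S (tailUnit e b)) = 0 := by
        rw [← hU (DAlg.ofA K S (tailUnit e b)), ← mul_assoc, genVertex_eq, ← DAlg.ofA_mul, h,
          map_zero, zero_mul]
        rw [genVertex_eq, ← DAlg.ofA_mul, idem_mul_tailUnit]
      have hX := (hp₁.mul (hA (tailUnit e b)))
      have hY := (hE.mul ((hA (headUnit e b * headUnit e a)).mul ((hq₂.mul hq₁).mul
        ((hA (tailUnit e a)).mul hp₂))))
      have := cyc_mul_comm_of_parity e hX hY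
      simp only [mul_assoc] at this h0 ⊢
      rw [this, h0]
      simp
  have h3 : p₁ * DAlg.ofA K S (tailUnit e b) * (q₂ * q₁) * (DAlg.ofA K S (tailUnit e a) *
      gauge K S * DAlg.ofA K S (headUnit e a * headUnit e b)) * p₂ = 0 := by
    rcases idem_mul_headUnit_or e b a.right.idx with h | h
    · rw [← headUnit_mul_idem e a, mul_assoc (headUnit e a), h]
      simp
    · have h0 : DAlg.ofA K S (tailUnit e b) * (q₂ * q₁ * DAlg.ofA K S (tailUnit e a)) = 0 := by
        rw [← hW (DAlg.ofA K S (tailUnit e a)), ← mul_assoc, genVertex_eq, ← DAlg.ofA_mul, h,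
          map_zero, zero_mul]
        rw [genVertex_eq, ← DAlg.ofA_mul, idem_mul_tailUnit]
      simp only [← mul_assoc] at h0 ⊢
      simp only [mul_assoc p₁] at h0 ⊢
      rw [h0]
      simp
  have h4 : p₁ * (DAlg.ofA K S (tailUnit e b * tailUnit e a) * gauge K S *
      DAlg.ofA K S (headUnit e a)) * (q₂ * q₁) * DAlg.ofA K S (headUnit e b) * p₂ = 0 := by
    rcases idem_mul_headUnit_or e b a.left.idx with h | h
    · have h0 : DAlg.ofA K S (headUnit e a) * (q₂ * q₁) * DAlg.ofA K S (headUnit e b) = 0 := by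
        rw [← hW' (DAlg.ofA K S (headUnit e a)), mul_assoc, genVertex_eq, ← DAlg.ofA_mul, h,
          map_zero, mul_zero]
        rw [genVertex_eq, ← DAlg.ofA_mul, headUnit_mul_idem]
      have h0' := congrArg (· * p₂) h0
      simp only [mul_assoc, zero_mul] at h0' ⊢
      rw [h0', mul_zero, mul_zero, mul_zero]
    · rw [← idem_mul_tailUnit e a, ← mul_assoc (tailUnit e b), h]
      simp
  have h5 : cyc (DAlg.deg K S) (p₁ * DAlg.ofA K S (headUnit e a) * (q₂ * q₁) *
      (DAlg.ofA K S (tailUnit e a * tailUnit e b) * gauge K S *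
      DAlg.ofA K S (headUnit e b)) * p₂) = 0 := by
    rcases idem_mul_headUnit_or e a b.left.idx with h | h
    · have h0 : DAlg.ofA K S (headUnit e b) * (p₂ * p₁) * DAlg.ofA K S (headUnit e a) = 0 := by
        rw [← hU' (DAlg.ofA K S (headUnit e b)), mul_assoc, genVertex_eq, ← DAlg.ofA_mul, h,
          map_zero, mul_zero]
        rw [genVertex_eq, ← DAlg.ofA_mul, headUnit_mul_idem]
      have hX := (hp₁.mul (hA (headUnit e a)))
      have hY := ((hq₂.mul hq₁).mul ((hA (tailUnit e a * tailUnit e b)).mul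
        (hE.mul ((hA (headUnit e b)).mul hp₂))))
      have := cyc_mul_comm_of_parity e hX hY
      simp only [mul_assoc] at this h0 ⊢
      rw [this, h0]
      simp
    · rw [← idem_mul_tailUnit e b, ← mul_assoc (tailUnit e a), h]
      simp
  -- the two terms that survive
  have h1 : p₁ * (DAlg.ofA K S (tailUnit e b) * gauge K S * DAlg.ofA K S (headUnit e a)) *
      (q₂ * q₁) * DAlg.ofA K S (tailUnit e a * headUnit e b) * p₂ =
      if b.right = a.left ∧ (prim b).val = (sec a).val then
        p₁ * (DAlg.ofA K S (tailUnit e b) * gauge K S * DAlg.ofA K S (headUnit e a)) *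
          (q₂ * q₁) * p₂ else 0 := by
    rw [tailUnit_mul_headUnit]
    split_ifs
    · rw [hW']
      rw [genVertex_eq, mul_assoc, mul_assoc, ← DAlg.ofA_mul, headUnit_mul_idem]
    · rw [mul_zero, zero_mul]
  have h6 : p₁ * DAlg.ofA K S (tailUnit e b * headUnit e a) * (q₂ * q₁) *
      (DAlg.ofA K S (tailUnit e a) * gauge K S * DAlg.ofA K S (headUnit e b)) * p₂ =
      if b.left = a.right ∧ (sec b).val = (prim a).val then
        p₁ * (q₂ * q₁) *
          (DAlg.ofA K S (tailUnit e a) * gauge K S * DAlg.ofA K S (headUnit e b)) * p₂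
        else 0 := by
    rw [tailUnit_mul_headUnit]
    simp only [eq_comm (a := a.right), eq_comm (a := (prim a).val)]
    split_ifs with h
    · rw [mul_assoc p₁, mul_assoc p₁, h.1, mul_assoc (genVertex e _), hW]
      · simp only [mul_assoc]
      · rw [genVertex_eq, ← mul_assoc, ← mul_assoc, ← DAlg.ofA_mul, idem_mul_tailUnit]
    · simp
  have hpar : ∀ x y : S, HasParity e 1 (DAlg.ofA K S x * gauge K S * DAlg.ofA K S y) := by
    intro x y
    exact (((hA x).mul hE).mul (hA y)).congr (by norm_num)
  rw [gen_eq_units, gen_eq_units, unsignedBracket_generators]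
  simp only [mul_add, mul_sub, add_mul, sub_mul, map_add, map_sub]
  rw [hΘ 1 _ _ (hpar _ _), hΘ 1 _ _ (hpar _ _), hΘ 0 _ _ (hA _), hΘ 1 _ _ (hpar _ _),
    hΘ 0 _ _ (hA _), hΘ 0 _ _ (hA _), h1, h2, h3, h4, h5, h6]
  simp only [map_zero, smul_zero, add_zero, sub_zero, mul_add]

end Term

end CutAndGlue

/-! ### The bracket of closed words -/

section ClosedWords

variable {K : Type*} [Field K] {ι : Type*} [DecidableEq ι] [Fintype ι] {d : ι → ℕ}
  [∀ i, NeZero (d i)] {S : Type*} [Ring S]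
  [Algebra K S] (e : S ≃ₐ[K] ((i : ι) → Matrix (Fin (d i)) (Fin (d i)) K))

/-- The product in `𝔻S` of the elements of the arrows of a word. -/
noncomputable def wordElem (u : List (Quiver.Total (DDQuiver d))) : DAlg K S :=
  (u.map (gen e)).prod

omit [Fintype ι] in
theorem wordElem_cons (a : Quiver.Total (DDQuiver d)) (u : List (Quiver.Total (DDQuiver d))) :
    wordElem e (a :: u) = gen e a * wordElem e u := by
  rw [wordElem, List.map_cons, List.prod_cons, wordElem]

omit [Fintype ι] in
theorem wordElem_append (u v : List (Quiver.Total (DDQuiver d))) :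
    wordElem e (u ++ v) = wordElem e u * wordElem e v := by
  rw [wordElem, List.map_append, List.prod_append, wordElem, wordElem]

omit [Fintype ι] in
theorem wordElem_nil : wordElem e ([] : List (Quiver.Total (DDQuiver d))) = 1 := rfl

omit [Fintype ι] in
theorem wordElem_mem_deg (u : List (Quiver.Total (DDQuiver d))) :
    wordElem e u ∈ DAlg.deg K S u.length := by
  induction u with
  | nil => exact SetLike.GradedOne.one_mem
  | cons a u ih =>
    rw [wordElem_cons, List.length_cons, add_comm]
    exact SetLike.mul_mem_graded (DAlg.ofD_mem _) ih

omit [Fintype ι] in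
theorem genVertex_mul_wordElem_cons (a : Quiver.Total (DDQuiver d))
    (u : List (Quiver.Total (DDQuiver d))) :
    genVertex e a.left * wordElem e (a :: u) = wordElem e (a :: u) := by
  rw [wordElem_cons, ← mul_assoc, genVertex_mul_gen]

omit [Fintype ι] in
theorem wordElem_concat_mul_genVertex (a : Quiver.Total (DDQuiver d))
    (u : List (Quiver.Total (DDQuiver d))) :
    wordElem e (u ++ [a]) * genVertex e a.right = wordElem e (u ++ [a]) := by
  rw [wordElem_append, wordElem_cons, wordElem_nil, mul_one, mul_assoc, gen_mul_genVertex]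

omit [Fintype ι] in
/-- The arrows that follow `a` cyclically in a closed word begin at the head of `a`. -/
theorem genVertex_mul_rotated {a : Quiver.Total (DDQuiver d)}
    {u w : List (Quiver.Total (DDQuiver d))} (h : IsClosedWord (u ++ a :: w)) (x : DAlg K S)
    (hx : genVertex e a.left * x = x) :
    genVertex e a.right * (wordElem e w * wordElem e u * x) =
      wordElem e w * wordElem e u * x := by
  obtain ⟨hc, hne, hl⟩ := h
  cases w with
  | cons b w =>
    have hab : a.right = b.left := by
      rw [List.isChain_append] at hc
      exact (List.isChain_cons_cons.1 hc.2.1).1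
    rw [hab, ← mul_assoc, ← mul_assoc, genVertex_mul_wordElem_cons]
  | nil =>
    rw [List.getLast_concat] at hl
    cases u with
    | nil =>
      simp only [List.nil_append, List.head_cons] at hl
      rw [hl, wordElem_nil, one_mul, one_mul, hx]
    | cons b u =>
      simp only [List.cons_append, List.head_cons] at hl
      rw [hl, wordElem_nil, one_mul, ← mul_assoc, genVertex_mul_wordElem_cons]

omit [Fintype ι] in
/-- The arrows that precede `a` cyclically in a closed word end at the tail of `a`. -/
theorem rotated_mul_genVertex {a : Quiver.Total (DDQuiver d)}
    {u w : List (Quiver.Total (DDQuiver d))} (h : IsClosedWord (u ++ a :: w)) (x : DAlg K S)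
    (hx : x * genVertex e a.right = x) :
    x * (wordElem e w * wordElem e u) * genVertex e a.left =
      x * (wordElem e w * wordElem e u) := by
  obtain ⟨hc, hne, hl⟩ := h
  rcases List.eq_nil_or_concat' u with rfl | ⟨u, b, rfl⟩
  · simp only [List.nil_append, List.head_cons] at hl
    rcases List.eq_nil_or_concat' w with rfl | ⟨w, b, rfl⟩
    · simp only [List.getLast_singleton] at hl
      rw [← hl, wordElem_nil, mul_one, mul_one, hx]
    · have hl' : b.right = a.left := by
        rw [← hl]
        congr 1
        simp [List.getLast_cons]
      rw [← hl', wordElem_nil, mul_one, mul_assoc, wordElem_concat_mul_genVertex]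
  · have hab : b.right = a.left := by
      rw [List.append_assoc, List.isChain_append] at hc
      exact (List.isChain_cons_cons.1 hc.2.1).1
    rw [← hab, mul_assoc, mul_assoc, wordElem_concat_mul_genVertex]

omit [Fintype ι] in
/-- The Leibniz rule for a product of several factors. -/
theorem IsTwDer.map_list_prod {M : Type*} [Ring M] [Algebra K M] {L R : DAlg K S →ₐ[K] M}
    {δ : DAlg K S →ₗ[K] M} (h : IsTwDer L R δ) (u : List (Quiver.Total (DDQuiver d))) :
    δ (wordElem e u) = ∑ i : Fin u.length,
      L (wordElem e (u.take i)) * δ (gen e u[i]) * R (wordElem e (u.drop (i + 1))) := by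
  induction u with
  | nil =>
    have := h 1 1
    rw [mul_one, map_one L, map_one R, one_mul, mul_one] at this
    rw [wordElem_nil]
    simpa using this
  | cons a u ih =>
    rw [wordElem_cons, h, ih, add_comm]
    refine Eq.trans ?_ (Fin.sum_univ_succ _).symm
    congr 1
    · simp [wordElem_nil]
    · rw [Finset.mul_sum]
      refine Finset.sum_congr rfl fun i _ => ?_
      simp only [Fin.val_succ, List.take_succ_cons, wordElem_cons, map_mul, mul_assoc,
        List.drop_succ_cons]
      rfl

/-- The Leibniz rules for a pair of words: one term for each choice of an arrow in either word. -/
theorem unsignedBracket_wordElem (v u : List (Quiver.Total (DDQuiver d))) :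
    unsignedBracket e (wordElem e v) (wordElem e u) = ∑ i : Fin u.length, ∑ j : Fin v.length,
      (wordElem e (u.take i) ⊗ₜ 1) * ((1 ⊗ₜ wordElem e (v.take j)) *
        unsignedBracket e (gen e v[j]) (gen e u[i]) * (wordElem e (v.drop (j + 1)) ⊗ₜ 1)) *
        (1 ⊗ₜ wordElem e (u.drop (i + 1))) := by
  have h1 : ∀ a, IsTwDer (Algebra.TensorProduct.includeLeft : _ →ₐ[K] DAlg K S ⊗[K] DAlg K S)
      (Algebra.TensorProduct.includeRight : _ →ₐ[K] DAlg K S ⊗[K] DAlg K S)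
      (unsignedBracket e a) := fun a b c => unsignedBracket_mul_right e a b c
  have h2 : ∀ b, IsTwDer (Algebra.TensorProduct.includeRight : _ →ₐ[K] DAlg K S ⊗[K] DAlg K S)
      (Algebra.TensorProduct.includeLeft : _ →ₐ[K] DAlg K S ⊗[K] DAlg K S)
      ((unsignedBracket e).flip b) := fun b a a' => unsignedBracket_mul_left e a a' b
  rw [(h1 _).map_list_prod e u]
  refine Finset.sum_congr rfl fun i _ => ?_
  have := (h2 (gen e u[i])).map_list_prod e v
  rw [LinearMap.flip_apply] at this
  rw [this, Finset.mul_sum, Finset.sum_mul]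
  rfl

theorem realize_word_mul (u : List (Quiver.Total (DDQuiver d)))
    (x : PathAlgebra K (DDQuiver d)) :
    realize e (PathAlgebra.word K u * x) = wordElem e u * realize e x := by
  induction u with
  | nil => rw [PathAlgebra.word, List.map_nil, List.prod_nil, one_mul, wordElem_nil, one_mul]
  | cons a u ih =>
    rw [wordElem_cons, mul_assoc, ← ih, ← realize_arrow, ← realize_mul, ← mul_assoc]
    rw [PathAlgebra.word, List.map_cons, List.prod_cons]
    rfl

theorem realize_mul_word (u : List (Quiver.Total (DDQuiver d)))
    (x : PathAlgebra K (DDQuiver d)) :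
    realize e (x * PathAlgebra.word K u) = realize e x * wordElem e u := by
  induction u generalizing x with
  | nil => rw [PathAlgebra.word, List.map_nil, List.prod_nil, mul_one, wordElem_nil, mul_one]
  | cons a u ih =>
    rw [wordElem_cons, ← mul_assoc, ← realize_arrow, ← realize_mul, ← ih, mul_assoc]
    rw [PathAlgebra.word, List.map_cons, List.prod_cons]
    rfl

theorem realize_glueHeadTail (v u : List (Quiver.Total (DDQuiver d))) (i : Fin u.length)
    (j : Fin v.length) : realize e (glueHeadTail K v u i j) =
      if u[i].right = v[j].left ∧ (prim u[i]).val = (sec v[j]).val then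
        wordElem e (u.take i) * (DAlg.ofA K S (tailUnit e u[i]) * gauge K S *
          DAlg.ofA K S (headUnit e v[j])) *
          (wordElem e (v.drop (j + 1)) * wordElem e (v.take j)) * wordElem e (u.drop (i + 1))
      else 0 := by
  rw [glueHeadTail]
  split_ifs
  · rw [realize_mul_word, ← mul_assoc, realize_mul_word, realize_mul_word, realize_word_mul,
      realize_colouredArrow, ← mul_assoc (_ * _) (wordElem e (v.drop _))]
    rfl
  · exact map_zero _

theorem realize_glueTailHead (v u : List (Quiver.Total (DDQuiver d))) (i : Fin u.length)
    (j : Fin v.length) : realize e (glueTailHead K v u i j) =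
      if u[i].left = v[j].right ∧ (sec u[i]).val = (prim v[j]).val then
        wordElem e (u.take i) * (wordElem e (v.drop (j + 1)) * wordElem e (v.take j)) *
          (DAlg.ofA K S (tailUnit e v[j]) * gauge K S * DAlg.ofA K S (headUnit e u[i])) *
          wordElem e (u.drop (i + 1))
      else 0 := by
  rw [glueTailHead]
  split_ifs
  · rw [realize_mul_word, mul_assoc, mul_assoc, realize_word_mul, realize_word_mul,
      realize_word_mul, realize_colouredArrow]
    simp only [mul_assoc]
    rfl
  · exact map_zero _

omit [DecidableEq ι] [Fintype ι] [∀ i, NeZero (d i)] in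
theorem take_append_getElem_cons_drop (u : List (Quiver.Total (DDQuiver d))) (i : Fin u.length) :
    u.take i ++ u[i] :: u.drop (i + 1) = u := by
  simp

variable [CharZero K]

/-- The bracket of two closed words in `𝔻S` is given by cut and glue. -/
theorem cyc_bracket_wordElem {v u : List (Quiver.Total (DDQuiver d))} (hv : IsClosedWord v)
    (hu : IsClosedWord u) : cyc (DAlg.deg K S) (bracket e (wordElem e v) (wordElem e u)) =
      cyc _ (realize e (necklaceSum K v u)) := by
  have hpar : ∀ w : List (Quiver.Total (DDQuiver d)), HasParity e w.length (wordElem e w) :=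
    fun w => HasParity.of_mem_deg e (wordElem_mem_deg e w)
  rw [bracket_apply (hpar v), unsignedBracket_wordElem, necklaceSum]
  simp only [map_sum, map_sub, map_smul]
  refine Finset.sum_congr rfl fun i _ => Finset.sum_congr rfl fun j _ => ?_
  have hv' : IsClosedWord (v.take j ++ v[j] :: v.drop (j + 1)) := by
    rwa [take_append_getElem_cons_drop]
  have hu' : IsClosedWord (u.take i ++ u[i] :: u.drop (i + 1)) := by
    rwa [take_append_getElem_cons_drop]
  have hi : ((u.take i).length : ℤ) = i := by
    rw [List.length_take, min_eq_left i.2.le]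
  have hj : ((v.drop (j + 1)).length : ℤ) = v.length - (j + 1) := by
    rw [List.length_drop, Nat.cast_sub j.2]
    push_cast
    ring
  rw [cyc_bracket_term (hpar _) (hpar _) (hpar _) (hpar _) (genVertex_mul_rotated e hv')
    (rotated_mul_genVertex e hv') (genVertex_mul_rotated e hu') (rotated_mul_genVertex e hu'),
    realize_glueHeadTail, realize_glueTailHead, hi, hj]
  congr 2
  · apply sgn_congr
    simp only [Int.even_sub, Int.even_add, Int.even_mul, Int.not_even_one]
    grind
  · apply sgn_congr
    simp only [Int.even_sub, Int.even_add, Int.even_mul, Int.not_even_one]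
    grind

/-- The bracket with an idempotent of `S` vanishes in the quotient: a derivation maps an idempotent
`s` to an element `y` with `s y s = 0`. -/
theorem cyc_bracket_idempotent (a : DAlg K S) {s : S} (hs : s * s = s) :
    cyc (DAlg.deg K S) (bracket e a (DAlg.ofA K S s)) = 0 := by
  induction a using DirectSum.Decomposition.inductionOn (DAlg.deg K S) with
  | zero => simp
  | add a b ha hb => rw [map_add, LinearMap.add_apply, map_add, ha, hb, add_zero]
  | @homogeneous n a =>
    have h := isTwDer_bracket (HasParity.of_mem_deg e a.2) (DAlg.ofA K S s) (DAlg.ofA K S s)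
    rw [← DAlg.ofA_mul, hs, par_ofA, id] at h
    generalize bracket e (a : DAlg K S) (DAlg.ofA K S s) = y at h
    have hss : DAlg.ofA K S s * DAlg.ofA K S s = DAlg.ofA K S s := by rw [← DAlg.ofA_mul, hs]
    have h0 : DAlg.ofA K S s * y * DAlg.ofA K S s = 0 := by
      have h1 := congrArg (fun z => DAlg.ofA K S s * z * DAlg.ofA K S s) h
      simp only [mul_add, add_mul] at h1
      rw [← mul_assoc, hss, mul_assoc _ (y * _), mul_assoc y, hss, ← mul_assoc] at h1
      simpa using h1
    have h2 : cyc (DAlg.deg K S) (DAlg.ofA K S s * y) = 0 := by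
      rw [← hss, mul_assoc, cyc_ofA_mul, h0, map_zero]
    rw [h, map_add, ← cyc_ofA_mul, h2, add_zero]

/-- The bracket of necklaces, transported from `𝔻S / [𝔻S, 𝔻S]`. -/
noncomputable def necklaceBracket :
    Necklaces K d →ₗ[K] Necklaces K d →ₗ[K] Necklaces K d :=
  ((cyclicBracket e).compl₁₂ (necklaceEquiv e).symm.toLinearMap
    (necklaceEquiv e).symm.toLinearMap).compr₂ (necklaceEquiv e).toLinearMap

theorem necklaceBracket_apply (x y : Necklaces K d) : necklaceBracket e x y =
    necklaceEquiv e (cyclicBracket e ((necklaceEquiv e).symm x) ((necklaceEquiv e).symm y)) := rfl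

theorem necklaceBracket_cyc (x y : PathAlgebra K (DDQuiver d)) :
    necklaceBracket e (cyc _ x) (cyc _ y) =
      necklaceEquiv e (cyc _ (bracket e (realize e x) (realize e y))) := rfl

omit [CharZero K] in
theorem realize_word_eq_wordElem {u : List (Quiver.Total (DDQuiver d))} (hu : IsClosedWord u) :
    realize e (PathAlgebra.word K u) = wordElem e u := by
  obtain ⟨-, hne, -⟩ := hu
  exact realize_word e hne

theorem isNecklaceBracket_necklaceBracket : IsNecklaceBracket K (necklaceBracket e) where
  closed v u hv hu := by
    rw [necklaceBracket_cyc, realize_word_eq_wordElem e hv, realize_word_eq_wordElem e hu,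
      cyc_bracket_wordElem e hv hu, necklaceEquiv_realize]
  vertex_left a x := by
    obtain ⟨x, rfl⟩ := Submodule.mkQ_surjective _ x
    have hs : idem e a.idx * idem e a.idx = idem e a.idx := by
      rw [idem_mul_idem, if_pos rfl]
    have h : ∀ y, cyc (DAlg.deg K S) (bracket e (genVertex e a) y) = 0 := by
      intro y
      induction y using DirectSum.Decomposition.inductionOn (DAlg.deg K S) with
      | zero => simp
      | add y z hy hz => rw [map_add, map_add, hy, hz, add_zero]
      | @homogeneous n y =>
        rw [cyc_bracket_antisymm e (show genVertex e a ∈ DAlg.deg K S 0 from DAlg.ofA_mem _) y.2,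
          genVertex_eq, cyc_bracket_idempotent e _ hs, smul_zero, neg_zero]
    rw [necklaceBracket_cyc, realize_vertex, h, map_zero]
  vertex_right a x := by
    obtain ⟨x, rfl⟩ := Submodule.mkQ_surjective _ x
    have hs : idem e a.idx * idem e a.idx = idem e a.idx := by
      rw [idem_mul_idem, if_pos rfl]
    rw [necklaceBracket_cyc, realize_vertex, genVertex_eq, cyc_bracket_idempotent e _ hs, map_zero]

omit [CharZero K] in
/-- A nontrivial path is a word in its arrows. -/
theorem exists_word_eq_path {V : Type*} [Quiver V] [DecidableEq V] [Fintype V] {a b c : V}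
    (p : Quiver.Path a b) (f : b ⟶ c) :
    ∃ (u : List (Quiver.Total V)) (h : u ≠ []), u.IsChain (fun a b => a.right = b.left) ∧
      (u.head h).left = a ∧ (u.getLast h).right = c ∧
      PathAlgebra.word K u = PathAlgebra.path K (p.cons f) := by
  induction p generalizing c with
  | nil =>
    refine ⟨[⟨_, _, f⟩], List.cons_ne_nil _ _, List.isChain_singleton _, rfl, rfl, ?_⟩
    rw [PathAlgebra.word, List.map_cons, List.map_nil, List.prod_cons, List.prod_nil, mul_one]
    rfl
  | @cons b' b p g ih =>
    obtain ⟨u, h, hc, hh, hl, hw⟩ := ih g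
    refine ⟨u ++ [⟨_, _, f⟩], by simp, ?_, ?_, ?_, ?_⟩
    · rw [List.isChain_append]
      refine ⟨hc, List.isChain_singleton _, ?_⟩
      intro x hx y hy
      rw [List.getLast?_eq_getLast_of_ne_nil h, Option.mem_some_iff] at hx
      rw [List.head?_cons, Option.mem_some_iff] at hy
      rw [← hx, ← hy, hl]
    · rw [List.head_append_of_ne_nil h, hh]
    · simp
    · rw [PathAlgebra.word, List.map_append, List.prod_append, List.map_cons, List.map_nil,
        List.prod_cons, List.prod_nil, mul_one]
      change PathAlgebra.word K u * _ = _
      rw [hw, PathAlgebra.arrow, PathAlgebra.path_mul_comp]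
      rfl

omit [CharZero K] [∀ i, NeZero (d i)] in
/-- The space of necklaces is spanned by the vertices and the closed words. -/
theorem necklaces_hom_ext {M : Type*} [AddCommGroup M] [Module K M]
    {f g : Necklaces K d →ₗ[K] M}
    (hv : ∀ a, f (cyc _ (PathAlgebra.vertex K a)) = g (cyc _ (PathAlgebra.vertex K a)))
    (hw : ∀ u, IsClosedWord u → f (cyc _ (PathAlgebra.word K u)) =
      g (cyc _ (PathAlgebra.word K u))) : f = g := by
  refine LinearMap.ext fun y => ?_
  obtain ⟨x, rfl⟩ := Submodule.mkQ_surjective _ y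
  have h : f ∘ₗ cyc (PathAlgebra.deg K (DDQuiver d)) = g ∘ₗ cyc _ := by
    refine PathAlgebra.hom_ext fun a b p => ?_
    rw [LinearMap.comp_apply, LinearMap.comp_apply]
    by_cases hab : a = b
    · subst hab
      cases p with
      | nil => exact hv a
      | cons p q =>
        obtain ⟨u, hne, hc, hh, hl, hu⟩ := exists_word_eq_path (K := K) p q
        rw [← hu]
        exact hw u ⟨hc, hne, hl.trans hh.symm⟩
    · rw [PathAlgebra.cyc_path_of_ne hab, map_zero, map_zero]
  exact LinearMap.congr_fun h x

omit [CharZero K] [∀ i, NeZero (d i)] in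
/-- A necklace bracket is determined by its values on vertices and closed words. -/
theorem IsNecklaceBracket.unique {N N' : Necklaces K d →ₗ[K] Necklaces K d →ₗ[K] Necklaces K d}
    (h : IsNecklaceBracket K N) (h' : IsNecklaceBracket K N') : N = N' := by
  refine necklaces_hom_ext (fun a => ?_) fun v hv => necklaces_hom_ext (fun a => ?_) fun u hu => ?_
  · refine LinearMap.ext fun x => ?_
    rw [h.vertex_left, h'.vertex_left]
  · rw [h.vertex_right, h'.vertex_right]
  · rw [h.closed v u hv hu, h'.closed v u hv hu]

end ClosedWords

end NecklaceLie

theorem mainTheorem3 {K : Type*} [Field K] [IsAlgClosed K] [CharZero K]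
    {ι : Type*} [Fintype ι] [DecidableEq ι] (d : ι → ℕ) [∀ i, NeZero (d i)]
    {S : Type*} [Ring S] [Algebra K S]
    (e : S ≃ₐ[K] ((i : ι) → Matrix (Fin (d i)) (Fin (d i)) K)) :
    -- the double Schouten-Nijenhuis bracket exists and is unique
    ∃ B : DAlg K S →ₗ[K] DAlg K S →ₗ[K] DAlg K S ⊗[K] DAlg K S,
      IsDoubleSchouten B ∧ (∀ B', IsDoubleSchouten B' → B' = B) ∧
    -- the induced bracket makes the shifted quotient of `𝔻S` a graded Lie algebra
    ∃ L : SuperCyclic (DAlg.deg K S) →ₗ[K] SuperCyclic (DAlg.deg K S) →ₗ[K]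
        SuperCyclic (DAlg.deg K S),
      (∀ a b : DAlg K S, L (cyc _ a) (cyc _ b) = cyc _ (LinearMap.mul' K (DAlg K S) (B a b))) ∧
      IsGradedLie (shiftedGrading (DAlg.deg K S)) L ∧
    -- the necklace bracket is well defined, unique, and a graded Lie bracket
    ∃ N : Necklaces K d →ₗ[K] Necklaces K d →ₗ[K] Necklaces K d,
      IsNecklaceBracket K N ∧ (∀ N', IsNecklaceBracket K N' → N' = N) ∧
      IsGradedLie (shiftedGrading (PathAlgebra.deg K (DDQuiver d))) N ∧
    -- the two graded Lie algebras are isomorphic, arrows corresponding to the generators of `𝔻S`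
    ∃ φ : SuperCyclic (DAlg.deg K S) ≃ₗ[K] Necklaces K d,
      (∀ p : ℤ, (shiftedGrading (DAlg.deg K S) p).map φ.toLinearMap =
        shiftedGrading (PathAlgebra.deg K (DDQuiver d)) p) ∧
      (∀ x y, φ (L x y) = N (φ x) (φ y)) ∧
      (∀ i : DDQuiver d, φ (cyc _ (genVertex e i)) = cyc _ (PathAlgebra.vertex K i)) ∧
      (∀ u : List (Quiver.Total (DDQuiver d)), IsClosedWord u →
        φ (cyc _ (u.map (gen e)).prod) = cyc _ (PathAlgebra.word K u)) := by
  refine ⟨superBracket e, isDoubleSchouten_superBracket e,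
    fun B' hB' => IsDoubleSchouten.unique e hB' (isDoubleSchouten_superBracket e),
    cyclicBracket e, fun a b => rfl, isGradedLie_cyclicBracket e,
    necklaceBracket e, isNecklaceBracket_necklaceBracket e,
    fun N' hN' => hN'.unique (isNecklaceBracket_necklaceBracket e), ?_,
    necklaceEquiv e, map_shiftedGrading_necklaceEquiv e, ?_, ?_, ?_⟩
  · refine (isGradedLie_cyclicBracket e).transport (necklaceEquiv e)
      (map_shiftedGrading_necklaceEquiv e) fun x y => ?_
    rw [necklaceBracket_apply, LinearEquiv.symm_apply_apply, LinearEquiv.symm_apply_apply]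
  · intro x y
    rw [necklaceBracket_apply, LinearEquiv.symm_apply_apply, LinearEquiv.symm_apply_apply]
  · intro i
    rw [← realize_vertex, necklaceEquiv_realize]
  · intro u hu
    obtain ⟨-, hne, -⟩ := hu
    rw [← realize_word e hne, necklaceEquiv_realize]
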